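/- Let $\mathbb T=\mathbb R/\mathbb Z$ be the one-dimensional torus of total mass $1$, identified with $[-1/2,1/2]$, and let $T>0$. Let $J:\mathbb T\to[0,\infty)$ be smooth and even, with support contained in $(-1/2,1/2)$ and $\int_{\mathbb T}J\,dx=1$; put $D=\int_{\mathbb T}J(x)|x|^2\,dx$. Let $a<0$ and $V(u)=\frac{u^4}{4}-\frac{a u^2}{2}$. Let $H^1(\mathbb T)=W^{1,2}(\mathbb T)$, and let $H^{-1}(\mathbb T)$ be its topological dual. For $u_0\in H^{-1}(\mathbb T)$ and $g\in L^2([0,T];L^2(\mathbb T))$, a weak solution of the skeleton Cahn–Hilliard equation $$\partial_t u=\partial_{xx}^2\Big[V'(u)-\frac D2\,\partial_{xx}^2u\Big]-\sqrt2\,\partial_x g,\qquad u(0)=u_0,$$ with control $g$ is a function $u\in C([0,T];H^{-1}(\mathbb T))\cap L^2([0,T];H^1(\mathbb T))\cap L^4([0,T];L^4(\mathbb T))$ such that, for every $\psi\in C^\infty(\mathbb T)$ and every $t\in[0,T]$, $$\langle u(t),\psi\rangle=\langle u_0,\psi\rangle+\frac D2\int_0^t\!\!\int_{\mathbb T}\partial_xu\,\partial_{xxx}^3\psi\,dx\,ds+\int_0^t\!\!\int_{\mathbb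 T}V'(u)\,\partial_{xx}^2\psi\,dx\,ds+\sqrt2\int_0^t\!\!\int_{\mathbb T}g\,\partial_x\psi\,dx\,ds,$$ where $\langle\cdot,\cdot\rangle$ is the duality pairing between $H^{-1}(\mathbb T)$ and $H^1(\mathbb T)$. Theorem. For every $u_0\in H^{-1}(\mathbb T)$ and every $g\in L^2([0,T];L^2(\mathbb T))$ there exists a unique weak solution with initial datum $u_0$ and control $g$. Furthermore, let $(g_m)$ be a sequence with $g_m\rightharpoonup g$ weakly in $L^2([0,T];L^2(\mathbb T))$, let $u_m$ be the weak solution with initial datum $u_0$ and control $g_m$, and let $u$ be the weak solution with initial datum $u_0$ and control $g$. Then $$\|u_m-u\|_{L^2([0,T];L^2(\mathbb T))}\to0\qquad\text{as } m\to\infty.$$ -/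

import Mathlib

open MeasureTheory Filter Topology
open scoped ContDiff ENNReal

noncomputable section

namespace CahnHilliard

/-! ### Function spaces on the torus `𝕋 = ℝ / ℤ` (total mass one) -/

/-- The space `L²(𝕋)` of real square-integrable functions on the torus. -/
abbrev L2 : Type := Lp ℝ 2 (volume : Measure UnitAddCircle)

/-- Smooth functions on the torus, i.e. smooth `1`-periodic functions on the line. -/
structure SmoothFun where
  toFun : ℝ → ℝ
  smooth : ContDiff ℝ ∞ toFun
  periodic : Function.Periodic toFun 1

namespace SmoothFun

/-- The smooth function, seen as a continuous function on the torus. -/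
def onTorus (ψ : SmoothFun) : C(UnitAddCircle, ℝ) where
  toFun := ψ.periodic.lift
  continuous_toFun := ψ.smooth.continuous.quotient_liftOn' _

/-- The (classical) derivative of a smooth function on the torus. -/
def dx (ψ : SmoothFun) : SmoothFun where
  toFun := deriv ψ.toFun
  smooth := (contDiff_infty_iff_deriv.1 ψ.smooth).2
  periodic := fun x => by
    have h : (fun y => ψ.toFun (y + 1)) = ψ.toFun := funext ψ.periodic
    rw [← deriv_comp_add_const, h]

theorem onTorus_coe (ψ : SmoothFun) (x : ℝ) : ψ.onTorus (x : UnitAddCircle) = ψ.toFun x :=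
  rfl

theorem memLp (ψ : SmoothFun) : MemLp ψ.onTorus 2 (volume : Measure UnitAddCircle) :=
  ψ.onTorus.memLp volume ℝ

/-- The smooth function, seen as an element of `L²(𝕋)`. -/
def toL2 (ψ : SmoothFun) : L2 := ψ.memLp.toLp

theorem coeFn_toL2 (ψ : SmoothFun) : ψ.toL2 =ᵐ[volume] ψ.onTorus := ψ.memLp.coeFn_toLp

theorem integrable_mul (ψ : SmoothFun) (f : L2) :
    Integrable (fun x => f x * ψ.onTorus x) (volume : Measure UnitAddCircle) :=
  (Lp.memLp f).integrable_mul ψ.memLp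

end SmoothFun

/-- `g` is the weak derivative of `f` on the torus: `∫ f ψ' = - ∫ g ψ` for all smooth `ψ`. -/
def IsWeakDeriv (f g : L2) : Prop :=
  ∀ ψ : SmoothFun, ∫ x, f x * ψ.dx.onTorus x = -∫ x, g x * ψ.onTorus x

/-- The Sobolev space `H¹(𝕋) = W^{1,2}(𝕋)`: the pairs `(f, f')` in `L² × L²` with `f'` the weak
derivative of `f`, with the norm `‖f‖² = ‖f‖²_{L²} + ‖f'‖²_{L²}`. -/
def H1 : Submodule ℝ (WithLp 2 (L2 × L2)) where
  carrier := {p | IsWeakDeriv p.fst p.snd}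
  zero_mem' := fun ψ => by
    have h : ∀ χ : SmoothFun, ∫ x, (0 : L2) x * χ.onTorus x = 0 := fun χ => by
      rw [← integral_zero UnitAddCircle ℝ (μ := volume)]
      refine integral_congr_ae ?_
      filter_upwards [Lp.coeFn_zero ℝ 2 (volume : Measure UnitAddCircle)] with x hx
      rw [hx, Pi.zero_apply, zero_mul]
    rw [WithLp.zero_fst, WithLp.zero_snd, h, h, neg_zero]
  add_mem' := fun {p q} hp hq ψ => by
    have h : ∀ (f g : L2) (χ : SmoothFun), ∫ x, (f + g) x * χ.onTorus x =
        (∫ x, f x * χ.onTorus x) + ∫ x, g x * χ.onTorus x := fun f g χ => by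
      rw [← integral_add (χ.integrable_mul f) (χ.integrable_mul g)]
      refine integral_congr_ae ?_
      filter_upwards [Lp.coeFn_add f g] with x hx
      rw [hx, Pi.add_apply, add_mul]
    rw [WithLp.add_fst, WithLp.add_snd, h, h, hp ψ, hq ψ, neg_add]
  smul_mem' := fun c p hp ψ => by
    have h : ∀ (f : L2) (χ : SmoothFun), ∫ x, (c • f) x * χ.onTorus x =
        c * ∫ x, f x * χ.onTorus x := fun f χ => by
      rw [← integral_const_mul]
      refine integral_congr_ae ?_
      filter_upwards [Lp.coeFn_smul c f] with x hx
      rw [hx, Pi.smul_apply, smul_eq_mul, mul_assoc]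
    rw [WithLp.smul_fst, WithLp.smul_snd, h, h, hp ψ, mul_neg]

/-- The inclusion `H¹(𝕋) → L²(𝕋)`. -/
def H1.toL2 : H1 →L[ℝ] L2 := (WithLp.fstL 2 ℝ L2 L2).comp H1.subtypeL

/-- The weak derivative `∂ₓ : H¹(𝕋) → L²(𝕋)`. -/
def H1.dx : H1 →L[ℝ] L2 := (WithLp.sndL 2 ℝ L2 L2).comp H1.subtypeL

theorem SmoothFun.isWeakDeriv (ψ : SmoothFun) : IsWeakDeriv ψ.toL2 ψ.dx.toL2 := by
  intro χ
  have key : ∀ φ η : SmoothFun, ∫ x, φ.toL2 x * η.onTorus x =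
      ∫ x in (0 : ℝ)..(0 + 1), φ.toFun x * η.toFun x := fun φ η => by
    have h1 : ∫ x, φ.toL2 x * η.onTorus x =
        ∫ x : UnitAddCircle, φ.onTorus x * η.onTorus x := by
      refine integral_congr_ae ?_
      filter_upwards [φ.coeFn_toL2] with x hx
      rw [hx]
    rw [h1, ← UnitAddCircle.intervalIntegral_preimage 0]
    rfl
  have hd : ∀ (φ : SmoothFun) (x : ℝ), HasDerivAt φ.toFun (φ.dx.toFun x) x := fun φ x =>
    ((φ.smooth.differentiable (by simp)) x).hasDerivAt
  rw [key, key, intervalIntegral.integral_mul_deriv_eq_deriv_mul (fun x _ => hd ψ x)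
    (fun x _ => hd χ x) (ψ.dx.smooth.continuous.intervalIntegrable _ _)
    (χ.dx.smooth.continuous.intervalIntegrable _ _), ψ.periodic, χ.periodic]
  ring

/-- A smooth function on the torus, seen as an element of `H¹(𝕋)`. -/
def SmoothFun.toH1 (ψ : SmoothFun) : H1 :=
  ⟨WithLp.toLp 2 (ψ.toL2, ψ.dx.toL2), ψ.isWeakDeriv⟩

/-- The space `H⁻¹(𝕋)`, the topological dual of `H¹(𝕋)` with the dual norm. -/
abbrev Hm1 : Type := StrongDual ℝ H1

/-- The inclusion `L²(𝕋) ⊂ H⁻¹(𝕋)`: the function `f` acts as `φ ↦ ⟨f, φ⟩_{L²}`. -/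
def toHm1 (f : L2) : Hm1 := (innerSL ℝ f).comp H1.toL2

/-! ### The equation -/

/-- Lebesgue measure on the time interval `[0, T]`. -/
abbrev timeMeasure (T : ℝ) : Measure ℝ := volume.restrict (Set.Icc 0 T)

/-- The space `L²([0,T]; L²(𝕋))`. -/
abbrev L2L2 (T : ℝ) : Type := Lp L2 2 (timeMeasure T)

/-- The conditions on the interaction kernel `J`, a function supported in the fundamental
domain `(-1/2, 1/2)` of the torus. -/
structure IsInteractionKernel (J : ℝ → ℝ) : Prop where
  smooth : ContDiff ℝ ∞ J
  nonneg : ∀ x, 0 ≤ J x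
  even : ∀ x, J (-x) = J x
  support : tsupport J ⊆ Set.Ioo (-1 / 2) (1 / 2)
  mass : ∫ x in (-1 / 2 : ℝ)..(1 / 2), J x = 1

/-- The constant `D = ∫_𝕋 J(x) |x|² dx`. -/
def diffusionConst (J : ℝ → ℝ) : ℝ := ∫ x in (-1 / 2 : ℝ)..(1 / 2), J x * |x| ^ 2

/-- The potential `V(u) = u⁴/4 - a u²/2`. -/
def potential (a : ℝ) (u : ℝ) : ℝ := u ^ 4 / 4 - a * u ^ 2 / 2

/-- The space `C([0,T]; H⁻¹) ∩ L²([0,T]; H¹) ∩ L⁴([0,T]; L⁴)`. An element of the intersection is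
given by its continuous `H⁻¹`-valued path together with its class in `L²([0,T]; H¹)`; the two
agree (in `H⁻¹`) at almost every time, so each determines the other. -/
@[ext]
structure SolutionSpace (T : ℝ) where
  path : C(Set.Icc (0 : ℝ) T, Hm1)
  val : Lp H1 2 (timeMeasure T)
  compat : ∀ᵐ t ∂timeMeasure T, ∀ ht : t ∈ Set.Icc (0 : ℝ) T,
    path ⟨t, ht⟩ = toHm1 (H1.toL2 (val t))
  memL4 : ∫⁻ t, (∫⁻ x, ‖H1.toL2 (val t) x‖ₑ ^ 4) ∂timeMeasure T < ⊤

/-- An element of the solution space, seen in `L²([0,T]; L²(𝕋))`. -/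
def SolutionSpace.toL2L2 {T : ℝ} (u : SolutionSpace T) : L2L2 T := H1.toL2.compLp u.val

/-- `u` is a weak solution of
`∂ₜ u = ∂ₓₓ [V'(u) - (D/2) ∂ₓₓ u] - √2 ∂ₓ g` on `[0,T] × 𝕋` with initial datum `u₀`. -/
def IsWeakSolution {T : ℝ} (a D : ℝ) (u₀ : Hm1) (g : L2L2 T) (u : SolutionSpace T) : Prop :=
  ∀ (ψ : SmoothFun) (t : Set.Icc (0 : ℝ) T),
    u.path t ψ.toH1 = u₀ ψ.toH1
      + D / 2 * (∫ s in (0 : ℝ)..t, ∫ x, H1.dx (u.val s) x * ψ.dx.dx.dx.onTorus x)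
      + (∫ s in (0 : ℝ)..t, ∫ x, deriv (potential a) (H1.toL2 (u.val s) x) * ψ.dx.dx.onTorus x)
      + √2 * ∫ s in (0 : ℝ)..t, ∫ x, g s x * ψ.dx.onTorus x

end CahnHilliard

end

/-! The equation is the $\dot H^{-1}$ gradient flow of $\int V(u)+\frac D4|\partial_xu|^2$, forced
by a divergence. Because $a<0$, the potential is convex, so differences of solutions obey a strong
stability estimate. Uniqueness, existence and convergence all come from it.

The control is first moved under two derivatives. With `prim g` $=-\partial_x^{-1}g$ on mean-zero
functions, `inner_prim` turns $\sqrt2\int g\,\psi'$ into $\int\sqrt2\,$`prim g`$\,\psi''$, so a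
control only adds a term $\rho$ to $V'(u)$. `IsPerturbedSolution` allows any such $\rho$ and
therefore covers weak solutions and Galerkin approximations alike. For two perturbed solutions with
the same mean and $w=u-v$, `energy_identity` reads $\frac12\|w(t)\|_{\dot
H^{-1}}^2+\int_0^t\big(\frac D2\|\partial_xw\|^2+\langle
V'(u)-V'(v)+\rho-\sigma,w\rangle\big)ds=\frac12\|w(0)\|_{\dot H^{-1}}^2.$ Monotonicity of $V'$, in
the form $\langle V'(u)-V'(v),w\rangle\ge\frac14\|w\|_{L^4}^4$, together with Poincaré and Young
gives `energy_estimate`; uniqueness is immediate.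

The identity is derived mode by mode in a real trigonometric basis that diagonalises
$\partial_{xx}$. The delicate point is summing the modes under the time integral, since the cubic
pairing is only controlled by fourth powers of $u$ and $v$. Cesàro means solve this: the Fejér
kernel is positive with mass one, so the means of the pairing are bounded by
$C(1+\|u\|_{L^4}^4+\|v\|_{L^4}^4)$, which is integrable in time, and dominated convergence applies.

For existence, the datum is replaced by a trigonometric polynomial with the same mean and the
control by a bounded continuous one. The Ginzburg–Landau energy then bounds the Galerkin solutions
in $H^1$ uniformly in the number $N$ of frequencies, so truncating the nonlinearity costs only
$O(1/N)$. Hence a Galerkin path is an exact perturbed solution with $\rho$ close to $\sqrt2\,$`prim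
g` (`exists_galerkin`). By stability such approximations form a Cauchy sequence; no compactness
theorem is needed.

For weakly convergent controls, the identity bounds $\frac D2\int\|\partial_xw_m\|^2$ by
$|\int\langle\rho_m-\sigma,w_m\rangle|$, a product of a weakly null factor and a bounded one. High
frequencies of $w_m$ are uniformly small because $\partial_xw_m$ is bounded. In a fixed mode, the
time primitive of the forcing tends to zero uniformly, while the mode of $w_m$ is the primitive of
an $L^1$-bounded function; integrating by parts in time makes the product vanish in the limit
(`tendsto_integral_inner`). -/

noncomputable section

namespace CahnHilliard

open scoped RealInnerProductSpace

/-! ### The Hartley basis of `L²(𝕋)` -/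

/-- Continuous real functions on the torus. -/
abbrev CT : Type := C(UnitAddCircle, ℝ)

/-- The inclusion of continuous functions in `L²(𝕋)`. -/
def ctL2 : CT →L[ℝ] L2 := ContinuousMap.toLp 2 (volume : Measure UnitAddCircle) ℝ

theorem coeFn_ctL2 (f : CT) : ctL2 f =ᵐ[volume] f := ContinuousMap.coeFn_toLp _ _

theorem ctL2_injective : Function.Injective ctL2 :=
  ContinuousMap.toLp_injective (volume : Measure UnitAddCircle)

theorem SmoothFun.toL2_eq (ψ : SmoothFun) : ψ.toL2 = ctL2 ψ.onTorus :=
  Lp.ext (ψ.coeFn_toL2.trans (coeFn_ctL2 _).symm)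

theorem inner_ctL2 (f : L2) (h : CT) : ⟪f, ctL2 h⟫ = ∫ x, f x * h x := by
  rw [L2.inner_def]
  refine integral_congr_ae ?_
  filter_upwards [coeFn_ctL2 h] with x hx
  rw [hx]
  simp [mul_comm]

theorem inner_ctL2_ctL2 (f h : CT) : ⟪ctL2 f, ctL2 h⟫ = ∫ x, f x * h x := by
  rw [inner_ctL2]
  refine integral_congr_ae ?_
  filter_upwards [coeFn_ctL2 f] with x hx
  rw [hx]

theorem inner_toL2 (f : L2) (ψ : SmoothFun) : ⟪f, ψ.toL2⟫ = ∫ x, f x * ψ.onTorus x := by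
  rw [ψ.toL2_eq, inner_ctL2]

theorem CT.integrable (f : CT) : Integrable f (volume : Measure UnitAddCircle) :=
  f.continuous.integrable_of_hasCompactSupport (HasCompactSupport.of_compactSpace f)

theorem isWeakDeriv_iff (f g : L2) :
    IsWeakDeriv f g ↔ ∀ ψ : SmoothFun, ⟪f, ψ.dx.toL2⟫ = -⟪g, ψ.toL2⟫ := by
  simp only [IsWeakDeriv, inner_toL2]

/-- The function `cos (2 π n x) + sin (2 π n x)`. -/
def cas (n : ℤ) : SmoothFun where
  toFun x := Real.cos (2 * Real.pi * n * x) + Real.sin (2 * Real.pi * n * x)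
  smooth := by fun_prop
  periodic x := by
    have h : 2 * Real.pi * n * (x + 1) = 2 * Real.pi * n * x + n * (2 * Real.pi) := by ring
    simp only [h, Real.cos_add_int_mul_two_pi, Real.sin_add_int_mul_two_pi]

theorem cas_toFun (n : ℤ) (x : ℝ) :
    (cas n).toFun x = Real.cos (2 * Real.pi * n * x) + Real.sin (2 * Real.pi * n * x) := rfl

/-- Differentiation exchanges the frequencies $n$ and $-n$. This keeps the whole analysis real, with
one basis indexed by $\mathbb Z$ instead of separate sines and cosines. -/
theorem cas_dx_toFun (n : ℤ) (x : ℝ) :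
    (cas n).dx.toFun x = 2 * Real.pi * n * (cas (-n)).toFun x := by
  have h : HasDerivAt (cas n).toFun (2 * Real.pi * n * (cas (-n)).toFun x) x := by
    have h0 : HasDerivAt (fun y : ℝ => 2 * Real.pi * n * y) (2 * Real.pi * n) x := by
      simpa using (hasDerivAt_id x).const_mul (2 * Real.pi * n)
    refine (h0.cos.add h0.sin).congr_deriv ?_
    rw [cas_toFun]
    push_cast
    rw [show 2 * Real.pi * -(n : ℝ) * x = -(2 * Real.pi * n * x) by ring, Real.cos_neg,
      Real.sin_neg]
    ring
  exact h.deriv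

theorem SmoothFun.dx_const_mul {ψ χ : SmoothFun} (c : ℝ) (h : ∀ x, ψ.toFun x = c * χ.toFun x)
    (x : ℝ) : ψ.dx.toFun x = c * χ.dx.toFun x := by
  have : ψ.toFun = fun y => c * χ.toFun y := funext h
  simp only [SmoothFun.dx, this]
  exact deriv_const_mul _ ((χ.smooth.differentiable (by simp)) x)

theorem SmoothFun.onTorus_const_mul {ψ χ : SmoothFun} (c : ℝ)
    (h : ∀ x, ψ.toFun x = c * χ.toFun x) : ψ.onTorus = c • χ.onTorus := by
  ext x
  induction x using QuotientAddGroup.induction_on with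
  | H x => exact h x

theorem SmoothFun.toL2_const_mul {ψ χ : SmoothFun} (c : ℝ)
    (h : ∀ x, ψ.toFun x = c * χ.toFun x) : ψ.toL2 = c • χ.toL2 := by
  rw [ψ.toL2_eq, χ.toL2_eq, SmoothFun.onTorus_const_mul c h, map_smul]

/-- The elements of the Hartley basis. -/
def e (n : ℤ) : L2 := (cas n).toL2

theorem cas_dx_toL2 (n : ℤ) : (cas n).dx.toL2 = (2 * Real.pi * n) • e (-n) :=
  SmoothFun.toL2_const_mul _ (cas_dx_toFun n)

theorem cas_dx_dx_toFun (n : ℤ) (x : ℝ) :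
    (cas n).dx.dx.toFun x = -(2 * Real.pi * n) ^ 2 * (cas n).toFun x := by
  rw [SmoothFun.dx_const_mul _ (cas_dx_toFun n), cas_dx_toFun]
  push_cast
  rw [neg_neg]
  ring

theorem cas_dx_dx_toL2 (n : ℤ) : (cas n).dx.dx.toL2 = (-(2 * Real.pi * n) ^ 2) • e n :=
  SmoothFun.toL2_const_mul _ (cas_dx_dx_toFun n)

theorem cas_dx_dx_dx_toL2 (n : ℤ) :
    (cas n).dx.dx.dx.toL2 = (-(2 * Real.pi * n) ^ 2) • (cas n).dx.toL2 :=
  SmoothFun.toL2_const_mul _ (SmoothFun.dx_const_mul _ (cas_dx_dx_toFun n))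

theorem integral_onTorus (ψ : SmoothFun) :
    ∫ x, ψ.onTorus x = ∫ x in (0 : ℝ)..1, ψ.toFun x := by
  rw [← UnitAddCircle.intervalIntegral_preimage 0, zero_add]
  rfl

theorem integral_cas (n : ℤ) : ∫ x, (cas n).onTorus x = if n = 0 then 1 else 0 := by
  split_ifs with h
  · rw [integral_onTorus]
    simp [h, cas_toFun]
  · have h1 := SmoothFun.isWeakDeriv (cas n)
    have h2 : (cas 0).dx.toL2 = 0 := by simp [cas_dx_toL2]
    -- The function `cas 0` is constant, and $\partial_x$ `cas (-n)` is a nonzero multiple of `cas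
    -- n`; integrating a derivative against a constant gives zero.
    have h3 := (isWeakDeriv_iff _ _).1 (cas (-n)).isWeakDeriv (cas 0)
    rw [h2, inner_zero_right, cas_dx_toL2, real_inner_smul_left, zero_eq_neg, neg_neg,
      mul_eq_zero] at h3
    have h4 : ⟪e n, (cas 0).toL2⟫ = 0 := by
      refine h3.resolve_left ?_
      simpa [Real.pi_ne_zero] using h
    rw [e, inner_toL2] at h4
    rw [← h4]
    refine integral_congr_ae ?_
    filter_upwards [(cas n).coeFn_toL2] with x hx
    rw [hx]
    induction x using QuotientAddGroup.induction_on with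
    | H x =>
      have : (cas 0).onTorus (x : UnitAddCircle) = 1 := by
        rw [SmoothFun.onTorus_coe]; simp [cas_toFun]
      exact (by rw [this, mul_one])

/-- Sums `cas k + cas (-k)` are $2\cos$ and differences `cas k - cas (-k)` are $2\sin$. The product
is $\cos$ at frequency $m-n$ plus $\sin$ at frequency $m+n$, and only the cosine can have nonzero
mean. -/
theorem cas_mul_cas_toFun (m n : ℤ) (x : ℝ) : 2 * ((cas m).toFun x * (cas n).toFun x) =
    (cas (m - n)).toFun x + (cas (n - m)).toFun x + (cas (m + n)).toFun x
      - (cas (-(m + n))).toFun x := by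
  simp only [cas_toFun]
  push_cast
  rw [show 2 * Real.pi * ((m : ℝ) - n) * x = 2 * Real.pi * m * x - 2 * Real.pi * n * x by ring,
    show 2 * Real.pi * ((n : ℝ) - m) * x = 2 * Real.pi * n * x - 2 * Real.pi * m * x by ring,
    show 2 * Real.pi * ((m : ℝ) + n) * x = 2 * Real.pi * m * x + 2 * Real.pi * n * x by ring,
    show 2 * Real.pi * (-((m : ℝ) + n)) * x = -(2 * Real.pi * m * x + 2 * Real.pi * n * x) by ring]
  simp only [Real.cos_sub, Real.sin_sub, Real.cos_add, Real.sin_add, Real.cos_neg, Real.sin_neg]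
  ring

theorem inner_e_e (m n : ℤ) : ⟪e m, e n⟫ = if m = n then 1 else 0 := by
  rw [e, e, (cas m).toL2_eq, (cas n).toL2_eq, inner_ctL2_ctL2]
  have h : ∀ x, (cas m).onTorus x * (cas n).onTorus x =
      2⁻¹ * ((cas (m - n)).onTorus x + (cas (n - m)).onTorus x + (cas (m + n)).onTorus x
      - (cas (-(m + n))).onTorus x) := fun x => by
    induction x using QuotientAddGroup.induction_on with
    | H x =>
      have := cas_mul_cas_toFun m n x
      simp only [← SmoothFun.onTorus_coe] at this
      exact (by linarith)
  simp only [h]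
  have I := fun n => CT.integrable (cas n).onTorus
  have I2 := fun m n => (I m).add (I n)
  simp only [Pi.add_def] at I2
  have I3 := fun m n k => (I2 m n).add (I k)
  simp only [Pi.add_def] at I3
  rw [integral_const_mul, integral_sub (I3 _ _ _) (I _), integral_add (I2 _ _) (I _),
    integral_add (I _) (I _)]
  simp only [integral_cas, neg_eq_zero, sub_eq_zero, eq_comm (a := n)]
  split_ifs <;> norm_num

theorem orthonormal_e : Orthonormal ℝ e := by
  rw [orthonormal_iff_ite]
  exact inner_e_e

/-- Complex exponentials are combinations of `cas n` and `cas (-n)`, so all complex Fourier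
coefficients of `f` vanish and completeness of the Fourier basis applies. -/
theorem eq_zero_of_inner_e (f : L2) (hf : ∀ n, ⟪f, e n⟫ = 0) : f = 0 := by
  have hvol : (volume : Measure UnitAddCircle) = AddCircle.haarAddCircle := by
    rw [AddCircle.volume_eq_smul_haarAddCircle]; simp
  have hfL : MemLp f 2 (volume : Measure UnitAddCircle) := Lp.memLp f
  have hF : MemLp (fun x => (f x : ℂ)) 2 (AddCircle.haarAddCircle : Measure UnitAddCircle) := by
    rw [← hvol]; exact hfL.ofReal
  have hcoef : ∀ n, ∫ x, f x * (cas n).onTorus x = 0 := fun n => by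
    rw [← inner_toL2]; exact hf n
  have hpt : ∀ (n : ℤ) (x : UnitAddCircle), (fourier (-n) x : ℂ) =
      (((cas n).onTorus x + (cas (-n)).onTorus x) / 2 : ℝ) -
      (((cas n).onTorus x - (cas (-n)).onTorus x) / 2 : ℝ) * Complex.I := fun n x => by
    induction x using QuotientAddGroup.induction_on with
    | H x =>
      have h1 : (fourier (-n) (x : UnitAddCircle) : ℂ) = _ := fourier_coe_apply
      refine h1.trans ?_
      have h2 : (2 * Real.pi * Complex.I * ((-n : ℤ) : ℂ) * x / ((1 : ℝ) : ℂ)) =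
          ((-(2 * Real.pi * n * x) : ℝ) : ℂ) * Complex.I := by push_cast; ring
      rw [h2, Complex.exp_mul_I, ← Complex.ofReal_cos, ← Complex.ofReal_sin, Real.cos_neg,
        Real.sin_neg]
      have h3 : (cas n).onTorus (x : UnitAddCircle) = _ := (cas n).onTorus_coe x
      have h4 : (cas (-n)).onTorus (x : UnitAddCircle) = _ := (cas (-n)).onTorus_coe x
      rw [cas_toFun] at h3 h4
      push_cast at h4
      rw [show 2 * Real.pi * -(n : ℝ) * x = -(2 * Real.pi * n * x) by ring, Real.cos_neg,
        Real.sin_neg] at h4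
      have h3' : (cas n).onTorus (QuotientAddGroup.mk x : UnitAddCircle) = _ := h3
      have h4' : (cas (-n)).onTorus (QuotientAddGroup.mk x : UnitAddCircle) = _ := h4
      rw [h3', h4']
      push_cast
      ring
  have hI : ∀ n, Integrable (fun x => f x * (cas n).onTorus x) volume := fun n =>
    (cas n).integrable_mul f
  have h0 : ∀ n, fourierCoeff (fun x => (f x : ℂ)) n = 0 := fun n => by
    rw [fourierCoeff, ← hvol]
    have : ∀ x : UnitAddCircle, (fourier (-n) x : ℂ) • (f x : ℂ) =
        ((2⁻¹ * (f x * (cas n).onTorus x + f x * (cas (-n)).onTorus x) : ℝ) : ℂ) -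
        ((2⁻¹ * (f x * (cas n).onTorus x - f x * (cas (-n)).onTorus x) : ℝ) : ℂ) * Complex.I :=
      fun x => by
        rw [hpt, smul_eq_mul]; push_cast; ring
    simp only [this]
    rw [integral_sub, integral_mul_const, integral_complex_ofReal, integral_complex_ofReal,
      integral_const_mul, integral_const_mul, integral_add (hI _) (hI _),
      integral_sub (hI _) (hI _), hcoef, hcoef]
    · simp
    · exact (((hI n).add (hI (-n))).const_mul _).ofReal
    · exact ((((hI n).sub (hI (-n))).const_mul _).ofReal).mul_const _
  have hz : hF.toLp = 0 := by
    apply fourierBasis.repr.injective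
    ext n
    rw [fourierBasis_repr, map_zero]
    simp only [lp.coeFn_zero, Pi.zero_apply]
    rw [← h0 n, fourierCoeff, fourierCoeff]
    refine integral_congr_ae ?_
    filter_upwards [hF.coeFn_toLp] with x hx
    rw [hx]
  have hz' := hF.coeFn_toLp
  rw [hz] at hz'
  replace hz' := hz'.symm.trans (Lp.coeFn_zero ℂ 2 _)
  rw [← hvol] at hz'
  refine Lp.ext ?_
  filter_upwards [hz', Lp.coeFn_zero ℝ 2 (volume : Measure UnitAddCircle)] with x hx h0
  rw [h0]
  simpa using hx

/-- The Hartley basis as a Hilbert basis. -/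
def hartley : HilbertBasis ℤ ℝ L2 :=
  HilbertBasis.mkOfOrthogonalEqBot orthonormal_e <| by
    rw [Submodule.eq_bot_iff]
    intro f hf
    refine eq_zero_of_inner_e f fun n => ?_
    rw [real_inner_comm]
    exact hf _ (Submodule.subset_span ⟨n, rfl⟩)

theorem hartley_apply (n : ℤ) : hartley n = e n := by
  simp [hartley, HilbertBasis.coe_mkOfOrthogonalEqBot]

/-- The coefficients of `f` in the Hartley basis. -/
def coef (n : ℤ) : L2 →L[ℝ] ℝ := innerSL ℝ (e n)

theorem coef_apply (n : ℤ) (f : L2) : coef n f = ⟪e n, f⟫ := rfl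

theorem coef_apply' (n : ℤ) (f : L2) : coef n f = ⟪f, e n⟫ := by
  rw [coef_apply, real_inner_comm]

theorem coef_e (m n : ℤ) : coef m (e n) = if m = n then 1 else 0 := inner_e_e m n

theorem hasSum_coef (f : L2) : HasSum (fun n => coef n f • e n) f := by
  have h := hartley.hasSum_repr f
  simp only [HilbertBasis.repr_apply_apply, hartley_apply] at h
  exact h

theorem hasSum_coef_mul (f g : L2) : HasSum (fun n => coef n f * coef n g) ⟪f, g⟫ := by
  simpa only [hartley_apply, ← coef_apply, ← coef_apply'] using hartley.hasSum_inner_mul_inner f g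

theorem hasSum_coef_sq (f : L2) : HasSum (fun n => coef n f ^ 2) (‖f‖ ^ 2) := by
  simpa only [real_inner_self_eq_norm_sq, ← pow_two] using hasSum_coef_mul f f

theorem ext_coef {f g : L2} (h : ∀ n, coef n f = coef n g) : f = g := by
  rw [← sub_eq_zero]
  refine eq_zero_of_inner_e _ fun n => ?_
  rw [← coef_apply', map_sub, h, sub_self]

theorem exists_coef_eq {c : ℤ → ℝ} (hc : Summable fun n => c n ^ 2) :
    ∃ f : L2, ∀ n, coef n f = c n := by
  have hm : Memℓp c 2 := by
    rw [memℓp_gen_iff (by norm_num)]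
    simpa using hc
  refine ⟨hartley.repr.symm ⟨c, hm⟩, fun n => ?_⟩
  rw [coef_apply, ← hartley_apply, ← HilbertBasis.repr_apply_apply,
    LinearIsometryEquiv.apply_symm_apply]

/-! ### The space `H¹(𝕋)` -/

theorem H1.toL2_apply (φ : H1) : H1.toL2 φ = φ.1.fst := rfl

theorem H1.dx_apply (φ : H1) : H1.dx φ = φ.1.snd := rfl

theorem SmoothFun.toH1_toL2 (ψ : SmoothFun) : H1.toL2 ψ.toH1 = ψ.toL2 := rfl

theorem H1.inner_dx (φ : H1) (ψ : SmoothFun) :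
    ⟪H1.dx φ, ψ.toL2⟫ = -⟪H1.toL2 φ, ψ.dx.toL2⟫ := by
  have := (isWeakDeriv_iff _ _).1 φ.2 ψ
  rw [H1.toL2_apply, H1.dx_apply, this, neg_neg]

theorem H1.norm_sq (φ : H1) : ‖φ‖ ^ 2 = ‖H1.toL2 φ‖ ^ 2 + ‖H1.dx φ‖ ^ 2 := by
  rw [show ‖φ‖ = ‖(φ : WithLp 2 (L2 × L2))‖ from rfl, WithLp.prod_norm_sq_eq_of_L2]
  rfl

theorem H1.norm_toL2_le (φ : H1) : ‖H1.toL2 φ‖ ≤ ‖φ‖ := by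
  refine le_of_sq_le_sq ?_ (norm_nonneg _)
  rw [H1.norm_sq φ]
  nlinarith [sq_nonneg ‖H1.dx φ‖]

theorem H1.norm_dx_le (φ : H1) : ‖H1.dx φ‖ ≤ ‖φ‖ := by
  refine le_of_sq_le_sq ?_ (norm_nonneg _)
  rw [H1.norm_sq φ]
  nlinarith [sq_nonneg ‖H1.toL2 φ‖]

theorem H1.isClosed : IsClosed (H1 : Set (WithLp 2 (L2 × L2))) := by
  have : (H1 : Set (WithLp 2 (L2 × L2))) =
      ⋂ ψ : SmoothFun, {p | ⟪p.fst, ψ.dx.toL2⟫ = -⟪p.snd, ψ.toL2⟫} := by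
    ext p
    rw [Set.mem_iInter]
    exact isWeakDeriv_iff _ _
  rw [this]
  refine isClosed_iInter fun ψ => isClosed_eq ?_ ?_
  · exact ((WithLp.fstL 2 ℝ L2 L2).continuous).inner continuous_const
  · exact (((WithLp.sndL 2 ℝ L2 L2).continuous).inner continuous_const).neg

instance : CompleteSpace H1 := H1.isClosed.completeSpace_coe

theorem H1.ext_toL2 {φ χ : H1} (h : H1.toL2 φ = H1.toL2 χ) : φ = χ := by
  have hd : H1.dx φ = H1.dx χ := by
    refine ext_coef fun n => ?_
    rw [coef_apply', coef_apply', e, H1.inner_dx, H1.inner_dx, h]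
  refine Subtype.ext ?_
  exact (WithLp.equiv 2 (L2 × L2)).injective (Prod.ext h hd)

/-- The Hartley basis in `H¹(𝕋)`. -/
def casH1 (n : ℤ) : H1 := (cas n).toH1

theorem casH1_toL2 (n : ℤ) : H1.toL2 (casH1 n) = e n := rfl

theorem casH1_dx (n : ℤ) : H1.dx (casH1 n) = (2 * Real.pi * n) • e (-n) := cas_dx_toL2 n

theorem coef_dx (φ : H1) (n : ℤ) :
    coef n (H1.dx φ) = -(2 * Real.pi * n) * coef (-n) (H1.toL2 φ) := by
  rw [coef_apply', coef_apply', e, H1.inner_dx, cas_dx_toL2, real_inner_smul_right]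
  ring

theorem coef_neg_dx (φ : H1) (n : ℤ) :
    coef (-n) (H1.dx φ) = 2 * Real.pi * n * coef n (H1.toL2 φ) := by
  rw [coef_dx, neg_neg]
  push_cast
  ring

/-- The eigenvalues of `-∂ₓₓ`. -/
def lam (n : ℤ) : ℝ := (2 * Real.pi * n) ^ 2

theorem lam_nonneg (n : ℤ) : 0 ≤ lam n := sq_nonneg _

theorem lam_zero : lam 0 = 0 := by simp [lam]

theorem sq_le_lam (n : ℤ) : (n : ℝ) ^ 2 ≤ lam n := by
  rw [lam, mul_pow]
  have : (1 : ℝ) ≤ (2 * Real.pi) ^ 2 := by nlinarith [Real.pi_gt_three]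
  nlinarith [sq_nonneg (n : ℝ)]

theorem one_le_lam {n : ℤ} (hn : n ≠ 0) : 1 ≤ lam n := by
  refine le_trans ?_ (sq_le_lam n)
  have : (1 : ℤ) ≤ n ^ 2 := by have := sq_pos_of_ne_zero hn; lia
  exact_mod_cast this

theorem hasSum_lam (φ : H1) :
    HasSum (fun n => lam n * coef n (H1.toL2 φ) ^ 2) (‖H1.dx φ‖ ^ 2) := by
  have h := (Equiv.neg ℤ).hasSum_iff.2 (hasSum_coef_sq (H1.dx φ))
  refine h.congr_fun ?_
  intro n
  simp only [Function.comp_apply, Equiv.neg_apply, coef_neg_dx, lam]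
  ring

/-- Differentiation maps the expansion of $\varphi$ to that of $\varphi'$ up to the reflection
$n\mapsto-n$, so both components converge in $L^2$. -/
theorem hasSum_casH1 (φ : H1) : HasSum (fun n => coef n (H1.toL2 φ) • casH1 n) φ := by
  have h1 := hasSum_coef (H1.toL2 φ)
  have h2 : HasSum (fun n => coef n (H1.toL2 φ) • H1.dx (casH1 n)) (H1.dx φ) := by
    have h := (Equiv.neg ℤ).hasSum_iff.2 (hasSum_coef (H1.dx φ))
    refine h.congr_fun ?_
    intro n
    simp only [Function.comp_apply, Equiv.neg_apply, coef_neg_dx, casH1_dx, smul_smul]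
    congr 1
    ring
  have h3 := h1.prodMk h2
  have h4 := (WithLp.prodContinuousLinearEquiv 2 ℝ L2 L2).symm.toContinuousLinearMap.hasSum h3
  have h5 : HasSum (fun n => ((coef n (H1.toL2 φ) • casH1 n : H1) : WithLp 2 (L2 × L2)))
      (φ : WithLp 2 (L2 × L2)) := h4
  have hi : IsInducing ((↑) : H1 → WithLp 2 (L2 × L2)) := IsInducing.subtypeVal
  exact (hi.hasSum_iff (g := H1.subtype) _ _).1 h5

/-! ### The embedding `H¹(𝕋) ⊂ C(𝕋)` -/

theorem norm_cas_le (n : ℤ) : ‖(cas n).onTorus‖ ≤ 2 := by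
  rw [ContinuousMap.norm_le _ (by norm_num)]
  intro x
  induction x using QuotientAddGroup.induction_on with
  | H x =>
    have h : (cas n).onTorus (QuotientAddGroup.mk x : UnitAddCircle) = _ := (cas n).onTorus_coe x
    rw [h, cas_toFun, Real.norm_eq_abs]
    refine (abs_add_le _ _).trans ?_
    linarith [Real.abs_cos_le_one (2 * Real.pi * n * x), Real.abs_sin_le_one (2 * Real.pi * n * x)]

theorem summable_abs_coef (φ : H1) : Summable fun n => |coef n (H1.toL2 φ)| := by
  have h0 : Summable fun n : ℤ => 1 / (n : ℝ) ^ 2 := Real.summable_one_div_int_pow.2 (by norm_num)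
  have h1 : Summable fun n : ℤ => if n = 0 then |coef 0 (H1.toL2 φ)| else 0 :=
    summable_of_ne_finset_zero (s := {0}) fun n hn => by
      simp only [Finset.mem_singleton] at hn
      simp [hn]
  refine Summable.of_nonneg_of_le (fun _ => abs_nonneg _) (fun n => ?_)
    ((h0.add (hasSum_lam φ).summable).add h1)
  by_cases hn : n = 0
  · subst hn
    simp [lam_zero]
  · simp only [hn, if_false, add_zero]
    have h2 := sq_le_lam n
    have hpos : 0 < (n : ℝ) ^ 2 := by positivity
    have h3 : (n : ℝ) ^ 2 * coef n (H1.toL2 φ) ^ 2 ≤ lam n * coef n (H1.toL2 φ) ^ 2 :=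
      mul_le_mul_of_nonneg_right h2 (sq_nonneg _)
    refine le_trans ?_ (add_le_add_right h3 _)
    set c := |coef n (H1.toL2 φ)|
    have hc : coef n (H1.toL2 φ) ^ 2 = c ^ 2 := (sq_abs _).symm
    rw [hc]
    -- Expanding the square gives $2|c_n|\le n^{-2}+n^2c_n^2$, with both right-hand terms summable.
    -- Mode $0$ is dominated by the separate summand `h1`.
    have h5 : 0 ≤ (1 / |(n : ℝ)| - |(n : ℝ)| * c) ^ 2 := sq_nonneg _
    have h6 : |(n : ℝ)| ≠ 0 := by positivity
    have h7 : (1 / |(n : ℝ)| - |(n : ℝ)| * c) ^ 2 =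
        1 / (n : ℝ) ^ 2 + (n : ℝ) ^ 2 * c ^ 2 - 2 * c := by
      rw [← sq_abs (n : ℝ)]
      field_simp
      ring
    have h8 : 0 ≤ c := abs_nonneg _
    linarith

theorem summable_coef_cas (φ : H1) :
    Summable fun n => coef n (H1.toL2 φ) • (cas n).onTorus := by
  refine Summable.of_norm_bounded ((summable_abs_coef φ).mul_right 2) fun n => ?_
  rw [norm_smul, Real.norm_eq_abs]
  exact mul_le_mul_of_nonneg_left (norm_cas_le n) (abs_nonneg _)

theorem ctL2_tsum (φ : H1) :
    ctL2 (∑' n, coef n (H1.toL2 φ) • (cas n).onTorus) = H1.toL2 φ := by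
  refine (ctL2.hasSum (summable_coef_cas φ).hasSum).unique ?_
  refine (hasSum_coef (H1.toL2 φ)).congr_fun fun n => ?_
  simp only [map_smul, e, SmoothFun.toL2_eq]

/-- The linear map sending a function in `H¹(𝕋)` to its continuous representative. -/
def H1.toCTₗ : H1 →ₗ[ℝ] CT where
  toFun φ := ∑' n, coef n (H1.toL2 φ) • (cas n).onTorus
  map_add' φ χ := ctL2_injective <| by
    rw [ctL2_tsum, map_add, map_add, ctL2_tsum, ctL2_tsum]
  map_smul' c φ := ctL2_injective <| by
    rw [ctL2_tsum, map_smul, map_smul, ctL2_tsum, RingHom.id_apply]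

/-- The embedding `H¹(𝕋) → C(𝕋)`. -/
def H1.toCT : H1 →L[ℝ] CT where
  toLinearMap := H1.toCTₗ
  cont := by
    -- Closed graph theorem: as `ctL2` is injective, the graph is the equaliser of two continuous
    -- maps into $L^2$.
    refine LinearMap.continuous_of_isClosed_graph _ ?_
    have : (H1.toCTₗ.graph : Set (H1 × CT)) = {p | ctL2 p.2 = H1.toL2 p.1} := by
      ext p
      rw [SetLike.mem_coe, LinearMap.mem_graph_iff, Set.mem_ofPred_eq]
      constructor
      · intro h
        rw [h]
        exact ctL2_tsum _
      · intro h
        refine ctL2_injective (h.trans ?_)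
        exact (ctL2_tsum _).symm
    rw [this]
    exact isClosed_eq (ctL2.continuous.comp continuous_snd)
      (H1.toL2.continuous.comp continuous_fst)

theorem ctL2_toCT (φ : H1) : ctL2 (H1.toCT φ) = H1.toL2 φ := ctL2_tsum φ

theorem SmoothFun.toCT_toH1 (ψ : SmoothFun) : H1.toCT ψ.toH1 = ψ.onTorus :=
  ctL2_injective <| by rw [ctL2_toCT, ψ.toH1_toL2, ψ.toL2_eq]

theorem coeFn_toL2 (φ : H1) : H1.toL2 φ =ᵐ[volume] H1.toCT φ := by
  rw [← ctL2_toCT]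
  exact coeFn_ctL2 _

/-! ### Poincaré inequality, truncation, and primitives -/

theorem norm_toL2_le_norm_dx (φ : H1) (h0 : coef 0 (H1.toL2 φ) = 0) :
    ‖H1.toL2 φ‖ ≤ ‖H1.dx φ‖ := by
  refine le_of_sq_le_sq ?_ (norm_nonneg _)
  refine hasSum_le (fun n => ?_) (hasSum_coef_sq _) (hasSum_lam φ)
  by_cases hn : n = 0
  · subst hn
    simp [h0, lam_zero]
  · nlinarith [one_le_lam hn, sq_nonneg (coef n (H1.toL2 φ))]

/-- The truncation of the Hartley series at frequency `N`. -/
def trunc (N : ℕ) : L2 →L[ℝ] L2 :=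
  ∑ n ∈ Finset.Icc (-(N : ℤ)) N, (coef n).smulRight (e n)

theorem trunc_apply (N : ℕ) (f : L2) :
    trunc N f = ∑ n ∈ Finset.Icc (-(N : ℤ)) N, coef n f • e n := by
  simp [trunc]

theorem coef_trunc (N : ℕ) (f : L2) (n : ℤ) :
    coef n (trunc N f) = if n ∈ Finset.Icc (-(N : ℤ)) N then coef n f else 0 := by
  simp [trunc_apply, coef_e]

theorem coef_sub_trunc (N : ℕ) (f : L2) (n : ℤ) :
    coef n (f - trunc N f) = if n ∈ Finset.Icc (-(N : ℤ)) N then 0 else coef n f := by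
  rw [map_sub, coef_trunc]
  split_ifs <;> simp

theorem le_abs_of_notMem_Icc {N : ℕ} {n : ℤ} (hn : n ∉ Finset.Icc (-(N : ℤ)) N) :
    (N : ℝ) ≤ |(n : ℝ)| := by
  rw [Finset.mem_Icc, ← abs_le, not_le] at hn
  exact_mod_cast hn.le

/-- The hypothesis says that $g$ dominates $\partial_xf$ coefficientwise. Frequencies that survive
the subtraction satisfy $N^2\le n^2\le\lambda_n$. -/
theorem norm_sub_trunc_le (N : ℕ) {f g : L2}
    (h : ∀ n, lam n * coef n f ^ 2 ≤ coef (-n) g ^ 2) :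
    N * ‖f - trunc N f‖ ≤ ‖g‖ := by
  refine le_of_sq_le_sq ?_ (norm_nonneg _)
  rw [mul_pow]
  refine hasSum_le (fun n => ?_) ((hasSum_coef_sq _).mul_left _)
    ((Equiv.neg ℤ).hasSum_iff.2 (hasSum_coef_sq g))
  rw [coef_sub_trunc]
  simp only [Function.comp_apply, Equiv.neg_apply]
  split_ifs with hn
  · simpa using sq_nonneg _
  · refine le_trans ?_ (h n)
    refine mul_le_mul_of_nonneg_right (le_trans ?_ (sq_le_lam n)) (sq_nonneg _)
    rw [← sq_abs (n : ℝ)]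
    gcongr
    exact le_abs_of_notMem_Icc hn

theorem norm_toL2_sub_trunc_le (N : ℕ) (φ : H1) :
    N * ‖H1.toL2 φ - trunc N (H1.toL2 φ)‖ ≤ ‖H1.dx φ‖ :=
  norm_sub_trunc_le N fun n => le_of_eq (by rw [coef_neg_dx, lam]; ring)

/-- For $n=0$ the quotient is $0$ by the convention on division, which is exactly the choice of a
mean-zero primitive. -/
theorem sq_coef_div_le (g : L2) (n : ℤ) :
    (-(coef (-n) g / (2 * Real.pi * n))) ^ 2 ≤ coef (-n) g ^ 2 := by
  rw [neg_sq, div_pow]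
  by_cases hn : n = 0
  · subst hn
    simpa using sq_nonneg _
  · exact div_le_self (sq_nonneg _) (one_le_lam hn)

theorem exists_coef_eq_neg_div (g : L2) :
    ∃ f : L2, ∀ n, coef n f = -(coef (-n) g / (2 * Real.pi * n)) :=
  exists_coef_eq <| Summable.of_nonneg_of_le (fun _ => sq_nonneg _) (sq_coef_div_le g)
    ((Equiv.neg ℤ).summable_iff.2 (hasSum_coef_sq g).summable)

/-- The operator `-∂ₓ⁻¹` on `L²(𝕋)`. -/
def prim : L2 →L[ℝ] L2 :=
  LinearMap.mkContinuous
    { toFun := fun g => (exists_coef_eq_neg_div g).choose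
      map_add' := fun f g => ext_coef fun n => by
        rw [map_add, (exists_coef_eq_neg_div _).choose_spec, (exists_coef_eq_neg_div _).choose_spec,
          (exists_coef_eq_neg_div _).choose_spec, map_add]
        ring
      map_smul' := fun c g => ext_coef fun n => by
        rw [map_smul, (exists_coef_eq_neg_div _).choose_spec,
          (exists_coef_eq_neg_div _).choose_spec, map_smul]
        simp only [smul_eq_mul, RingHom.id_apply]
        ring } 1 fun g => by
    rw [one_mul]
    refine le_of_sq_le_sq ?_ (norm_nonneg _)
    refine hasSum_le (fun n => ?_) (hasSum_coef_sq _)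
      ((Equiv.neg ℤ).hasSum_iff.2 (hasSum_coef_sq g))
    simp only [LinearMap.coe_mk, AddHom.coe_mk, (exists_coef_eq_neg_div _).choose_spec]
    exact sq_coef_div_le g n

theorem coef_prim (n : ℤ) (g : L2) : coef n (prim g) = -(coef (-n) g / (2 * Real.pi * n)) :=
  (exists_coef_eq_neg_div g).choose_spec n

theorem norm_prim_le (g : L2) : ‖prim g‖ ≤ ‖g‖ := by
  have := prim.le_of_opNorm_le (LinearMap.mkContinuous_norm_le _ zero_le_one _) g
  rwa [one_mul] at this

theorem norm_prim_sub_trunc_le (N : ℕ) (g : L2) :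
    N * ‖prim g - trunc N (prim g)‖ ≤ ‖g‖ :=
  norm_sub_trunc_le N fun n => by
    rw [coef_prim, lam]
    by_cases hn : n = 0
    · subst hn
      simpa using sq_nonneg _
    · have : 2 * Real.pi * (n : ℝ) ≠ 0 := by simpa [Real.pi_ne_zero] using hn
      rw [neg_sq, div_pow, mul_div_cancel₀ _ (pow_ne_zero _ this)]

theorem coef_dx_toL2 (ψ : SmoothFun) (n : ℤ) :
    coef n ψ.dx.toL2 = -(2 * Real.pi * n) * coef (-n) ψ.toL2 := coef_dx ψ.toH1 n

theorem coef_dx_dx_toL2 (ψ : SmoothFun) (n : ℤ) :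
    coef n ψ.dx.dx.toL2 = -lam n * coef n ψ.toL2 := by
  rw [coef_dx_toL2, coef_dx_toL2, neg_neg, lam]
  push_cast
  ring

/-- This is the integration by parts that hides the control inside the nonlinear term. The mean of
`g`, lost by `prim`, does not matter because $\psi'$ has mean zero. -/
theorem inner_prim (g : L2) (ψ : SmoothFun) : ⟪prim g, ψ.dx.dx.toL2⟫ = ⟪g, ψ.dx.toL2⟫ := by
  refine (hasSum_coef_mul _ _).unique
    (((Equiv.neg ℤ).hasSum_iff.2 (hasSum_coef_mul g ψ.dx.toL2)).congr_fun fun n => ?_)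
  simp only [Function.comp_apply, Equiv.neg_apply]
  rw [coef_prim, coef_dx_toL2 ψ.dx]
  by_cases hn : n = 0
  · subst hn
    simp [coef_dx_toL2]
  · have : 2 * Real.pi * (n : ℝ) ≠ 0 := by simpa [Real.pi_ne_zero] using hn
    field_simp

/-! ### Trigonometric polynomials and the space `H⁻¹(𝕋)` -/

/-- The trigonometric polynomial with coefficients `c` and frequencies in `S`. -/
def trigPoly (S : Finset ℤ) (c : ℤ → ℝ) : H1 := ∑ n ∈ S, c n • casH1 n

theorem toL2_trigPoly (S : Finset ℤ) (c : ℤ → ℝ) :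
    H1.toL2 (trigPoly S c) = ∑ n ∈ S, c n • e n := by
  simp only [trigPoly, map_sum, map_smul, casH1_toL2]

theorem coef_trigPoly (S : Finset ℤ) (c : ℤ → ℝ) (n : ℤ) :
    coef n (H1.toL2 (trigPoly S c)) = if n ∈ S then c n else 0 := by
  simp [toL2_trigPoly, coef_e]

theorem norm_toL2_trigPoly_sq (S : Finset ℤ) (c : ℤ → ℝ) :
    ‖H1.toL2 (trigPoly S c)‖ ^ 2 = ∑ n ∈ S, c n ^ 2 := by
  refine (hasSum_coef_sq _).unique ?_
  have : HasSum _ _ := hasSum_sum_of_ne_finset_zero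
    (f := fun n => coef n (H1.toL2 (trigPoly S c)) ^ 2) (s := S) fun n hn => by
      simp [coef_trigPoly, hn]
  convert this using 1
  exact Finset.sum_congr rfl fun n hn => by rw [coef_trigPoly, if_pos hn]

theorem norm_dx_trigPoly_sq (S : Finset ℤ) (c : ℤ → ℝ) :
    ‖H1.dx (trigPoly S c)‖ ^ 2 = ∑ n ∈ S, lam n * c n ^ 2 := by
  refine (hasSum_lam _).unique ?_
  have : HasSum _ _ := hasSum_sum_of_ne_finset_zero
    (f := fun n => lam n * coef n (H1.toL2 (trigPoly S c)) ^ 2) (s := S) fun n hn => by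
      simp [coef_trigPoly, hn]
  convert this using 1
  exact Finset.sum_congr rfl fun n hn => by rw [coef_trigPoly, if_pos hn]

theorem toHm1_apply (f : L2) (φ : H1) : toHm1 f φ = ⟪f, H1.toL2 φ⟫ := rfl

theorem toHm1_casH1 (f : L2) (n : ℤ) : toHm1 f (casH1 n) = coef n f := by
  rw [toHm1_apply, casH1_toL2, coef_apply']

theorem norm_toHm1_le (f : L2) : ‖toHm1 f‖ ≤ ‖f‖ := by
  refine ContinuousLinearMap.opNorm_le_bound _ (norm_nonneg _) fun φ => ?_
  rw [toHm1_apply]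
  exact (norm_inner_le_norm _ _).trans (mul_le_mul_of_nonneg_left (H1.norm_toL2_le φ) (norm_nonneg _))

theorem toHm1_sub (f g : L2) : toHm1 (f - g) = toHm1 f - toHm1 g := by
  ext φ
  simp [toHm1_apply, inner_sub_left]

theorem hasSum_apply_casH1 (Φ : Hm1) (φ : H1) :
    HasSum (fun n => coef n (H1.toL2 φ) * Φ (casH1 n)) (Φ φ) := by
  have := Φ.hasSum (hasSum_casH1 φ)
  simpa only [map_smul, smul_eq_mul] using this

/-- Half the square of the homogeneous `H⁻¹` norm. -/
def homEnergy (Φ : Hm1) : ℝ := ∑' n, Φ (casH1 n) ^ 2 / (2 * lam n)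

theorem homEnergy_term_nonneg (Φ : Hm1) (n : ℤ) : 0 ≤ Φ (casH1 n) ^ 2 / (2 * lam n) :=
  div_nonneg (sq_nonneg _) (mul_nonneg zero_le_two (lam_nonneg n))

/-- Duality: $\Phi$ is tested on its own truncated Riesz representative. The zero mode is absent
from the sum, being a division by $\lambda_0=0$. -/
theorem sum_homEnergy_le (Φ : Hm1) (S : Finset ℤ) :
    ∑ n ∈ S, Φ (casH1 n) ^ 2 / (2 * lam n) ≤ ‖Φ‖ ^ 2 := by
  -- With these coefficients $\Phi(p)=s$ and $\|p\|_{H^1}^2\le s$, since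
  -- $(1+\lambda_n)/(2\lambda_n)\le1$; hence $s\le\|\Phi\|\|p\|$ yields $s\le\|\Phi\|^2$.
  set c : ℤ → ℝ := fun n => Φ (casH1 n) / (2 * lam n) with hc
  set s := ∑ n ∈ S, Φ (casH1 n) ^ 2 / (2 * lam n)
  have h1 : Φ (trigPoly S c) = s := by
    simp only [trigPoly, map_sum, map_smul, smul_eq_mul, hc, s]
    exact Finset.sum_congr rfl fun n _ => by ring
  have h2 : ‖trigPoly S c‖ ^ 2 ≤ s := by
    rw [H1.norm_sq, norm_toL2_trigPoly_sq, norm_dx_trigPoly_sq, ← Finset.sum_add_distrib]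
    refine Finset.sum_le_sum fun n _ => ?_
    by_cases hn : n = 0
    · simp [hn, hc, lam_zero]
    · have hl := one_le_lam hn
      have h3 : c n ^ 2 + lam n * c n ^ 2 =
          Φ (casH1 n) ^ 2 / (2 * lam n) * ((1 + lam n) / (2 * lam n)) := by
        simp only [hc]
        field_simp
      rw [h3]
      refine mul_le_of_le_one_right (homEnergy_term_nonneg Φ n) ?_
      rw [div_le_one (by linarith)]
      linarith
  have h3 : s ≤ ‖Φ‖ * ‖trigPoly S c‖ := by
    rw [← h1]
    exact (le_abs_self _).trans (Φ.le_opNorm _)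
  nlinarith [sq_nonneg (‖Φ‖ - ‖trigPoly S c‖), sq_nonneg ‖trigPoly S c‖]

theorem summable_homEnergy (Φ : Hm1) : Summable fun n => Φ (casH1 n) ^ 2 / (2 * lam n) :=
  summable_of_sum_le (homEnergy_term_nonneg Φ) (sum_homEnergy_le Φ)

theorem homEnergy_le (Φ : Hm1) : homEnergy Φ ≤ ‖Φ‖ ^ 2 :=
  (summable_homEnergy Φ).tsum_le_of_sum_le (sum_homEnergy_le Φ)

theorem homEnergy_nonneg (Φ : Hm1) : 0 ≤ homEnergy Φ := tsum_nonneg (homEnergy_term_nonneg Φ)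

theorem homEnergy_zero : homEnergy 0 = 0 := by simp [homEnergy]

/-- A functional without zero mode has the form $\varphi\mapsto\langle f,\partial_x\varphi\rangle$
with $\|f\|^2$ equal to twice its energy. -/
theorem norm_sq_le_homEnergy (Φ : Hm1) (h0 : Φ (casH1 0) = 0) : ‖Φ‖ ^ 2 ≤ 2 * homEnergy Φ := by
  have hs : HasSum (fun n => (Φ (casH1 n) / (2 * Real.pi * n)) ^ 2) (2 * homEnergy Φ) := by
    refine ((summable_homEnergy Φ).hasSum.mul_left 2).congr_fun fun n => ?_
    rw [div_pow, ← lam, mul_comm 2 (lam n), ← div_div]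
    ring
  have hs' := (Equiv.neg ℤ).hasSum_iff.2 hs
  obtain ⟨f, hf⟩ := exists_coef_eq hs'.summable
  have hfn : ‖f‖ ^ 2 = 2 * homEnergy Φ := by
    refine (hasSum_coef_sq f).unique ?_
    exact hs'.congr_fun fun n => by rw [hf]; rfl
  rw [← hfn]
  gcongr
  refine ContinuousLinearMap.opNorm_le_bound _ (norm_nonneg _) fun φ => ?_
  have hφ : HasSum (fun n => Φ (casH1 n) / (2 * Real.pi * n) * coef (-n) (H1.dx φ)) (Φ φ) := by
    refine (hasSum_apply_casH1 Φ φ).congr_fun fun n => ?_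
    rw [coef_neg_dx]
    by_cases hn : n = 0
    · subst hn
      simp [h0]
    · have : 2 * Real.pi * (n : ℝ) ≠ 0 := by simpa [Real.pi_ne_zero] using hn
      field_simp
  have h2 : Φ φ = ⟪f, H1.dx φ⟫ := by
    refine ((Equiv.neg ℤ).hasSum_iff.2 hφ).unique
      ((hasSum_coef_mul f (H1.dx φ)).congr_fun fun n => ?_)
    simp [hf]
  rw [h2]
  exact (norm_inner_le_norm _ _).trans
    (mul_le_mul_of_nonneg_left (H1.norm_dx_le φ) (norm_nonneg _))

/-- The error has no zero mode, and its energy is the tail of the convergent series `homEnergy Φ`.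
-/
theorem tendsto_toHm1_trigPoly (Φ : Hm1) :
    Tendsto (fun N : ℕ => ‖toHm1 (H1.toL2 (trigPoly (Finset.Icc (-(N : ℤ)) N)
      fun n => Φ (casH1 n))) - Φ‖) atTop (𝓝 0) := by
  set P := fun N : ℕ => toHm1 (H1.toL2 (trigPoly (Finset.Icc (-(N : ℤ)) N)
      fun n => Φ (casH1 n)))
  have hc : ∀ N n, (P N - Φ) (casH1 n) =
      if n ∈ Finset.Icc (-(N : ℤ)) N then 0 else -Φ (casH1 n) := fun N n => by
    simp only [P, sub_apply, toHm1_casH1, coef_trigPoly]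
    split_ifs <;> simp
  have hE : ∀ N, homEnergy (P N - Φ) = homEnergy Φ -
      ∑ n ∈ Finset.Icc (-(N : ℤ)) N, Φ (casH1 n) ^ 2 / (2 * lam n) := fun N => by
    rw [eq_sub_iff_add_eq]
    have h1 : HasSum (fun n => if n ∈ Finset.Icc (-(N : ℤ)) N then
        Φ (casH1 n) ^ 2 / (2 * lam n) else 0)
        (∑ n ∈ Finset.Icc (-(N : ℤ)) N, Φ (casH1 n) ^ 2 / (2 * lam n)) := by
      have h2 : HasSum _ _ := hasSum_sum_of_ne_finset_zero
        (f := fun n => if n ∈ Finset.Icc (-(N : ℤ)) N then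
        Φ (casH1 n) ^ 2 / (2 * lam n) else 0) (s := Finset.Icc (-(N : ℤ)) N)
        fun n hn => if_neg hn
      convert h2 using 1
      exact Finset.sum_congr rfl fun n hn => (if_pos hn).symm
    refine ((summable_homEnergy (P N - Φ)).hasSum.add h1).unique
      ((summable_homEnergy Φ).hasSum.congr_fun fun n => ?_)
    rw [hc]
    split_ifs <;> simp
  have ht : Tendsto (fun N => homEnergy (P N - Φ)) atTop (𝓝 0) := by
    simp only [hE]
    have := (summable_homEnergy Φ).hasSum.comp Finset.tendsto_Icc_neg
    simpa [homEnergy] using this.const_sub (homEnergy Φ)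
  have h0 : ∀ N, (P N - Φ) (casH1 0) = 0 := fun N => by
    rw [hc, if_pos]
    simp
  have h1 : Tendsto (fun N => √(2 * homEnergy (P N - Φ))) atTop (𝓝 0) := by
    simpa using (ht.const_mul 2).sqrt
  exact squeeze_zero (fun N => norm_nonneg (P N - Φ))
    (fun N => Real.le_sqrt_of_sq_le (norm_sq_le_homEnergy _ (h0 N))) h1

/-! ### Cesàro means and the Fejér kernel -/

/-- The Cesàro means of the symmetric partial sums of a series indexed by `ℤ`. -/
def cesaro (N : ℕ) (φ : ℤ → ℝ) : ℝ :=
  (N : ℝ)⁻¹ * ∑ p ∈ Finset.range N ×ˢ Finset.range N, φ (p.1 - p.2)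

/-- The right side is a sum of symmetric partial sums, which gives convergence of the means. The
left side is a double sum over a square, which exposes the positivity of the Fejér kernel. -/
theorem sum_range_sub_eq (φ : ℤ → ℝ) (N : ℕ) :
    ∑ p ∈ Finset.range N ×ˢ Finset.range N, φ (p.1 - p.2) =
      ∑ n ∈ Finset.range N, (∑ j ∈ Finset.range (n + 1), (φ j + φ (-j)) - φ 0) := by
  rw [Finset.sum_product]
  induction N with
  | zero => simp
  | succ N ih =>
    simp only at ih ⊢
    rw [Finset.sum_range_succ, Finset.sum_range_succ (n := N)
      (f := fun n => ∑ j ∈ Finset.range (n + 1), (φ j + φ (-j)) - φ 0), ← ih]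
    have h1 : ∀ i : ℕ, ∑ j ∈ Finset.range (N + 1), φ (i - j) =
        ∑ j ∈ Finset.range N, φ (i - j) + φ (i - N) := fun i => Finset.sum_range_succ _ _
    simp only [h1, Finset.sum_add_distrib]
    have h2 : ∑ j ∈ Finset.range (N + 1), φ (j : ℤ) =
        ∑ j ∈ Finset.range N, φ ((N : ℤ) - j) + φ 0 := by
      rw [← Finset.sum_range_reflect, Finset.sum_range_succ]
      simp only [Nat.add_sub_cancel, Nat.sub_self, Nat.cast_zero]
      congr 1
      refine Finset.sum_congr rfl fun j hj => ?_
      rw [Finset.mem_range] at hj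
      rw [Nat.cast_sub hj.le]
    have h3 : ∑ j ∈ Finset.range (N + 1), φ (-(j : ℤ)) =
        ∑ j ∈ Finset.range N, φ ((j : ℤ) - N) + φ 0 := by
      rw [← Finset.sum_range_reflect, Finset.sum_range_succ]
      simp only [Nat.add_sub_cancel, Nat.sub_self, Nat.cast_zero, neg_zero]
      congr 1
      refine Finset.sum_congr rfl fun j hj => ?_
      rw [Finset.mem_range] at hj
      rw [Nat.cast_sub hj.le, neg_sub]
    rw [h2, h3, sub_self]
    ring

theorem tendsto_cesaro {φ : ℤ → ℝ} {s : ℝ} (h : HasSum φ s) :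
    Tendsto (fun N => cesaro N φ) atTop (𝓝 s) := by
  have h1 := (h.nat_add_neg.tendsto_sum_nat.comp (tendsto_add_atTop_nat 1)).sub_const (φ 0)
  rw [add_sub_cancel_right] at h1
  simp only [cesaro, sum_range_sub_eq]
  exact h1.cesaro

theorem cesaro_le {φ : ℤ → ℝ} {s : ℝ} (h : HasSum φ s) (h0 : ∀ n, 0 ≤ φ n) (N : ℕ) :
    cesaro N φ ≤ s := by
  have hs : 0 ≤ s := h.nonneg h0
  rw [cesaro, sum_range_sub_eq]
  have h1 : ∑ n ∈ Finset.range N, (∑ j ∈ Finset.range (n + 1), (φ j + φ (-j)) - φ 0) ≤ N * s := by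
    refine (Finset.sum_le_card_nsmul _ _ s fun n _ => ?_).trans (by simp)
    rw [sub_le_iff_le_add]
    exact sum_le_hasSum _ (fun j _ => add_nonneg (h0 _) (h0 _)) h.nat_add_neg
  rcases Nat.eq_zero_or_pos N with rfl | hN
  · simpa using hs
  · have : (0 : ℝ) < N := by exact_mod_cast hN
    rw [inv_mul_le_iff₀ this]
    exact h1

theorem cesaro_mono {φ χ : ℤ → ℝ} (h : ∀ n, φ n ≤ χ n) (N : ℕ) : cesaro N φ ≤ cesaro N χ :=
  mul_le_mul_of_nonneg_left (Finset.sum_le_sum fun _ _ => h _) (by positivity)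

theorem cesaro_neg (φ : ℤ → ℝ) (N : ℕ) : cesaro N (fun n => -φ n) = -cesaro N φ := by
  simp [cesaro]

theorem cesaro_add (φ χ : ℤ → ℝ) (N : ℕ) :
    cesaro N (fun n => φ n + χ n) = cesaro N φ + cesaro N χ := by
  simp [cesaro, Finset.sum_add_distrib, mul_add]

theorem cesaro_const_mul (c : ℝ) (φ : ℤ → ℝ) (N : ℕ) :
    cesaro N (fun n => c * φ n) = c * cesaro N φ := by
  simp only [cesaro, ← Finset.mul_sum]
  ring

theorem abs_cesaro_le {φ χ : ℤ → ℝ} {s : ℝ} (h : HasSum χ s) (h0 : ∀ n, |φ n| ≤ χ n) (N : ℕ) :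
    |cesaro N φ| ≤ s := by
  have h1 := cesaro_le h (fun n => (abs_nonneg _).trans (h0 n)) N
  rw [abs_le]
  constructor
  · have := cesaro_mono (fun n => (abs_le.1 (h0 n)).1) N
    rw [cesaro_neg] at this
    linarith
  · exact (cesaro_mono (fun n => (abs_le.1 (h0 n)).2) N).trans h1

theorem integral_cesaro {α : Type*} [MeasurableSpace α] {μ : Measure α} {φ : ℤ → α → ℝ}
    (h : ∀ n, Integrable (φ n) μ) (N : ℕ) :
    ∫ x, cesaro N (fun n => φ n x) ∂μ = cesaro N fun n => ∫ x, φ n x ∂μ := by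
  simp only [cesaro]
  rw [integral_const_mul, integral_finsetSum _ fun p _ => h _]

theorem integrable_cesaro {α : Type*} [MeasurableSpace α] {μ : Measure α} {φ : ℤ → α → ℝ}
    (h : ∀ n, Integrable (φ n) μ) (N : ℕ) :
    Integrable (fun x => cesaro N (fun n => φ n x)) μ :=
  (integrable_finsetSum _ fun _ _ => h _).const_mul _

theorem integrable_of_continuous {f : UnitAddCircle → ℝ} (hf : Continuous f) :
    Integrable f (volume : Measure UnitAddCircle) := CT.integrable ⟨f, hf⟩

/-- The Fejér kernel. -/
def fejer (N : ℕ) (x y : UnitAddCircle) : ℝ :=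
  cesaro N fun k => (cas k).onTorus x * (cas k).onTorus y

theorem continuous_cesaro {α : Type*} [TopologicalSpace α] {φ : ℤ → α → ℝ}
    (h : ∀ n, Continuous (φ n)) (N : ℕ) : Continuous fun x => cesaro N (fun n => φ n x) :=
  continuous_const.mul (continuous_finsetSum _ fun _ _ => h _)

theorem continuous_fejer (N : ℕ) (x : UnitAddCircle) : Continuous (fejer N x) :=
  continuous_cesaro (fun k => continuous_const.mul (cas k).onTorus.continuous) N

/-- Summed over the square, $\cos((i-j)a)$ gives $(\sum\cos ia)^2+(\sum\sin ia)^2$, and the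
antisymmetric $\sin((i-j)b)$ cancels. -/
theorem fejer_nonneg (N : ℕ) (x y : UnitAddCircle) : 0 ≤ fejer N x y := by
  induction x using QuotientAddGroup.induction_on with
  | H x =>
  induction y using QuotientAddGroup.induction_on with
  | H y =>
  refine mul_nonneg (by positivity) ?_
  have h : ∀ k : ℤ, (cas k).onTorus (QuotientAddGroup.mk x : UnitAddCircle) *
      (cas k).onTorus (QuotientAddGroup.mk y : UnitAddCircle) =
      Real.cos (k * (2 * Real.pi * (x - y))) + Real.sin (k * (2 * Real.pi * (x + y))) := fun k => by
    have hx : (cas k).onTorus (QuotientAddGroup.mk x : UnitAddCircle) = _ := (cas k).onTorus_coe x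
    have hy : (cas k).onTorus (QuotientAddGroup.mk y : UnitAddCircle) = _ := (cas k).onTorus_coe y
    rw [hx, hy, cas_toFun, cas_toFun,
      show k * (2 * Real.pi * (x - y)) = 2 * Real.pi * k * x - 2 * Real.pi * k * y by ring,
      show k * (2 * Real.pi * (x + y)) = 2 * Real.pi * k * x + 2 * Real.pi * k * y by ring,
      Real.cos_sub, Real.sin_add]
    ring
  simp only [h]
  rw [Finset.sum_product]
  set a := 2 * Real.pi * (x - y)
  set b := 2 * Real.pi * (x + y)
  have h2 : ∀ i j : ℕ, Real.cos (((i - j : ℤ) : ℝ) * a) + Real.sin (((i - j : ℤ) : ℝ) * b) =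
      Real.cos (i * a) * Real.cos (j * a) + Real.sin (i * a) * Real.sin (j * a) +
      Real.sin (i * b) * Real.cos (j * b) - Real.cos (i * b) * Real.sin (j * b) := fun i j => by
    push_cast
    rw [sub_mul, sub_mul, Real.cos_sub, Real.sin_sub]
    ring
  simp only [h2, Finset.sum_add_distrib, Finset.sum_sub_distrib, ← Finset.mul_sum,
    ← Finset.sum_mul]
  nlinarith [sq_nonneg (∑ i ∈ Finset.range N, Real.cos (i * a)),
    sq_nonneg (∑ i ∈ Finset.range N, Real.sin (i * a))]

theorem cas_zero_onTorus (x : UnitAddCircle) : (cas 0).onTorus x = 1 := by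
  induction x using QuotientAddGroup.induction_on with
  | H x =>
    have h : (cas 0).onTorus (QuotientAddGroup.mk x : UnitAddCircle) = _ := (cas 0).onTorus_coe x
    rw [h]
    simp [cas_toFun]

theorem cesaro_single {N : ℕ} (hN : N ≠ 0) {φ : ℤ → ℝ} (h : ∀ n ≠ 0, φ n = 0) :
    cesaro N φ = φ 0 := by
  have h1 : ∀ i j : ℕ, φ (i - j) = if i = j then φ 0 else 0 := fun i j => by
    split_ifs with hij
    · simp [hij]
    · exact h _ (by rw [sub_ne_zero]; exact_mod_cast hij)
  have h2 : (N : ℝ) ≠ 0 := by exact_mod_cast hN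
  simp only [cesaro, h1, Finset.sum_product, Finset.sum_ite_eq]
  rw [Finset.sum_congr rfl fun i hi => if_pos hi]
  simp [h2]

theorem integral_fejer {N : ℕ} (hN : N ≠ 0) (x : UnitAddCircle) : ∫ y, fejer N x y = 1 := by
  simp only [fejer]
  rw [integral_cesaro fun k =>
    integrable_of_continuous (by fun_prop)]
  simp only [integral_const_mul, integral_cas]
  rw [cesaro_single hN fun n hn => by simp [hn]]
  simp [cas_zero_onTorus]

/-- The Fejér means of a continuous function. -/
def fejerMean (N : ℕ) (w : CT) (x : UnitAddCircle) : ℝ :=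
  cesaro N fun k => (cas k).onTorus x * coef k (ctL2 w)

theorem coef_ctL2 (k : ℤ) (w : CT) : coef k (ctL2 w) = ∫ y, (cas k).onTorus y * w y := by
  rw [coef_apply, e, (cas k).toL2_eq, inner_ctL2_ctL2]

theorem fejerMean_eq_integral (N : ℕ) (w : CT) (x : UnitAddCircle) :
    fejerMean N w x = ∫ y, fejer N x y * w y := by
  have h1 : ∀ y, fejer N x y * w y =
      cesaro N fun k => (cas k).onTorus x * ((cas k).onTorus y * w y) := fun y => by
    rw [fejer, mul_comm, ← cesaro_const_mul]
    congr 1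
    ext k
    ring
  simp only [h1]
  rw [integral_cesaro fun k => integrable_of_continuous (by fun_prop)]
  simp only [integral_const_mul, ← coef_ctL2, fejerMean]

theorem continuous_fejerMean (N : ℕ) (w : CT) : Continuous (fejerMean N w) :=
  continuous_cesaro (fun k => (cas k).onTorus.continuous.mul continuous_const) N

theorem cesaro_coef_mul (N : ℕ) (F w : CT) :
    cesaro N (fun k => coef k (ctL2 F) * coef k (ctL2 w)) = ∫ x, F x * fejerMean N w x := by
  have h1 : ∀ x, F x * fejerMean N w x =
      cesaro N fun k => ((cas k).onTorus x * F x) * coef k (ctL2 w) := fun x => by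
    rw [fejerMean, ← cesaro_const_mul]
    congr 1
    ext k
    ring
  simp only [h1]
  rw [integral_cesaro fun k => integrable_of_continuous (by fun_prop)]
  simp only [integral_mul_const, ← coef_ctL2]

theorem integral_fejerMean {N : ℕ} (hN : N ≠ 0) (w : CT) : ∫ x, fejerMean N w x = ∫ x, w x := by
  simp only [fejerMean]
  rw [integral_cesaro fun k =>
    integrable_of_continuous (by fun_prop)]
  simp only [integral_mul_const, integral_cas]
  rw [cesaro_single hN fun n hn => by simp [hn]]
  simp [coef_ctL2, cas_zero_onTorus]

/-- The Cesàro mean of the Parseval series is $\iint F(x)K_N(x,y)w(y)$ with $K_N\ge0$ of mass one in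
each variable, so a bound with separated variables integrates to a bound independent of $N$. -/
theorem abs_cesaro_coef_mul_le {N : ℕ} (hN : N ≠ 0) {F w p r : CT}
    (h : ∀ x y, |F x * w y| ≤ p x + r y) :
    |cesaro N (fun k => coef k (ctL2 F) * coef k (ctL2 w))| ≤ (∫ x, p x) + ∫ x, r x := by
  have hpt : ∀ x, |F x * fejerMean N w x| ≤ p x + fejerMean N r x := fun x => by
    have h1 : p x + fejerMean N r x = ∫ y, fejer N x y * (p x + r y) := by
      simp only [mul_add]
      have hc := continuous_fejer N x
      rw [integral_add (integrable_of_continuous (by fun_prop))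
        (integrable_of_continuous (by fun_prop)), integral_mul_const, integral_fejer hN, one_mul,
        fejerMean_eq_integral]
    rw [h1, fejerMean_eq_integral, ← integral_const_mul]
    refine (abs_integral_le_integral_abs).trans ?_
    have hc := continuous_fejer N x
    refine integral_mono (integrable_of_continuous (by fun_prop))
      (integrable_of_continuous (by fun_prop)) fun y => ?_
    simp only
    rw [show F x * (fejer N x y * w y) = fejer N x y * (F x * w y) by ring, abs_mul,
      abs_of_nonneg (fejer_nonneg N x y)]
    exact mul_le_mul_of_nonneg_left (h x y) (fejer_nonneg N x y)
  have hc := continuous_fejerMean N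
  rw [cesaro_coef_mul, ← integral_fejerMean hN r, ← integral_add p.integrable
    (integrable_of_continuous (hc r))]
  have hw := hc w
  have hr := hc r
  exact (abs_integral_le_integral_abs).trans (integral_mono (integrable_of_continuous (by fun_prop))
    (integrable_of_continuous (by fun_prop)) hpt)

/-! ### Products of primitives -/

/-- Integration by parts for absolutely continuous functions; $G$ and $H$ need only be integrable.
-/
theorem primitive_mul_primitive {G H : ℝ → ℝ} {t : ℝ} (hG : IntervalIntegrable G volume 0 t)
    (hH : IntervalIntegrable H volume 0 t) (a b : ℝ) :
    (a + ∫ s in (0 : ℝ)..t, G s) * (b + ∫ s in (0 : ℝ)..t, H s) =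
      a * b + ∫ s in (0 : ℝ)..t, (G s * (b + ∫ r in (0 : ℝ)..s, H r) +
        (a + ∫ r in (0 : ℝ)..s, G r) * H s) := by
  have hc : ∀ c : ℝ, AbsolutelyContinuousOnInterval (fun _ : ℝ => c) 0 t := fun c =>
    ((LipschitzWith.const c).lipschitzOnWith (s := Set.uIcc 0 t)).absolutelyContinuousOnInterval
  have hA : AbsolutelyContinuousOnInterval (fun s => a + ∫ r in (0 : ℝ)..s, G r) 0 t :=
    (hc a).add (hG.absolutelyContinuousOnInterval_intervalIntegral (by simp))
  have hB : AbsolutelyContinuousOnInterval (fun s => b + ∫ r in (0 : ℝ)..s, H r) 0 t :=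
    (hc b).add (hH.absolutelyContinuousOnInterval_intervalIntegral (by simp))
  have h1 := hA.integral_deriv_mul_eq_sub hB
  simp only [intervalIntegral.integral_same, add_zero] at h1
  rw [← sub_eq_iff_eq_add', ← h1]
  refine intervalIntegral.integral_congr_ae ?_
  filter_upwards [hG.ae_hasDerivAt_integral, hH.ae_hasDerivAt_integral] with s h2 h3 hs
  have hs' := Set.uIoc_subset_uIcc hs
  rw [((h2 hs' 0 (by simp)).const_add a).deriv, ((h3 hs' 0 (by simp)).const_add b).deriv]

theorem intervalIntegrable_of_integrable {E : Type*} [NormedAddCommGroup E] {T t : ℝ} {f : ℝ → E}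
    (hf : Integrable f (timeMeasure T)) (ht : t ∈ Set.Icc 0 T) :
    IntervalIntegrable f volume 0 t := by
  rw [intervalIntegrable_iff_integrableOn_Icc_of_le ht.1]
  exact hf.mono_measure (Measure.restrict_mono (Set.Icc_subset_Icc_right ht.2) le_rfl)

theorem ae_uIoc_of_ae {T t : ℝ} {p : ℝ → Prop} (hp : ∀ᵐ s ∂timeMeasure T, p s)
    (ht : t ∈ Set.Icc 0 T) : ∀ᵐ s, s ∈ Set.uIoc 0 t → p s := by
  rw [ae_restrict_iff' measurableSet_Icc] at hp
  filter_upwards [hp] with s hs h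
  rw [Set.uIoc_of_le ht.1] at h
  exact hs ⟨h.1.le, h.2.trans ht.2⟩

/-! ### The nonlinearity -/

/-- The nonlinearity `V'`, acting on continuous functions. -/
def nonlin (a : ℝ) (f : CT) : CT := f ^ 3 - a • f

/-- The fourth power of the `L⁴` norm of a continuous function. -/
def quart (f : CT) : ℝ := ∫ x, f x ^ 4

theorem nonlin_apply (a : ℝ) (f : CT) (x : UnitAddCircle) :
    nonlin a f x = f x ^ 3 - a * f x := rfl

theorem deriv_potential (a y : ℝ) : deriv (potential a) y = y ^ 3 - a * y := by
  have h : HasDerivAt (potential a) (4 * y ^ 3 / 4 - a * (2 * y) / 2) y := by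
    have h4 := (hasDerivAt_pow 4 y).div_const 4
    have h2 := ((hasDerivAt_pow 2 y).const_mul a).div_const 2
    have := h4.sub h2
    refine this.congr_deriv ?_
    norm_num
  rw [h.deriv]
  ring

theorem integral_eq_coef (f : CT) : ∫ x, f x = coef 0 (ctL2 f) := by
  simp [coef_ctL2, cas_zero_onTorus]

theorem quart_eq_coef (f : CT) : quart f = coef 0 (ctL2 (f ^ 4)) := by
  simp [quart, ← integral_eq_coef]

theorem continuous_nonlin (a : ℝ) : Continuous (nonlin a) := by
  unfold nonlin
  fun_prop

theorem continuous_quart : Continuous quart := by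
  have : quart = fun f => coef 0 (ctL2 (f ^ 4)) := funext quart_eq_coef
  rw [this]
  fun_prop

theorem quart_nonneg (f : CT) : 0 ≤ quart f := integral_nonneg fun x => by positivity

theorem volume_real_circle : (volume : Measure UnitAddCircle).real Set.univ = 1 := by
  simp [Measure.real]

theorem integral_one_add_pow (f h : CT) :
    ∫ x, (1 + f x ^ 4 + h x ^ 4) = 1 + quart f + quart h := by
  rw [integral_add (integrable_of_continuous (by fun_prop))
    (integrable_of_continuous (by fun_prop)), integral_add (integrable_of_continuous (by fun_prop))
    (integrable_of_continuous (by fun_prop))]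
  simp [quart, volume_real_circle]

theorem cube_mul_le {p r : ℝ} (hp : 0 ≤ p) (hr : 0 ≤ r) : p ^ 3 * r ≤ p ^ 4 + r ^ 4 := by
  rcases le_total p r with h | h
  · have : p ^ 3 * r ≤ r ^ 3 * r := by gcongr
    nlinarith [pow_nonneg hp 4]
  · have : p ^ 3 * r ≤ p ^ 3 * p := by gcongr
    nlinarith [pow_nonneg hr 4]

theorem mul_le_one_add {p r : ℝ} (hp : 0 ≤ p) (hr : 0 ≤ r) : p * r ≤ 1 + p ^ 4 + r ^ 4 := by
  nlinarith [sq_nonneg (p - r), sq_nonneg (p ^ 2 - 1), sq_nonneg (r ^ 2 - 1), pow_nonneg hp 4,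
    pow_nonneg hr 4]

/-- The two factors take values at different points $x$ and $y$, as the Fejér kernel requires.
Young's inequality separates the variables and leaves only fourth powers. -/
theorem abs_nonlin_sub_mul_le (a u v y z : ℝ) :
    |((u ^ 3 - a * u) - (v ^ 3 - a * v)) * (y - z)| ≤
      4 * (1 + |a|) * (1 + u ^ 4 + v ^ 4) + 4 * (1 + |a|) * (1 + y ^ 4 + z ^ 4) := by
  have e4 : ∀ r : ℝ, r ^ 4 = |r| ^ 4 := fun r => by
    rw [← abs_pow, abs_of_nonneg (by positivity)]
  rw [abs_mul, e4 u, e4 v, e4 y, e4 z]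
  have h1 : |(u ^ 3 - a * u) - (v ^ 3 - a * v)| ≤
      |u| ^ 3 + |v| ^ 3 + |a| * (|u| + |v|) := by
    have e : (u ^ 3 - a * u) - (v ^ 3 - a * v) = (u ^ 3 - v ^ 3) - a * (u - v) := by ring
    rw [e, mul_add, ← abs_pow, ← abs_pow, ← abs_mul, ← abs_mul, mul_sub]
    have i1 := abs_sub (u ^ 3 - v ^ 3) (a * u - a * v)
    have i2 := abs_sub (u ^ 3) (v ^ 3)
    have i3 := abs_sub (a * u) (a * v)
    linarith
  have h2 : |y - z| ≤ |y| + |z| := abs_sub _ _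
  have hu := abs_nonneg u
  have hv := abs_nonneg v
  have hy := abs_nonneg y
  have hz := abs_nonneg z
  have ha := abs_nonneg a
  have h3 := mul_le_mul h1 h2 (abs_nonneg _) (by positivity)
  refine h3.trans ?_
  generalize |u| = p at *
  generalize |v| = q at *
  generalize |y| = r at *
  generalize |z| = s at *
  have k1 := cube_mul_le hu hy
  have k2 := cube_mul_le hu hz
  have k3 := cube_mul_le hv hy
  have k4 := cube_mul_le hv hz
  have m : (p + q) * (r + s) ≤ 4 + 2 * (p ^ 4 + q ^ 4 + r ^ 4 + s ^ 4) := by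
    nlinarith [mul_le_one_add hu hy, mul_le_one_add hu hz, mul_le_one_add hv hy,
      mul_le_one_add hv hz]
  have m2 := mul_le_mul_of_nonneg_left m ha
  have n1 := pow_nonneg hu 4
  have n2 := pow_nonneg hv 4
  have n3 := pow_nonneg hy 4
  have n4 := pow_nonneg hz 4
  have n5 : 0 ≤ |a| * (p ^ 4 + q ^ 4 + r ^ 4 + s ^ 4) := by positivity
  nlinarith

theorem abs_cesaro_nonlin_le {N : ℕ} (hN : N ≠ 0) (a : ℝ) (u v : CT) :
    |cesaro N (fun k => coef k (ctL2 (nonlin a u - nonlin a v)) * coef k (ctL2 (u - v)))| ≤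
      8 * (1 + |a|) * (1 + quart u + quart v) := by
  have h := abs_cesaro_coef_mul_le hN (F := nonlin a u - nonlin a v) (w := u - v)
    (p := (4 * (1 + |a|)) • (1 + u ^ 4 + v ^ 4)) (r := (4 * (1 + |a|)) • (1 + u ^ 4 + v ^ 4))
    fun x y => abs_nonlin_sub_mul_le a (u x) (v x) (u y) (v y)
  refine h.trans (le_of_eq ?_)
  have : ∫ x, ((4 * (1 + |a|)) • (1 + u ^ 4 + v ^ 4) : CT) x =
      4 * (1 + |a|) * (1 + quart u + quart v) := by
    rw [← integral_one_add_pow, ← integral_const_mul]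
    rfl
  rw [this]
  ring

/-- Pointwise, $(p^3-ap-q^3+aq)(p-q)-\frac14(p-q)^4=(p-q)^2\big(\frac34(p+q)^2-a\big)$, which is
nonnegative because $a<0$. -/
theorem quart_sub_le {a : ℝ} (ha : a < 0) (u v : CT) :
    1 / 4 * quart (u - v) ≤ ⟪ctL2 (nonlin a u - nonlin a v), ctL2 (u - v)⟫ := by
  rw [inner_ctL2_ctL2, quart, ← integral_const_mul]
  refine integral_mono (integrable_of_continuous (by fun_prop))
    (integrable_of_continuous (by fun_prop)) fun x => ?_
  simp only [ContinuousMap.sub_apply, nonlin_apply]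
  generalize u x = p
  generalize v x = q
  have : (p ^ 3 - a * p - (q ^ 3 - a * q)) * (p - q) - 1 / 4 * (p - q) ^ 4 =
      (p - q) ^ 2 * (3 / 4 * (p + q) ^ 2 - a) := by ring
  have h2 : 0 ≤ (p - q) ^ 2 * (3 / 4 * (p + q) ^ 2 - a) := by
    refine mul_nonneg (sq_nonneg _) ?_
    nlinarith [sq_nonneg (p + q)]
  linarith

/-- Young's inequality with a free parameter. When $u_n\to v$ in $L^2$ with bounded fourth powers,
letting $n\to\infty$ and then $\delta\to0$ passes to the limit in the cubic term. -/
theorem abs_inner_nonlin_sub_le (a δ : ℝ) (hδ : 0 < δ) (u v h : CT) :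
    |⟪ctL2 (nonlin a u - nonlin a v), ctL2 h⟫| ≤
      ‖h‖ * (8 * (1 + |a|)) * (δ⁻¹ * ‖ctL2 (u - v)‖ ^ 2 + δ * (1 + quart u + quart v)) := by
  have hn : ‖ctL2 (u - v)‖ ^ 2 = ∫ x, (u x - v x) ^ 2 := by
    rw [← real_inner_self_eq_norm_sq, inner_ctL2_ctL2]
    simp [pow_two]
  rw [inner_ctL2_ctL2, hn, ← integral_one_add_pow, ← integral_const_mul, ← integral_const_mul,
    ← integral_add (integrable_of_continuous (by fun_prop))
      (integrable_of_continuous (by fun_prop)), ← integral_const_mul]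
  refine (abs_integral_le_integral_abs).trans (integral_mono (integrable_of_continuous (by fun_prop))
    (integrable_of_continuous (by fun_prop)) fun x => ?_)
  simp only [ContinuousMap.sub_apply, nonlin_apply]
  have hx : |h x| ≤ ‖h‖ := h.norm_coe_le_norm x
  rw [abs_mul, mul_comm, mul_assoc]
  refine mul_le_mul hx ?_ (abs_nonneg _) (norm_nonneg _)
  generalize u x = p
  generalize v x = q
  have e1 : p ^ 3 - a * p - (q ^ 3 - a * q) = (p - q) * (p ^ 2 + p * q + q ^ 2 - a) := by ring
  have e2 : |p ^ 2 + p * q + q ^ 2 - a| ≤ 2 * (1 + |a|) * (1 + p ^ 2 + q ^ 2) := by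
    have ha1 := neg_abs_le a
    have ha2 := le_abs_self a
    have ha3 := abs_nonneg a
    have ha4 : 0 ≤ |a| * (p ^ 2 + q ^ 2) := by positivity
    rw [abs_le]
    constructor <;> nlinarith [sq_nonneg (p + q), sq_nonneg (p - q), sq_nonneg p, sq_nonneg q]
  rw [e1, abs_mul]
  have e3 : |p - q| * (1 + p ^ 2 + q ^ 2) ≤
      4 * (δ⁻¹ * (p - q) ^ 2 + δ * (1 + p ^ 4 + q ^ 4)) := by
    have hs : (p - q) ^ 2 = |p - q| ^ 2 := (sq_abs _).symm
    rw [hs]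
    generalize |p - q| = m
    have i1 : m * (1 + p ^ 2 + q ^ 2) ≤ δ⁻¹ * m ^ 2 + δ * (1 + p ^ 2 + q ^ 2) ^ 2 := by
      have : 0 ≤ δ⁻¹ * (m - δ * (1 + p ^ 2 + q ^ 2)) ^ 2 + m * (1 + p ^ 2 + q ^ 2) * 0 := by
        rw [mul_zero, add_zero]; positivity
      have e : δ⁻¹ * (m - δ * (1 + p ^ 2 + q ^ 2)) ^ 2 =
          δ⁻¹ * m ^ 2 - 2 * (m * (1 + p ^ 2 + q ^ 2)) + δ * (1 + p ^ 2 + q ^ 2) ^ 2 := by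
        field_simp
        ring
      have i0 : 0 ≤ δ⁻¹ * m ^ 2 + δ * (1 + p ^ 2 + q ^ 2) ^ 2 := by positivity
      linarith
    have i2 : (1 + p ^ 2 + q ^ 2) ^ 2 ≤ 4 * (1 + p ^ 4 + q ^ 4) := by
      nlinarith [sq_nonneg (p ^ 2 - 1), sq_nonneg (q ^ 2 - 1), sq_nonneg (p ^ 2 - q ^ 2)]
    have i3 := mul_le_mul_of_nonneg_left i2 hδ.le
    have i4 : 0 ≤ δ⁻¹ * m ^ 2 := by positivity
    linarith
  have hpos : 0 ≤ 2 * (1 + |a|) := by positivity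
  calc |p - q| * |p ^ 2 + p * q + q ^ 2 - a|
      ≤ |p - q| * (2 * (1 + |a|) * (1 + p ^ 2 + q ^ 2)) :=
        mul_le_mul_of_nonneg_left e2 (abs_nonneg _)
    _ = 2 * (1 + |a|) * (|p - q| * (1 + p ^ 2 + q ^ 2)) := by ring
    _ ≤ 2 * (1 + |a|) * (4 * (δ⁻¹ * (p - q) ^ 2 + δ * (1 + p ^ 4 + q ^ 4))) :=
        mul_le_mul_of_nonneg_left e3 hpos
    _ = _ := by ring

/-! ### Perturbed solutions and the energy identity -/

namespace SolutionSpace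

variable {T : ℝ} (u v : SolutionSpace T)

/-- The solution at time `s`, as a continuous function. -/
def ct (s : ℝ) : CT := H1.toCT (u.val s)

theorem aesm_val : AEStronglyMeasurable u.val (timeMeasure T) := Lp.aestronglyMeasurable _

theorem aesm_ct : AEStronglyMeasurable u.ct (timeMeasure T) :=
  H1.toCT.continuous.comp_aestronglyMeasurable u.aesm_val

theorem enorm_pow_eq (f : CT) : ∫⁻ x, ‖f x‖ₑ ^ 4 = ENNReal.ofReal (quart f) := by
  rw [quart, ofReal_integral_eq_lintegral_ofReal (integrable_of_continuous (by fun_prop))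
    (Eventually.of_forall fun x => by positivity)]
  refine lintegral_congr fun x => ?_
  rw [Real.enorm_eq_ofReal_abs, ← ENNReal.ofReal_pow (abs_nonneg _), ← abs_pow,
    abs_of_nonneg (by positivity)]

theorem lintegral_toL2 (φ : H1) :
    ∫⁻ x, ‖H1.toL2 φ x‖ₑ ^ 4 = ENNReal.ofReal (quart (H1.toCT φ)) := by
  rw [← enorm_pow_eq]
  refine lintegral_congr_ae ?_
  filter_upwards [coeFn_toL2 φ] with x hx
  rw [hx]

theorem integrable_quart : Integrable (fun s => quart (u.ct s)) (timeMeasure T) := by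
  refine ⟨continuous_quart.comp_aestronglyMeasurable u.aesm_ct, ?_⟩
  have h := u.memL4
  simp only [lintegral_toL2] at h
  rw [hasFiniteIntegral_iff_ofReal (Eventually.of_forall fun s => quart_nonneg _)]
  exact h

theorem memLp_val : MemLp u.val 2 (timeMeasure T) := Lp.memLp _

theorem memLp_toL2 : MemLp (fun s => H1.toL2 (u.val s)) 2 (timeMeasure T) :=
  H1.toL2.comp_memLp' u.memLp_val

theorem memLp_dx : MemLp (fun s => H1.dx (u.val s)) 2 (timeMeasure T) :=
  H1.dx.comp_memLp' u.memLp_val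

end SolutionSpace

theorem integrable_inner_const {T : ℝ} {f : ℝ → L2} (hf : MemLp f 2 (timeMeasure T)) (h : L2) :
    Integrable (fun s => ⟪f s, h⟫) (timeMeasure T) :=
  (hf.inner_const h).integrable one_le_two

theorem integrable_norm_sq {E : Type*} [NormedAddCommGroup E] {T : ℝ} {f : ℝ → E}
    (hf : MemLp f 2 (timeMeasure T)) : Integrable (fun s => ‖f s‖ ^ 2) (timeMeasure T) :=
  (memLp_two_iff_integrable_sq_norm hf.1).1 hf

theorem SolutionSpace.integrable_nonlin {T : ℝ} (u v : SolutionSpace T) (a : ℝ) (h : CT) :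
    Integrable (fun s => ⟪ctL2 (nonlin a (u.ct s) - nonlin a (v.ct s)), ctL2 h⟫)
      (timeMeasure T) := by
  have hb : Integrable (fun s => ‖h‖ * (8 * (1 + |a|)) *
      ((1 : ℝ)⁻¹ * ‖H1.toL2 (u.val s - v.val s)‖ ^ 2 +
      1 * (1 + quart (u.ct s) + quart (v.ct s)))) (timeMeasure T) := by
    have h1 : Integrable (fun s => ‖H1.toL2 (u.val s - v.val s)‖ ^ 2) (timeMeasure T) := by
      simp only [map_sub]
      exact integrable_norm_sq (u.memLp_toL2.sub v.memLp_toL2)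
    exact ((h1.const_mul (1 : ℝ)⁻¹).add ((((integrable_const (1 : ℝ)).add
      u.integrable_quart).add v.integrable_quart).const_mul 1)).const_mul (‖h‖ * (8 * (1 + |a|)))
  refine hb.mono' ?_ (Eventually.of_forall fun s => ?_)
  · have hc : Continuous fun f => ctL2 (nonlin a f) := ctL2.continuous.comp (continuous_nonlin a)
    have h1 := hc.comp_aestronglyMeasurable u.aesm_ct
    have h2 := hc.comp_aestronglyMeasurable v.aesm_ct
    simp only [map_sub]
    exact (h1.sub h2).inner_const (𝕜 := ℝ)
  · have := abs_inner_nonlin_sub_le a 1 one_pos (u.ct s) (v.ct s) h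
    have e : ctL2 (u.ct s - v.ct s) = H1.toL2 (u.val s - v.val s) := by
      rw [SolutionSpace.ct, SolutionSpace.ct, ← map_sub, ctL2_toCT]
    rw [e] at this
    exact this

/-- The zero path serves as a comparison point: integrability of $V'(u)$ alone follows from that of
the difference $V'(u)-V'(0)$. -/
instance {T : ℝ} : Zero (SolutionSpace T) where
  zero :=
    { path := 0
      val := 0
      compat := by
        filter_upwards [Lp.coeFn_zero H1 2 (timeMeasure T)] with t ht _
        rw [ht]
        ext φ
        simp [toHm1_apply]
      memL4 := by
        have : ∀ᵐ t ∂timeMeasure T,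
            ∫⁻ x, ‖H1.toL2 ((0 : Lp H1 2 (timeMeasure T)) t) x‖ₑ ^ 4 = 0 := by
          filter_upwards [Lp.coeFn_zero H1 2 (timeMeasure T)] with t ht
          rw [ht, SolutionSpace.lintegral_toL2]
          simp [quart]
        rw [lintegral_congr_ae this]
        simp }

theorem SolutionSpace.integrable_nonlin_single {T : ℝ} (u : SolutionSpace T) (a : ℝ) (h : CT) :
    Integrable (fun s => ⟪ctL2 (nonlin a (u.ct s)), ctL2 h⟫) (timeMeasure T) := by
  refine (u.integrable_nonlin 0 a h).congr ?_
  filter_upwards [Lp.coeFn_zero H1 2 (timeMeasure T)] with t ht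
  have : (0 : SolutionSpace T).ct t = 0 := by
    have : (0 : SolutionSpace T).val t = 0 := ht
    rw [SolutionSpace.ct, this, map_zero]
  rw [this]
  simp [nonlin]

/-- `u` solves the equation weakly, with initial datum `Φ`, and with `V'(u)` replaced by
`V'(u) + ρ` for a given `ρ`. The control is subsumed in `ρ`. -/
def IsPerturbedSolution {T : ℝ} (a D : ℝ) (Φ : Hm1) (ρ : ℝ → L2) (u : SolutionSpace T) : Prop :=
  ∀ (ψ : SmoothFun) (t : Set.Icc (0 : ℝ) T), u.path t ψ.toH1 = Φ ψ.toH1 +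
    ∫ s in (0 : ℝ)..t, (D / 2 * ⟪H1.dx (u.val s), ψ.dx.dx.dx.toL2⟫ +
      ⟪ctL2 (nonlin a (u.ct s)) + ρ s, ψ.dx.dx.toL2⟫)

theorem isWeakSolution_iff {T : ℝ} (a D : ℝ) (Φ : Hm1) (g : L2L2 T) (u : SolutionSpace T) :
    IsWeakSolution a D Φ g u ↔ IsPerturbedSolution a D Φ (fun s => √2 • prim (g s)) u := by
  refine forall₂_congr fun ψ t => ?_
  have h1 : ∀ s, ∫ x, H1.dx (u.val s) x * ψ.dx.dx.dx.onTorus x =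
      ⟪H1.dx (u.val s), ψ.dx.dx.dx.toL2⟫ := fun s => (inner_toL2 _ _).symm
  have h2 : ∀ s, ∫ x, deriv (potential a) (H1.toL2 (u.val s) x) * ψ.dx.dx.onTorus x =
      ⟪ctL2 (nonlin a (u.ct s)), ψ.dx.dx.toL2⟫ := fun s => by
    rw [ψ.dx.dx.toL2_eq, inner_ctL2_ctL2]
    refine integral_congr_ae ?_
    filter_upwards [coeFn_toL2 (u.val s)] with x hx
    rw [hx, deriv_potential, nonlin_apply, SolutionSpace.ct]
  have h3 : ∀ s, ∫ x, g s x * ψ.dx.onTorus x = ⟪prim (g s), ψ.dx.dx.toL2⟫ := fun s => by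
    rw [inner_prim, inner_toL2]
  simp only [h1, h2, h3]
  have i1 := intervalIntegrable_of_integrable (integrable_inner_const u.memLp_dx
    ψ.dx.dx.dx.toL2) t.2
  have i2 : IntervalIntegrable (fun s => ⟪ctL2 (nonlin a (u.ct s)), ψ.dx.dx.toL2⟫) volume 0 t := by
    rw [ψ.dx.dx.toL2_eq]
    exact intervalIntegrable_of_integrable (u.integrable_nonlin_single a _) t.2
  have i3 : IntervalIntegrable (fun s => ⟪prim (g s), ψ.dx.dx.toL2⟫) volume 0 t :=
    intervalIntegrable_of_integrable (integrable_inner_const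
      (prim.comp_memLp' (Lp.memLp g)) ψ.dx.dx.toL2) t.2
  have e : ∀ s, D / 2 * ⟪H1.dx (u.val s), ψ.dx.dx.dx.toL2⟫ +
      ⟪ctL2 (nonlin a (u.ct s)) + √2 • prim (g s), ψ.dx.dx.toL2⟫ =
      D / 2 * ⟪H1.dx (u.val s), ψ.dx.dx.dx.toL2⟫ + (⟪ctL2 (nonlin a (u.ct s)), ψ.dx.dx.toL2⟫ +
        √2 * ⟪prim (g s), ψ.dx.dx.toL2⟫) := fun s => by
    rw [inner_add_left, real_inner_smul_left]
  simp only [e]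
  rw [intervalIntegral.integral_add (i1.const_mul _) (i2.add (i3.const_mul _)),
    intervalIntegral.integral_add i2 (i3.const_mul _), intervalIntegral.integral_const_mul,
    intervalIntegral.integral_const_mul, add_assoc, add_assoc]

/-! ### Evolution and energy of a single mode. -/

section EnergyIdentity

variable {T a D : ℝ} {u v : SolutionSpace T} {Φ Ψ : Hm1} {ρ σ : ℝ → L2}

/-- The density of the `k`-th mode of the energy identity. -/
def modeDensity (a D : ℝ) (u v : SolutionSpace T) (ρ σ : ℝ → L2) (k : ℤ) (s : ℝ) : ℝ :=
  D / 2 * (lam k * coef k (H1.toL2 (u.val s - v.val s)) ^ 2) +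
    coef k (ctL2 (nonlin a (u.ct s) - nonlin a (v.ct s)) + (ρ s - σ s)) *
      coef k (H1.toL2 (u.val s - v.val s))

theorem integrable_perturbed (u : SolutionSpace T) (hρ : MemLp ρ 2 (timeMeasure T))
    (ψ : SmoothFun) :
    Integrable (fun s => D / 2 * ⟪H1.dx (u.val s), ψ.dx.dx.dx.toL2⟫ +
      ⟪ctL2 (nonlin a (u.ct s)) + ρ s, ψ.dx.dx.toL2⟫) (timeMeasure T) := by
  have h2 := u.integrable_nonlin_single a ψ.dx.dx.onTorus
  rw [← ψ.dx.dx.toL2_eq] at h2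
  simp only [inner_add_left]
  exact ((integrable_inner_const u.memLp_dx _).const_mul _).add
    (h2.add (integrable_inner_const hρ _))

theorem integral_perturbed_cas (k : ℤ) (φ : H1) (f : L2) :
    D / 2 * ⟪H1.dx φ, (cas k).dx.dx.dx.toL2⟫ + ⟪f, (cas k).dx.dx.toL2⟫ =
      -lam k * (D / 2 * lam k * coef k (H1.toL2 φ) + coef k f) := by
  rw [cas_dx_dx_dx_toL2, real_inner_smul_right, H1.inner_dx, cas_dx_dx_toL2,
    real_inner_smul_right, real_inner_smul_right, ← coef_apply', ← coef_apply', lam]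
  ring

/-- The evolution of the `k`-th mode of the difference of two perturbed solutions. -/
theorem mode_eq (hρ : MemLp ρ 2 (timeMeasure T)) (hσ : MemLp σ 2 (timeMeasure T))
    (hu : IsPerturbedSolution a D Φ ρ u) (hv : IsPerturbedSolution a D Ψ σ v) (k : ℤ)
    (t : Set.Icc 0 T) :
    (u.path t - v.path t) (casH1 k) = (Φ - Ψ) (casH1 k) + ∫ s in (0 : ℝ)..t,
      -lam k * (D / 2 * lam k * coef k (H1.toL2 (u.val s - v.val s)) +
        coef k (ctL2 (nonlin a (u.ct s) - nonlin a (v.ct s)) + (ρ s - σ s))) := by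
  have h1 := hu (cas k) t
  have h2 := hv (cas k) t
  have i1 := intervalIntegrable_of_integrable (integrable_perturbed (a := a) (D := D) u hρ
    (cas k)) t.2
  have i2 := intervalIntegrable_of_integrable (integrable_perturbed (a := a) (D := D) v hσ
    (cas k)) t.2
  simp only [sub_apply]
  rw [casH1, h1, h2, add_sub_add_comm, ← intervalIntegral.integral_sub i1 i2]
  congr 1
  refine intervalIntegral.integral_congr fun s _ => ?_
  simp only [integral_perturbed_cas, map_sub, map_add]
  ring

theorem integrable_mode (hρ : MemLp ρ 2 (timeMeasure T)) (hσ : MemLp σ 2 (timeMeasure T))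
    (k : ℤ) : Integrable (fun s => -lam k * (D / 2 * lam k * coef k (H1.toL2 (u.val s - v.val s)) +
        coef k (ctL2 (nonlin a (u.ct s) - nonlin a (v.ct s)) + (ρ s - σ s)))) (timeMeasure T) := by
  have i1 := integrable_perturbed (a := a) (D := D) u hρ (cas k)
  have i2 := integrable_perturbed (a := a) (D := D) v hσ (cas k)
  refine (i1.sub i2).congr (Eventually.of_forall fun s => ?_)
  simp only [Pi.sub_apply, integral_perturbed_cas, map_sub, map_add]
  ring

theorem ae_coef_eq (u v : SolutionSpace T) (k : ℤ) :
    ∀ᵐ s ∂timeMeasure T, ∀ hs : s ∈ Set.Icc 0 T,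
      coef k (H1.toL2 (u.val s - v.val s)) = (u.path ⟨s, hs⟩ - v.path ⟨s, hs⟩) (casH1 k) := by
  filter_upwards [u.compat, v.compat] with s h1 h2 hs
  rw [h1 hs, h2 hs, sub_apply, toHm1_casH1, toHm1_casH1, map_sub, map_sub]

/-- The mode $W$ solves $W'=G$. Multiplying by $W/\lambda_k$ and using the product rule for
primitives gives the energy balance of mode $k$. -/
theorem mode_energy (hρ : MemLp ρ 2 (timeMeasure T)) (hσ : MemLp σ 2 (timeMeasure T))
    (hu : IsPerturbedSolution a D Φ ρ u) (hv : IsPerturbedSolution a D Ψ σ v)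
    (h0 : (Φ - Ψ) (casH1 0) = 0) (k : ℤ) (t : Set.Icc 0 T) :
    IntervalIntegrable (modeDensity a D u v ρ σ k) volume 0 t ∧
    (u.path t - v.path t) (casH1 k) ^ 2 / (2 * lam k) +
      ∫ s in (0 : ℝ)..t, modeDensity a D u v ρ σ k s = (Φ - Ψ) (casH1 k) ^ 2 / (2 * lam k) := by
  set G : ℝ → ℝ := fun s => -lam k * (D / 2 * lam k * coef k (H1.toL2 (u.val s - v.val s)) +
        coef k (ctL2 (nonlin a (u.ct s) - nonlin a (v.ct s)) + (ρ s - σ s))) with hG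
  have hGi : Integrable G (timeMeasure T) := integrable_mode hρ hσ k
  have hGt := intervalIntegrable_of_integrable hGi t.2
  set W : ℝ → ℝ := fun s => (Φ - Ψ) (casH1 k) + ∫ r in (0 : ℝ)..s, G r with hW
  have hWp : ∀ s : Set.Icc 0 T, W s = (u.path s - v.path s) (casH1 k) := fun s =>
    (mode_eq hρ hσ hu hv k s).symm
  have hae : ∀ᵐ s, s ∈ Set.uIoc 0 (t : ℝ) →
      coef k (H1.toL2 (u.val s - v.val s)) = W s := by
    refine ae_uIoc_of_ae (p := fun s => coef k (H1.toL2 (u.val s - v.val s)) = W s) ?_ t.2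
    filter_upwards [ae_coef_eq u v k, ae_restrict_mem measurableSet_Icc] with s h1 h2
    rw [h1 h2, ← hWp ⟨s, h2⟩]
  by_cases hk : k = 0
  -- Division by $\lambda_0=0$ kills both boundary terms, so the density itself has to vanish. It
  -- does, because the mean is conserved and the two means agree.
  · subst hk
    have hz : ∀ᵐ s, s ∈ Set.uIoc 0 (t : ℝ) → modeDensity a D u v ρ σ 0 s = 0 := by
      filter_upwards [hae] with s hs hst
      have hW0 : W s = 0 := by simp [hW, hG, lam_zero, h0]
      rw [modeDensity, hs hst, hW0]
      ring
    constructor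
    · exact (IntervalIntegrable.zero (a := 0) (b := (t : ℝ)) (μ := volume)
        (E := ℝ)).congr_ae (((ae_restrict_iff' measurableSet_uIoc).2 hz).mono fun s hs => hs.symm)
    · rw [intervalIntegral.integral_congr_ae hz]
      simp [lam_zero]
  · have hl := one_le_lam hk
    have hl0 : lam k ≠ 0 := by linarith
    have hm : ∀ᵐ s, s ∈ Set.uIoc 0 (t : ℝ) →
        modeDensity a D u v ρ σ k s = -(2 * lam k)⁻¹ * (G s * W s + W s * G s) := by
      filter_upwards [hae] with s hs hst
      rw [modeDensity, hG]
      simp only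
      rw [hs hst]
      field_simp
      ring
    have hWc : ContinuousOn W (Set.uIcc 0 (t : ℝ)) :=
      continuousOn_const.add (intervalIntegral.continuousOn_primitive_interval
        ((intervalIntegrable_iff_integrableOn_Icc_of_le t.2.1).1 hGt |>.mono_set
          (by rw [Set.uIcc_of_le t.2.1])))
    have hint : IntervalIntegrable (fun s => -(2 * lam k)⁻¹ * (G s * W s + W s * G s))
        volume 0 t :=
      ((hGt.mul_continuousOn hWc).add (hGt.continuousOn_mul hWc)).const_mul _
    refine ⟨hint.congr_ae (((ae_restrict_iff' measurableSet_uIoc).2 hm).mono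
      fun s hs => hs.symm), ?_⟩
    rw [intervalIntegral.integral_congr_ae hm, intervalIntegral.integral_const_mul]
    have hp := primitive_mul_primitive hGt hGt ((Φ - Ψ) (casH1 k)) ((Φ - Ψ) (casH1 k))
    have hWt := hWp t
    simp only [hW] at hWt ⊢
    rw [hWt, ← sub_eq_iff_eq_add'] at hp
    rw [← hp]
    field_simp
    ring
end EnergyIdentity

/-! ### Time integrability of the pairings. -/

theorem abs_inner_le_add {E : Type*} [NormedAddCommGroup E] [InnerProductSpace ℝ E] (f g : E) :
    |⟪f, g⟫| ≤ ‖f‖ ^ 2 + ‖g‖ ^ 2 := by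
  have := abs_real_inner_le_norm f g
  nlinarith [sq_nonneg (‖f‖ - ‖g‖), sq_nonneg ‖f‖, sq_nonneg ‖g‖]

theorem integrable_inner {T : ℝ} {f g : ℝ → L2} (hf : MemLp f 2 (timeMeasure T))
    (hg : MemLp g 2 (timeMeasure T)) : Integrable (fun s => ⟪f s, g s⟫) (timeMeasure T) :=
  ((integrable_norm_sq hf).add (integrable_norm_sq hg)).mono' (hf.1.inner hg.1)
    (Eventually.of_forall fun _ => abs_inner_le_add _ _)

theorem quart_sub_le_add (f h : CT) : quart (f - h) ≤ 8 * (1 + quart f + quart h) := by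
  rw [← integral_one_add_pow, quart, ← integral_const_mul]
  refine integral_mono (integrable_of_continuous (by fun_prop))
    (integrable_of_continuous (by fun_prop)) fun x => ?_
  simp only [ContinuousMap.sub_apply]
  generalize f x = p
  generalize h x = q
  have h1 : (p - q) ^ 2 ≤ 2 * (p ^ 2 + q ^ 2) := by nlinarith [sq_nonneg (p + q)]
  have h2 : ((p - q) ^ 2) ^ 2 ≤ (2 * (p ^ 2 + q ^ 2)) ^ 2 :=
    pow_le_pow_left₀ (sq_nonneg _) h1 2
  nlinarith [sq_nonneg (p ^ 2 - q ^ 2)]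

/-! ### Summation over the modes and the stability estimate. -/

section EnergyIdentity

variable {T a D : ℝ} {u v : SolutionSpace T} {Φ Ψ : Hm1} {ρ σ : ℝ → L2}

theorem memLp_toL2_sub (u v : SolutionSpace T) :
    MemLp (fun s => H1.toL2 (u.val s - v.val s)) 2 (timeMeasure T) := by
  simp only [map_sub]
  exact u.memLp_toL2.sub v.memLp_toL2

theorem memLp_dx_sub (u v : SolutionSpace T) :
    MemLp (fun s => H1.dx (u.val s - v.val s)) 2 (timeMeasure T) := by
  simp only [map_sub]
  exact u.memLp_dx.sub v.memLp_dx

theorem ctL2_ct_sub (u v : SolutionSpace T) (s : ℝ) :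
    ctL2 (u.ct s - v.ct s) = H1.toL2 (u.val s - v.val s) := by
  rw [SolutionSpace.ct, SolutionSpace.ct, ← map_sub, ctL2_toCT]

theorem integrable_quart_bound (u v : SolutionSpace T) (c : ℝ) :
    Integrable (fun s => c * (1 + quart (u.ct s) + quart (v.ct s))) (timeMeasure T) :=
  ((((integrable_const (1 : ℝ)).add u.integrable_quart).add v.integrable_quart).const_mul c)

/-- Limit of the Cesàro bounds. It makes the nonlinear pairing integrable in time knowing only the
$L^4$ integrability of the two solutions. -/
theorem abs_inner_nonlin_sub_le' (a : ℝ) (f h : CT) :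
    |⟪ctL2 (nonlin a f - nonlin a h), ctL2 (f - h)⟫| ≤ 8 * (1 + |a|) * (1 + quart f + quart h) := by
  have h1 := (tendsto_cesaro (hasSum_coef_mul (ctL2 (nonlin a f - nonlin a h)) (ctL2 (f - h)))).abs
  refine le_of_tendsto h1 ?_
  filter_upwards [eventually_ne_atTop 0] with N hN
  exact abs_cesaro_nonlin_le hN a f h

theorem integrable_inner_nonlin (u v : SolutionSpace T) (a : ℝ) :
    Integrable (fun s => ⟪ctL2 (nonlin a (u.ct s) - nonlin a (v.ct s)),
      H1.toL2 (u.val s - v.val s)⟫) (timeMeasure T) := by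
  refine (integrable_quart_bound u v (8 * (1 + |a|))).mono' ?_ (Eventually.of_forall fun s => ?_)
  · have hc : Continuous fun f => ctL2 (nonlin a f) := ctL2.continuous.comp (continuous_nonlin a)
    have h1 := hc.comp_aestronglyMeasurable u.aesm_ct
    have h2 := hc.comp_aestronglyMeasurable v.aesm_ct
    simp only [map_sub (f := ctL2)]
    exact (h1.sub h2).inner (memLp_toL2_sub u v).1
  · rw [← ctL2_ct_sub]
    exact abs_inner_nonlin_sub_le' a _ _

theorem integrable_quart_sub (u v : SolutionSpace T) :
    Integrable (fun s => quart (u.ct s - v.ct s)) (timeMeasure T) := by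
  refine (integrable_quart_bound u v 8).mono'
    (continuous_quart.comp_aestronglyMeasurable (u.aesm_ct.sub v.aesm_ct))
    (Eventually.of_forall fun s => ?_)
  rw [Real.norm_of_nonneg (quart_nonneg _)]
  exact quart_sub_le_add _ _

theorem hasSum_modeDensity (a D : ℝ) (u v : SolutionSpace T) (ρ σ : ℝ → L2) (s : ℝ) :
    HasSum (fun k => modeDensity a D u v ρ σ k s)
      (D / 2 * ‖H1.dx (u.val s - v.val s)‖ ^ 2 +
        ⟪ctL2 (nonlin a (u.ct s) - nonlin a (v.ct s)) + (ρ s - σ s),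
          H1.toL2 (u.val s - v.val s)⟫) :=
  ((hasSum_lam _).mul_left _).add (hasSum_coef_mul _ _)

/-- The dominating function for the energy identity. The quadratic parts are bounded by nonnegative
series; only the nonlinear part needs the Fejér kernel. -/
theorem abs_cesaro_modeDensity_le {N : ℕ} (hN : N ≠ 0) (a : ℝ) {D : ℝ} (hD : 0 ≤ D)
    (u v : SolutionSpace T) (ρ σ : ℝ → L2) (s : ℝ) :
    |cesaro N (fun k => modeDensity a D u v ρ σ k s)| ≤
      D / 2 * ‖H1.dx (u.val s - v.val s)‖ ^ 2 +
      8 * (1 + |a|) * (1 + quart (u.ct s) + quart (v.ct s)) +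
      (‖ρ s - σ s‖ ^ 2 + ‖H1.toL2 (u.val s - v.val s)‖ ^ 2) := by
  have e : ∀ k, modeDensity a D u v ρ σ k s =
      D / 2 * (lam k * coef k (H1.toL2 (u.val s - v.val s)) ^ 2) +
      coef k (ctL2 (nonlin a (u.ct s) - nonlin a (v.ct s))) * coef k (ctL2 (u.ct s - v.ct s)) +
      coef k (ρ s - σ s) * coef k (H1.toL2 (u.val s - v.val s)) := fun k => by
    rw [modeDensity, ctL2_ct_sub, map_add]
    ring
  simp only [e]
  rw [cesaro_add, cesaro_add]
  refine (abs_add_le _ _).trans (add_le_add ((abs_add_le _ _).trans (add_le_add ?_ ?_)) ?_)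
  · refine abs_cesaro_le ((hasSum_lam _).mul_left _) (fun k => le_of_eq (abs_of_nonneg ?_)) N
    have := lam_nonneg k
    positivity
  · exact abs_cesaro_nonlin_le hN a _ _
  · refine abs_cesaro_le ((hasSum_coef_sq _).add (hasSum_coef_sq _)) (fun k => ?_) N
    generalize coef k (ρ s - σ s) = p
    generalize coef k (H1.toL2 (u.val s - v.val s)) = q
    rw [abs_le]
    constructor <;> nlinarith [sq_nonneg (p + q), sq_nonneg (p - q), sq_nonneg p, sq_nonneg q]

/-- The energy identity in `H⁻¹` for the difference of two solutions with the same mean. -/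
theorem energy_identity (hD : 0 ≤ D) (hρ : MemLp ρ 2 (timeMeasure T))
    (hσ : MemLp σ 2 (timeMeasure T)) (hu : IsPerturbedSolution a D Φ ρ u)
    (hv : IsPerturbedSolution a D Ψ σ v) (h0 : (Φ - Ψ) (casH1 0) = 0) (t : Set.Icc 0 T) :
    homEnergy (u.path t - v.path t) + ∫ s in (0 : ℝ)..t,
      (D / 2 * ‖H1.dx (u.val s - v.val s)‖ ^ 2 +
        ⟪ctL2 (nonlin a (u.ct s) - nonlin a (v.ct s)) + (ρ s - σ s),
          H1.toL2 (u.val s - v.val s)⟫) = homEnergy (Φ - Ψ) := by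
  have hm := mode_energy hρ hσ hu hv h0
  have hi : ∀ k, IntegrableOn (modeDensity a D u v ρ σ k) (Set.Ioc 0 t) := fun k =>
    (intervalIntegrable_iff_integrableOn_Ioc_of_le t.2.1).1 (hm k t).1
  have hN : ∀ N, cesaro N (fun k => (u.path t - v.path t) (casH1 k) ^ 2 / (2 * lam k)) +
      ∫ s in (0 : ℝ)..t, cesaro N (fun k => modeDensity a D u v ρ σ k s) =
      cesaro N (fun k => (Φ - Ψ) (casH1 k) ^ 2 / (2 * lam k)) := fun N => by
    rw [intervalIntegral.integral_of_le t.2.1, integral_cesaro hi, ← cesaro_add]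
    congr 1
    ext k
    rw [← intervalIntegral.integral_of_le t.2.1, (hm k t).2]
  have l1 := tendsto_cesaro (summable_homEnergy (u.path t - v.path t)).hasSum
  have l2 := tendsto_cesaro (summable_homEnergy (Φ - Ψ)).hasSum
  have l3 : Tendsto (fun N => ∫ s in (0 : ℝ)..t, cesaro N (fun k => modeDensity a D u v ρ σ k s))
      atTop (𝓝 (∫ s in (0 : ℝ)..t, (D / 2 * ‖H1.dx (u.val s - v.val s)‖ ^ 2 +
        ⟪ctL2 (nonlin a (u.ct s) - nonlin a (v.ct s)) + (ρ s - σ s),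
          H1.toL2 (u.val s - v.val s)⟫))) := by
    -- Pointwise in time the means converge to the Parseval sum, and they are dominated by an
    -- integrable function independent of $N$.
    refine intervalIntegral.tendsto_integral_filter_of_dominated_convergence
      (fun s => D / 2 * ‖H1.dx (u.val s - v.val s)‖ ^ 2 +
      8 * (1 + |a|) * (1 + quart (u.ct s) + quart (v.ct s)) +
      (‖ρ s - σ s‖ ^ 2 + ‖H1.toL2 (u.val s - v.val s)‖ ^ 2)) ?_ ?_ ?_ ?_
    · refine Eventually.of_forall fun N => ?_
      rw [Set.uIoc_of_le t.2.1]
      exact (integrable_cesaro hi N).1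
    · filter_upwards [eventually_ne_atTop 0] with N hN
      exact Eventually.of_forall fun s _ => abs_cesaro_modeDensity_le hN a hD u v ρ σ s
    · refine intervalIntegrable_of_integrable ?_ t.2
      exact (((integrable_norm_sq (memLp_dx_sub u v)).const_mul _).add
        (integrable_quart_bound u v _)).add ((integrable_norm_sq (hρ.sub hσ)).add
          (integrable_norm_sq (memLp_toL2_sub u v)))
    · exact Eventually.of_forall fun s _ =>
        tendsto_cesaro (hasSum_modeDensity a D u v ρ σ s)
  have l4 := l1.add l3
  simp only [hN] at l4
  exact tendsto_nhds_unique l4 l2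

theorem path_sub_casH1_zero (hρ : MemLp ρ 2 (timeMeasure T)) (hσ : MemLp σ 2 (timeMeasure T))
    (hu : IsPerturbedSolution a D Φ ρ u) (hv : IsPerturbedSolution a D Ψ σ v)
    (h0 : (Φ - Ψ) (casH1 0) = 0) (t : Set.Icc 0 T) : (u.path t - v.path t) (casH1 0) = 0 := by
  rw [mode_eq hρ hσ hu hv 0 t, h0]
  simp [lam_zero]

theorem ae_coef_zero (hρ : MemLp ρ 2 (timeMeasure T)) (hσ : MemLp σ 2 (timeMeasure T))
    (hu : IsPerturbedSolution a D Φ ρ u) (hv : IsPerturbedSolution a D Ψ σ v)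
    (h0 : (Φ - Ψ) (casH1 0) = 0) :
    ∀ᵐ s ∂timeMeasure T, coef 0 (H1.toL2 (u.val s - v.val s)) = 0 := by
  filter_upwards [ae_coef_eq u v 0, ae_restrict_mem measurableSet_Icc] with s h1 h2
  rw [h1 h2, path_sub_casH1_zero hρ hσ hu hv h0]

/-- The stability estimate for the difference of two solutions with the same mean. -/
theorem energy_estimate (hD : 0 < D) (ha : a < 0) (hρ : MemLp ρ 2 (timeMeasure T))
    (hσ : MemLp σ 2 (timeMeasure T)) (hu : IsPerturbedSolution a D Φ ρ u)
    (hv : IsPerturbedSolution a D Ψ σ v) (h0 : (Φ - Ψ) (casH1 0) = 0) (t : Set.Icc 0 T) :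
    homEnergy (u.path t - v.path t) + ∫ s in (0 : ℝ)..t,
      (D / 4 * ‖H1.dx (u.val s - v.val s)‖ ^ 2 + 1 / 4 * quart (u.ct s - v.ct s)) ≤
      homEnergy (Φ - Ψ) + D⁻¹ * ∫ s in (0 : ℝ)..t, ‖ρ s - σ s‖ ^ 2 := by
  have hid := energy_identity hD.le hρ hσ hu hv h0 t
  have id2 := (integrable_norm_sq (memLp_dx_sub u v))
  have ir : Integrable (fun s => ‖ρ s - σ s‖ ^ 2) (timeMeasure T) := integrable_norm_sq (hρ.sub hσ)
  have iF := (integrable_inner_nonlin u v a).add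
    (integrable_inner (hρ.sub hσ) (memLp_toL2_sub u v))
  have iL : Integrable (fun s => D / 4 * ‖H1.dx (u.val s - v.val s)‖ ^ 2 +
      1 / 4 * quart (u.ct s - v.ct s)) (timeMeasure T) := (id2.const_mul (D / 4)).add ((integrable_quart_sub u v).const_mul (1 / 4))
  have key : ∫ s in (0 : ℝ)..t, ((D / 4 * ‖H1.dx (u.val s - v.val s)‖ ^ 2 +
      1 / 4 * quart (u.ct s - v.ct s)) - D⁻¹ * ‖ρ s - σ s‖ ^ 2) ≤
      ∫ s in (0 : ℝ)..t, (D / 2 * ‖H1.dx (u.val s - v.val s)‖ ^ 2 +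
        ⟪ctL2 (nonlin a (u.ct s) - nonlin a (v.ct s)) + (ρ s - σ s),
          H1.toL2 (u.val s - v.val s)⟫) := by
    refine intervalIntegral.integral_mono_ae_restrict t.2.1
      (intervalIntegrable_of_integrable (iL.sub (ir.const_mul _)) t.2)
      (intervalIntegrable_of_integrable (((id2.const_mul (D / 2)).add iF).congr
        (Eventually.of_forall fun s => by simp [inner_add_left])) t.2) ?_
    have hz := ae_coef_zero hρ hσ hu hv h0
    have hz' : ∀ᵐ s ∂volume.restrict (Set.Icc 0 (t : ℝ)),
        coef 0 (H1.toL2 (u.val s - v.val s)) = 0 :=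
      ae_mono (Measure.restrict_mono (Set.Icc_subset_Icc_right t.2.2) le_rfl) hz
    filter_upwards [hz'] with s hs
    have h1 := norm_toL2_le_norm_dx _ hs
    have h2 := quart_sub_le ha (u.ct s) (v.ct s)
    rw [ctL2_ct_sub] at h2
    have h3 := (abs_le.1 (abs_real_inner_le_norm (ρ s - σ s) (H1.toL2 (u.val s - v.val s)))).1
    rw [inner_add_left]
    set r := ‖ρ s - σ s‖
    set d := ‖H1.dx (u.val s - v.val s)‖
    have h4 : r * ‖H1.toL2 (u.val s - v.val s)‖ ≤ r * d :=
      mul_le_mul_of_nonneg_left h1 (norm_nonneg _)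
    -- Young's inequality, spending half of the dissipation $\frac D2d^2$ on the forcing; the other
    -- half remains in the estimate.
    have h5 : r * d ≤ D / 4 * d ^ 2 + D⁻¹ * r ^ 2 := by
      have : 0 ≤ D⁻¹ * (r - D / 2 * d) ^ 2 := by positivity
      have e : D⁻¹ * (r - D / 2 * d) ^ 2 = D⁻¹ * r ^ 2 - r * d + D / 4 * d ^ 2 := by
        field_simp
        ring
      linarith
    linarith
  rw [intervalIntegral.integral_sub (intervalIntegrable_of_integrable iL t.2)
    (intervalIntegrable_of_integrable (ir.const_mul _) t.2),
    intervalIntegral.integral_const_mul] at key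
  linarith

end EnergyIdentity

/-! ### Global solutions of ordinary differential equations -/

section ODE

variable {X : Type*} [NormedAddCommGroup X] [NormedSpace ℝ X]

/-- Global existence for a bounded Lipschitz vector field with continuous forcing. -/
theorem exists_solution_of_bounded_lipschitz [CompleteSpace X] {f : X → X} {b : ℝ → X}
    {K : NNReal} {M B T : ℝ} (hT : 0 ≤ T) (hK : LipschitzWith K f) (hM : ∀ x, ‖f x‖ ≤ M)
    (hb : Continuous b) (hB : ∀ t, ‖b t‖ ≤ B) (x₀ : X) :
    ∃ x : ℝ → X, x 0 = x₀ ∧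
      ∀ t ∈ Set.Icc 0 T, HasDerivWithinAt x (f (x t) + b t) (Set.Icc 0 T) t := by
  have hM0 : 0 ≤ M := (norm_nonneg _).trans (hM x₀)
  have hB0 : 0 ≤ B := (norm_nonneg _).trans (hB 0)
  have h : IsPicardLindelof (fun t x => f x + b t) (⟨0, le_rfl, hT⟩ : Set.Icc 0 T) x₀
      (Real.toNNReal ((M + B) * T)) 0 (Real.toNNReal (M + B)) K :=
    { lipschitzOnWith := fun t _ x _ y _ => by
        simpa only [edist_add_right] using hK x y
      continuousOn := fun x _ => (continuous_const.add hb).continuousOn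
      norm_le := fun t _ x _ => by
        rw [Real.coe_toNNReal _ (by positivity)]
        exact (norm_add_le _ _).trans (add_le_add (hM x) (hB t))
      mul_max_le := by
        rw [Real.coe_toNNReal _ (by positivity), Real.coe_toNNReal _ (by positivity)]
        simp [hT] }
  obtain ⟨x, h0, hx⟩ := h.exists_eq_forall_mem_Icc_hasDerivWithinAt₀
  exact ⟨x, h0, hx⟩

/-- Global existence for a `C¹` vector field with continuous forcing in a finite-dimensional
space, in the presence of an a priori bound. -/
theorem exists_solution_of_bound [FiniteDimensional ℝ X] {F : X → X} {b : ℝ → X} {B T R : ℝ}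
    (hT : 0 ≤ T) (hF : ContDiff ℝ 1 F) (hb : Continuous b) (hB : ∀ t, ‖b t‖ ≤ B) {x₀ : X}
    (hx0 : ‖x₀‖ < R)
    (hR : ∀ (x : ℝ → X) (τ : ℝ), τ ∈ Set.Icc 0 T → x 0 = x₀ →
      (∀ t ∈ Set.Icc 0 τ, HasDerivWithinAt x (F (x t) + b t) (Set.Icc 0 τ) t) → ‖x τ‖ < R) :
    ∃ x : ℝ → X, x 0 = x₀ ∧
      ∀ t ∈ Set.Icc 0 T, HasDerivWithinAt x (F (x t) + b t) (Set.Icc 0 T) t := by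
  have : CompleteSpace X := FiniteDimensional.complete ℝ X
  have hR0 : 0 < R := (norm_nonneg _).trans_lt hx0
  -- Multiplying by a cutoff equal to $1$ on the ball of radius $R$ makes the field bounded and
  -- globally Lipschitz.
  let χ : ContDiffBump (0 : X) := ⟨R, R + 1, hR0, by linarith⟩
  have hcs : HasCompactSupport fun x => χ x • F x := χ.hasCompactSupport.smul_right
  have hcd : ContDiff ℝ 1 fun x => χ x • F x := χ.contDiff.smul hF
  obtain ⟨K, hK⟩ := hcd.lipschitzWith_of_hasCompactSupport hcs one_ne_zero
  obtain ⟨M, hM⟩ := hcs.exists_bound_of_continuous hcd.continuous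
  obtain ⟨x, h0, hx⟩ := exists_solution_of_bounded_lipschitz hT hK hM hb hB x₀
  have hxc : ContinuousOn x (Set.Icc 0 T) := fun t ht => (hx t ht).continuousWithinAt
  have hloc : ∀ τ ∈ Set.Icc 0 T, (∀ t ∈ Set.Icc 0 τ, ‖x t‖ ≤ R) →
      ∀ t ∈ Set.Icc 0 τ, HasDerivWithinAt x (F (x t) + b t) (Set.Icc 0 τ) t := fun τ hτ hb t ht => by
    have h1 := (hx t ⟨ht.1, ht.2.trans hτ.2⟩).mono (Set.Icc_subset_Icc_right hτ.2)
    have h2 : χ (x t) = 1 := χ.one_of_mem_closedBall (by simpa using hb t ht)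
    simpa only [h2, one_smul] using h1
  have hlt : ∀ t ∈ Set.Icc 0 T, ‖x t‖ < R := by
    by_contra! hcon
    set A := {t ∈ Set.Icc 0 T | R ≤ ‖x t‖} with hA
    have hAne : A.Nonempty := hcon
    have hAc : IsClosed A := hxc.norm.preimage_isClosed_of_isClosed isClosed_Icc isClosed_Ici
    have hAb : BddBelow A := ⟨0, fun t ht => ht.1.1⟩
    have hmem := hAc.csInf_mem hAne hAb
    -- The first time at which the norm reaches $R$. Up to $\tau$ the cutoff is inactive, so the a
    -- priori bound applies at $\tau$ and contradicts its definition.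
    set τ := sInf A
    have hlow : ∀ t ∈ Set.Ico 0 τ, ‖x t‖ < R := fun t ht => by
      by_contra! h
      exact absurd (csInf_le hAb ⟨⟨ht.1, ht.2.le.trans hmem.1.2⟩, h⟩) (not_le.2 ht.2)
    have hτ0 : 0 < τ := by
      refine lt_of_le_of_ne hmem.1.1 fun h => ?_
      have := hmem.2
      rw [← h, h0] at this
      linarith
    have hle : ∀ t ∈ Set.Icc 0 τ, ‖x t‖ ≤ R := by
      have hcl : Set.Icc 0 τ ⊆ closure (Set.Ico 0 τ) := by rw [closure_Ico hτ0.ne]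
      intro t ht
      have hc : ContinuousWithinAt (fun t => ‖x t‖) (Set.Ico 0 τ) t :=
        ((hxc.norm) t ⟨ht.1, ht.2.trans hmem.1.2⟩).mono fun s hs =>
          ⟨hs.1, hs.2.le.trans hmem.1.2⟩
      have := hc.mem_closure (hcl ht) (t := Set.Iic R) fun s hs => (hlow s hs).le
      rwa [isClosed_Iic.closure_eq] at this
    have := hR x τ hmem.1 h0 (hloc τ hmem.1 hle)
    exact absurd hmem.2 (not_le.2 this)
  exact ⟨x, h0, hloc T ⟨hT, le_rfl⟩ fun t ht => (hlt t ht).le⟩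

end ODE

/-! ### Galerkin approximation -/

/-- The trigonometric polynomial with given coefficients, as a function of the coefficients. -/
def galerkinEmb (S : Finset ℤ) : (S → ℝ) →L[ℝ] H1 :=
  ∑ n : S, (ContinuousLinearMap.proj (R := ℝ) (φ := fun _ : S => ℝ) n).smulRight (casH1 n)

theorem galerkinEmb_apply (S : Finset ℤ) (x : S → ℝ) :
    galerkinEmb S x = ∑ n : S, x n • casH1 n := by
  simp [galerkinEmb]

theorem inner_galerkinEmb (S : Finset ℤ) (x : S → ℝ) (f : L2) :
    ⟪f, H1.toL2 (galerkinEmb S x)⟫ = ∑ n : S, x n * coef n f := by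
  simp only [galerkinEmb_apply, map_sum, map_smul, inner_sum, real_inner_smul_right, casH1_toL2,
    coef_apply']

theorem inner_dx_galerkinEmb (S : Finset ℤ) (x : S → ℝ) (φ : H1) :
    ⟪H1.dx φ, H1.dx (galerkinEmb S x)⟫ = ∑ n : S, x n * (lam n * coef n (H1.toL2 φ)) := by
  simp only [galerkinEmb_apply, map_sum, map_smul, inner_sum, real_inner_smul_right, casH1_dx,
    ← coef_apply', coef_neg_dx, lam]
  exact Finset.sum_congr rfl fun n _ => by ring

theorem coef_galerkinEmb (S : Finset ℤ) (x : S → ℝ) (k : ℤ) :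
    coef k (H1.toL2 (galerkinEmb S x)) = if h : k ∈ S then x ⟨k, h⟩ else 0 := by
  rw [coef_apply, inner_galerkinEmb]
  simp only [coef_e]
  split_ifs with h
  · rw [Finset.sum_eq_single ⟨k, h⟩]
    · simp
    · intro n _ hn
      have : (n : ℤ) ≠ k := fun h' => hn (Subtype.ext h')
      simp [this]
    · simp
  · refine Finset.sum_eq_zero fun n _ => ?_
    have : (n : ℤ) ≠ k := fun h' => h (h' ▸ n.2)
    simp [this]

theorem coef_galerkinEmb_mem (S : Finset ℤ) (x : S → ℝ) (n : S) :
    coef n (H1.toL2 (galerkinEmb S x)) = x n := by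
  rw [coef_galerkinEmb, dif_pos n.2]

theorem galerkinEmb_coef {S : Finset ℤ} {φ : H1} (h : ∀ n ∉ S, coef n (H1.toL2 φ) = 0) :
    galerkinEmb S (fun n => coef n (H1.toL2 φ)) = φ := by
  refine H1.ext_toL2 (ext_coef fun k => ?_)
  rw [coef_galerkinEmb]
  split_ifs with hk
  · rfl
  · exact (h k hk).symm

theorem abs_coef_le (n : ℤ) (f : L2) : |coef n f| ≤ ‖f‖ := by
  refine abs_le_of_sq_le_sq ?_ (norm_nonneg _)
  exact le_hasSum (hasSum_coef_sq f) n fun _ _ => sq_nonneg _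

theorem norm_le_galerkinEmb (S : Finset ℤ) (x : S → ℝ) : ‖x‖ ≤ ‖galerkinEmb S x‖ := by
  rw [pi_norm_le_iff_of_nonneg (norm_nonneg _)]
  intro n
  rw [Real.norm_eq_abs, ← coef_galerkinEmb_mem S x n]
  exact (abs_coef_le _ _).trans (H1.norm_toL2_le _)

/-- The Galerkin vector field. -/
def galerkinField (a D : ℝ) (S : Finset ℤ) (x : S → ℝ) (n : S) : ℝ :=
  -lam n * (D / 2 * lam n * x n + coef n (ctL2 (nonlin a (H1.toCT (galerkinEmb S x)))))

/-- The Galerkin forcing term. -/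
def galerkinForce (S : Finset ℤ) (g : ℝ → L2) (t : ℝ) (n : S) : ℝ :=
  -lam n * coef n (√2 • prim (g t))

theorem contDiff_galerkinField (a D : ℝ) (S : Finset ℤ) :
    ContDiff ℝ 1 (galerkinField a D S) := by
  rw [contDiff_pi]
  intro n
  have h : ContDiff ℝ 1 fun x : S → ℝ => H1.toCT (galerkinEmb S x) :=
    (H1.toCT.comp (galerkinEmb S)).contDiff
  have h2 : ContDiff ℝ 1 fun x : S → ℝ => nonlin a (H1.toCT (galerkinEmb S x)) :=
    (h.pow 3).sub (h.const_smul a)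
  have h3 : ContDiff ℝ 1 fun x : S → ℝ =>
      coef n (ctL2 (nonlin a (H1.toCT (galerkinEmb S x)))) :=
    ((coef n).comp ctL2).contDiff.comp h2
  exact contDiff_const.mul ((contDiff_const.mul (contDiff_apply ℝ ℝ n)).add h3)

theorem continuous_galerkinForce (S : Finset ℤ) {g : ℝ → L2} (hg : Continuous g) :
    Continuous (galerkinForce S g) := by
  rw [continuous_pi_iff]
  intro n
  unfold galerkinForce
  fun_prop

theorem exists_bound_galerkinForce (S : Finset ℤ) {g : ℝ → L2} {B : ℝ} (hB : ∀ t, ‖g t‖ ≤ B) :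
    ∃ C, ∀ t, ‖galerkinForce S g t‖ ≤ C := by
  have hB0 : 0 ≤ B := (norm_nonneg _).trans (hB 0)
  refine ⟨(∑ n ∈ S, lam n) * (√2 * B), fun t => ?_⟩
  have hs : 0 ≤ ∑ n ∈ S, lam n := Finset.sum_nonneg fun n _ => lam_nonneg n
  rw [pi_norm_le_iff_of_nonneg (by positivity)]
  intro n
  rw [galerkinForce, norm_mul, norm_neg, Real.norm_of_nonneg (lam_nonneg _), Real.norm_eq_abs]
  refine mul_le_mul (Finset.single_le_sum (fun n _ => lam_nonneg n) n.2) ?_ (abs_nonneg _) hs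
  refine (abs_coef_le _ _).trans ?_
  rw [norm_smul, Real.norm_of_nonneg (by positivity)]
  gcongr
  exact (norm_prim_le _).trans (hB t)

/-- The Ginzburg–Landau energy. -/
def glEnergy (a D : ℝ) (φ : H1) : ℝ :=
  quart (H1.toCT φ) / 4 - a / 2 * ‖H1.toL2 φ‖ ^ 2 + D / 4 * ‖H1.dx φ‖ ^ 2

theorem le_glEnergy (a D : ℝ) (φ : H1) :
    min (-a / 2) (D / 4) * ‖φ‖ ^ 2 ≤ glEnergy a D φ := by
  rw [glEnergy, H1.norm_sq, mul_add]
  have h1 := mul_le_mul_of_nonneg_right (min_le_left (-a / 2) (D / 4)) (sq_nonneg ‖H1.toL2 φ‖)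
  have h2 := mul_le_mul_of_nonneg_right (min_le_right (-a / 2) (D / 4)) (sq_nonneg ‖H1.dx φ‖)
  have h3 := quart_nonneg (H1.toCT φ)
  linarith

theorem hasDerivWithinAt_glEnergy (a D : ℝ) {z : ℝ → H1} {z' : H1} {s : Set ℝ} {t : ℝ}
    (hz : HasDerivWithinAt z z' s t) :
    HasDerivWithinAt (fun t => glEnergy a D (z t))
      (⟪ctL2 (nonlin a (H1.toCT (z t))), H1.toL2 z'⟫ + D / 2 * ⟪H1.dx (z t), H1.dx z'⟫) s t := by
  have h1 : HasDerivWithinAt (fun t => H1.toCT (z t)) (H1.toCT z') s t :=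
    H1.toCT.hasFDerivAt.comp_hasDerivWithinAt t hz
  have h2 := h1.mul h1
  have h4 := (coef 0).hasFDerivAt.comp_hasDerivWithinAt t
    (ctL2.hasFDerivAt.comp_hasDerivWithinAt t (h2.mul h2))
  have hq : HasDerivWithinAt (fun t => quart (H1.toCT (z t)))
      (4 * ⟪ctL2 (H1.toCT (z t) ^ 3), ctL2 (H1.toCT z')⟫) s t := by
    -- Written as the zero mode of a product in the algebra of continuous functions, the quartic
    -- energy is differentiated by the product rule and linear maps.
    have e1 : (fun t => quart (H1.toCT (z t))) = fun t => coef 0 (ctL2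
        (((fun t => H1.toCT (z t)) * fun t => H1.toCT (z t)) t *
          ((fun t => H1.toCT (z t)) * fun t => H1.toCT (z t)) t)) := by
      ext t
      rw [quart_eq_coef]
      congr 2
      simp only [Pi.mul_apply]
      ring
    rw [e1]
    refine h4.congr_deriv ?_
    rw [← integral_eq_coef, inner_ctL2_ctL2, ← integral_const_mul]
    refine integral_congr_ae (Eventually.of_forall fun x => ?_)
    simp only [ContinuousMap.add_apply, ContinuousMap.mul_apply, ContinuousMap.pow_apply,
      Pi.mul_apply]
    ring
  have h5 : HasDerivWithinAt (fun t => H1.toL2 (z t)) (H1.toL2 z') s t :=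
    H1.toL2.hasFDerivAt.comp_hasDerivWithinAt t hz
  have h6 : HasDerivWithinAt (fun t => H1.dx (z t)) (H1.dx z') s t :=
    H1.dx.hasFDerivAt.comp_hasDerivWithinAt t hz
  have h7 := ((hq.div_const 4).sub (h5.norm_sq.const_mul (a / 2))).add
    (h6.norm_sq.const_mul (D / 4))
  refine h7.congr_deriv ?_
  rw [nonlin, map_sub, map_smul, inner_sub_left, real_inner_smul_left, ctL2_toCT, ctL2_toCT]
  ring

/-- The weight $\lambda_n$ undoes the primitive: the energy balance needs only the $L^2$ norm of the
control, uniformly in the frequencies. -/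
theorem lam_mul_coef_prim_sq_le (n : ℤ) (f : L2) :
    lam n * coef n (√2 • prim f) ^ 2 ≤ 2 * coef (-n) f ^ 2 := by
  rw [map_smul, coef_prim, smul_eq_mul, mul_pow, Real.sq_sqrt zero_le_two]
  by_cases hn : n = 0
  · subst hn
    rw [lam_zero, zero_mul]
    positivity
  · have : 2 * Real.pi * (n : ℝ) ≠ 0 := by simpa [Real.pi_ne_zero] using hn
    rw [lam]
    field_simp
    rfl

/-- With $\mu_n$ the mode of the chemical potential and $\beta_n$ that of the forcing, the energy
changes at rate $-\sum\lambda_n\mu_n(\mu_n+\beta_n)\le\frac14\sum\lambda_n\beta_n^2$, by completing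
the square. -/
theorem galerkin_dissipation (a D : ℝ) (S : Finset ℤ) (g : ℝ → L2) (x : S → ℝ) (t : ℝ) :
    ⟪ctL2 (nonlin a (H1.toCT (galerkinEmb S x))),
      H1.toL2 (galerkinEmb S (galerkinField a D S x + galerkinForce S g t))⟫ +
      D / 2 * ⟪H1.dx (galerkinEmb S x),
        H1.dx (galerkinEmb S (galerkinField a D S x + galerkinForce S g t))⟫ ≤
      ‖g t‖ ^ 2 / 2 := by
  rw [inner_galerkinEmb, inner_dx_galerkinEmb, Finset.mul_sum, ← Finset.sum_add_distrib]
  have hs : ∑ n : S, coef (-(n : ℤ)) (g t) ^ 2 ≤ ‖g t‖ ^ 2 := by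
    rw [Finset.sum_coe_sort S (fun n => coef (-n) (g t) ^ 2)]
    exact sum_le_hasSum S (fun _ _ => sq_nonneg _)
      ((Equiv.neg ℤ).hasSum_iff.2 (hasSum_coef_sq (g t)))
  have h2 : ∑ n : S, coef (-(n : ℤ)) (g t) ^ 2 / 2 ≤ ‖g t‖ ^ 2 / 2 := by
    rw [← Finset.sum_div]
    linarith
  refine le_trans (Finset.sum_le_sum fun n _ => ?_) h2
  have h3 := lam_mul_coef_prim_sq_le n (g t)
  have hl := lam_nonneg n
  rw [coef_galerkinEmb_mem, Pi.add_apply, galerkinField, galerkinForce]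
  set β := coef n (√2 • prim (g t))
  set c := coef n (ctL2 (nonlin a (H1.toCT (galerkinEmb S x))))
  have h4 : 0 ≤ lam n * (D / 2 * lam n * x n + c + β / 2) ^ 2 := mul_nonneg hl (sq_nonneg _)
  nlinarith

/-- The growth of the Ginzburg–Landau energy is at most $B^2/2$ per unit time, and this energy
controls the $H^1$ norm. The bound rules out blow-up and does not depend on `S` except through the
initial energy. -/
theorem exists_galerkin_ode {a D T B : ℝ} (ha : a < 0) (hD : 0 < D) (hT : 0 ≤ T) (S : Finset ℤ)
    {g : ℝ → L2} (hg : Continuous g) (hB : ∀ t, ‖g t‖ ≤ B) (x₀ : S → ℝ) :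
    ∃ x : ℝ → S → ℝ, x 0 = x₀ ∧ ∀ t ∈ Set.Icc 0 T,
      HasDerivWithinAt x (galerkinField a D S (x t) + galerkinForce S g t) (Set.Icc 0 T) t ∧
      min (-a / 2) (D / 4) * ‖galerkinEmb S (x t)‖ ^ 2 ≤
        glEnergy a D (galerkinEmb S x₀) + B ^ 2 / 2 * T := by
  obtain ⟨C, hC⟩ := exists_bound_galerkinForce S hB
  set m := min (-a / 2) (D / 4) with hm
  have hm0 : 0 < m := lt_min (by linarith) (by linarith)
  set E := glEnergy a D (galerkinEmb S x₀) + B ^ 2 / 2 * T with hE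
  have key : ∀ (x : ℝ → S → ℝ) (τ : ℝ), τ ∈ Set.Icc 0 T → x 0 = x₀ →
      (∀ t ∈ Set.Icc 0 τ, HasDerivWithinAt x (galerkinField a D S (x t) + galerkinForce S g t)
        (Set.Icc 0 τ) t) → ∀ t ∈ Set.Icc 0 τ, m * ‖galerkinEmb S (x t)‖ ^ 2 ≤ E := by
    intro x τ hτ h0 hx t ht
    have hd : ∀ t ∈ Set.Icc 0 τ, HasDerivWithinAt (fun t => glEnergy a D (galerkinEmb S (x t)))
        (⟪ctL2 (nonlin a (H1.toCT (galerkinEmb S (x t)))),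
      H1.toL2 (galerkinEmb S (galerkinField a D S (x t) + galerkinForce S g t))⟫ +
      D / 2 * ⟪H1.dx (galerkinEmb S (x t)),
        H1.dx (galerkinEmb S (galerkinField a D S (x t) + galerkinForce S g t))⟫)
        (Set.Icc 0 τ) t := fun t ht => hasDerivWithinAt_glEnergy a D
          ((galerkinEmb S).hasFDerivAt.comp_hasDerivWithinAt t (hx t ht))
    have hle := image_le_of_deriv_right_le_deriv_boundary
      (fun t ht => (hd t ht).continuousWithinAt)
      (fun t ht => (hd t ⟨ht.1, ht.2.le⟩).mono_of_mem_nhdsWithin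
        (Icc_mem_nhdsGE_of_mem ht))
      (B := fun t => glEnergy a D (galerkinEmb S x₀) + B ^ 2 / 2 * t) (B' := fun _ => B ^ 2 / 2)
      (by simp [h0]) (by fun_prop)
      (fun t _ => by
        have := (((hasDerivAt_id t).const_mul (B ^ 2 / 2)).const_add
          (glEnergy a D (galerkinEmb S x₀))).hasDerivWithinAt (s := Set.Ici t)
        simpa using this)
      (fun t _ => (galerkin_dissipation a D S g (x t) t).trans (by
        have := pow_le_pow_left₀ (norm_nonneg _) (hB t) 2
        linarith)) ht
    refine (le_glEnergy a D _).trans (hle.trans ?_)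
    have : B ^ 2 / 2 * t ≤ B ^ 2 / 2 * T := by
      have := ht.2.trans hτ.2
      gcongr
    linarith
  have hbd : ∀ y : S → ℝ, m * ‖galerkinEmb S y‖ ^ 2 ≤ E → ‖y‖ < √(E / m) + 1 := fun y hy => by
    refine lt_of_le_of_lt ((norm_le_galerkinEmb S y).trans (Real.le_sqrt_of_sq_le ?_))
      (lt_add_one _)
    rw [le_div_iff₀ hm0]
    linarith
  have h0E : m * ‖galerkinEmb S x₀‖ ^ 2 ≤ E := by
    refine (le_glEnergy a D _).trans ?_
    have : 0 ≤ B ^ 2 / 2 * T := by positivity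
    linarith
  obtain ⟨x, h0, hx⟩ := exists_solution_of_bound hT (contDiff_galerkinField a D S)
    (continuous_galerkinForce S hg) hC (hbd _ h0E) (fun x τ hτ h0 hx =>
      hbd _ (key x τ hτ h0 hx τ ⟨hτ.1, le_rfl⟩))
  exact ⟨x, h0, fun t ht => ⟨hx t ht, key x T ⟨hT, le_rfl⟩ h0 hx t ht⟩⟩

/-! ### Truncation error of the nonlinearity. -/

theorem norm_ctL2_mul_le (h f : CT) : ‖ctL2 (h * f)‖ ≤ ‖h‖ * ‖ctL2 f‖ := by
  refine le_of_sq_le_sq ?_ (by positivity)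
  rw [mul_pow, ← real_inner_self_eq_norm_sq (ctL2 _), ← real_inner_self_eq_norm_sq (ctL2 f),
    inner_ctL2_ctL2, inner_ctL2_ctL2, ← integral_const_mul]
  refine integral_mono (integrable_of_continuous (by fun_prop))
    (integrable_of_continuous (by fun_prop)) fun x => ?_
  simp only [ContinuousMap.mul_apply]
  have h1 : h x ^ 2 ≤ ‖h‖ ^ 2 := sq_le_sq' (abs_le.1 (h.norm_coe_le_norm x)).1
    (abs_le.1 (h.norm_coe_le_norm x)).2
  nlinarith [mul_le_mul_of_nonneg_right h1 (sq_nonneg (f x))]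

/-- The chain rule for `V'(p)` with `p` smooth. -/
theorem exists_smooth_nonlin (a : ℝ) (p : SmoothFun) : ∃ q : SmoothFun,
    q.onTorus = nonlin a p.onTorus ∧
      ‖q.dx.toL2‖ ≤ (3 * ‖p.onTorus‖ ^ 2 + |a|) * ‖p.dx.toL2‖ := by
  have hsm := p.smooth
  let q : SmoothFun :=
    { toFun := fun x => p.toFun x ^ 3 - a * p.toFun x
      smooth := (hsm.pow 3).sub (contDiff_const.mul hsm)
      periodic := fun x => by simp only [p.periodic x] }
  have hq : q.onTorus = nonlin a p.onTorus := by
    ext x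
    induction x using QuotientAddGroup.induction_on with
    | H x => rfl
  have hdx : ∀ x, q.dx.toFun x = (3 * p.toFun x ^ 2 - a) * p.dx.toFun x := fun x => by
    have hp : HasDerivAt p.toFun (p.dx.toFun x) x :=
      ((hsm.differentiable (by simp)) x).hasDerivAt
    have h := (hp.pow 3).sub (hp.const_mul a)
    refine (HasDerivAt.deriv (f := q.toFun) h).trans ?_
    simp only [Nat.add_one_sub_one, Nat.cast_ofNat]
    ring
  have hdq : q.dx.onTorus = (3 * p.onTorus ^ 2 - ContinuousMap.const _ a) * p.dx.onTorus := by
    ext x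
    induction x using QuotientAddGroup.induction_on with
    | H x => exact hdx x
  refine ⟨q, hq, ?_⟩
  rw [q.dx.toL2_eq, p.dx.toL2_eq, hdq]
  refine (norm_ctL2_mul_le _ _).trans (mul_le_mul_of_nonneg_right ?_ (norm_nonneg _))
  refine (ContinuousMap.norm_le _ (by positivity)).2 fun x => ?_
  have h1 : |p.onTorus x| ≤ ‖p.onTorus‖ := p.onTorus.norm_coe_le_norm x
  have h2 : p.onTorus x ^ 2 ≤ ‖p.onTorus‖ ^ 2 := sq_le_sq' (abs_le.1 h1).1 (abs_le.1 h1).2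
  have h3 : ((3 * p.onTorus ^ 2 - ContinuousMap.const _ a : CT) x) = 3 * p.onTorus x ^ 2 - a := rfl
  rw [h3, Real.norm_eq_abs]
  refine (abs_sub _ _).trans (add_le_add ?_ le_rfl)
  rw [abs_of_nonneg (by positivity)]
  linarith

theorem exists_smooth_galerkinEmb (S : Finset ℤ) (x : S → ℝ) :
    ∃ p : SmoothFun, p.toH1 = galerkinEmb S x := by
  let p : SmoothFun :=
    { toFun := fun y => ∑ n : S, x n * (cas n).toFun y
      smooth := ContDiff.sum fun n _ => contDiff_const.mul (cas n).smooth
      periodic := fun y => by simp only [(cas _).periodic y] }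
  have hp : p.onTorus = ∑ n : S, x n • (cas n).onTorus := by
    ext y
    induction y using QuotientAddGroup.induction_on with
    | H y =>
      rw [ContinuousMap.sum_apply]
      rfl
  refine ⟨p, H1.ext_toL2 ?_⟩
  rw [p.toH1_toL2, p.toL2_eq, hp, galerkinEmb_apply, map_sum, map_sum]
  refine Finset.sum_congr rfl fun n _ => ?_
  rw [map_smul, map_smul, casH1_toL2, e, (cas n).toL2_eq]

/-- One derivative of $V'(p)$ is bounded through the chain rule and $H^1\subset C$, and one
derivative gains a factor $1/N$. -/
theorem norm_nonlin_sub_trunc_le (a : ℝ) (S : Finset ℤ) (x : S → ℝ) (N : ℕ) :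
    N * ‖ctL2 (nonlin a (H1.toCT (galerkinEmb S x))) -
      trunc N (ctL2 (nonlin a (H1.toCT (galerkinEmb S x))))‖ ≤
    (3 * (‖H1.toCT‖ * ‖galerkinEmb S x‖) ^ 2 + |a|) * ‖galerkinEmb S x‖ := by
  obtain ⟨p, hp⟩ := exists_smooth_galerkinEmb S x
  obtain ⟨q, hq, hqd⟩ := exists_smooth_nonlin a p
  rw [← hp, p.toCT_toH1, ← hq, ← q.toL2_eq]
  refine (norm_toL2_sub_trunc_le N q.toH1).trans (hqd.trans ?_)
  refine mul_le_mul ?_ (H1.norm_dx_le p.toH1) (norm_nonneg _) (by positivity)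
  have : ‖p.onTorus‖ ≤ ‖H1.toCT‖ * ‖p.toH1‖ := by
    rw [← p.toCT_toH1]
    exact H1.toCT.le_opNorm _
  gcongr

theorem continuous_toHm1 : Continuous toHm1 := by
  refine (LipschitzWith.of_dist_le_mul (f := toHm1) (K := 1) fun f g => ?_).continuous
  refine (dist_eq_norm (toHm1 f) (toHm1 g)).trans_le ?_
  rw [← toHm1_sub, NNReal.coe_one, one_mul, dist_eq_norm]
  exact norm_toHm1_le _

/-- A continuous `H¹`-valued path, as an element of the solution space. -/
theorem exists_solutionSpace_of_continuous (T : ℝ) {z : ℝ → H1} (hz : Continuous z) :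
    ∃ u : SolutionSpace T, (∀ t : Set.Icc 0 T, u.path t = toHm1 (H1.toL2 (z t))) ∧
      u.val =ᵐ[timeMeasure T] z := by
  obtain ⟨C, hC⟩ := isCompact_Icc.exists_bound_of_continuousOn (s := Set.Icc 0 T) hz.continuousOn
  have hm : MemLp z 2 (timeMeasure T) := by
    refine MemLp.of_bound hz.aestronglyMeasurable C ?_
    filter_upwards [ae_restrict_mem measurableSet_Icc] with t ht
    exact hC t ht
  refine ⟨{ path := ⟨fun t => toHm1 (H1.toL2 (z t)), ?_⟩, val := hm.toLp, compat := ?_,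
            memL4 := ?_ }, fun t => rfl, hm.coeFn_toLp⟩
  · exact continuous_toHm1.comp (H1.toL2.continuous.comp (hz.comp continuous_subtype_val))
  · filter_upwards [hm.coeFn_toLp] with t ht _
    rw [ht]
    rfl
  · have h1 : ∫⁻ t, (∫⁻ x, ‖H1.toL2 ((hm.toLp : Lp H1 2 (timeMeasure T)) t) x‖ₑ ^ 4) ∂timeMeasure T =
        ∫⁻ t, ENNReal.ofReal (quart (H1.toCT (z t))) ∂timeMeasure T := by
      refine lintegral_congr_ae ?_
      filter_upwards [hm.coeFn_toLp] with t ht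
      rw [ht, SolutionSpace.lintegral_toL2]
    rw [h1]
    have hc : Continuous fun t => quart (H1.toCT (z t)) :=
      continuous_quart.comp (H1.toCT.continuous.comp hz)
    have hi : Integrable (fun t => quart (H1.toCT (z t))) (timeMeasure T) :=
      hc.continuousOn.integrableOn_Icc
    exact (hasFiniteIntegral_iff_ofReal (Eventually.of_forall fun s => quart_nonneg _)).1 hi.2

theorem inner_trunc (N : ℕ) (f g : L2) :
    ⟪trunc N f, g⟫ = ∑ n ∈ Finset.Icc (-(N : ℤ)) N, coef n f * coef n g := by
  rw [trunc_apply, sum_inner]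
  exact Finset.sum_congr rfl fun n _ => by rw [real_inner_smul_left, coef_apply n g]

/-- Only the nonlinear and forcing terms carry the truncation; the linear term already has its
frequencies in the Galerkin space. -/
theorem galerkin_weak_form (a D : ℝ) (N : ℕ) (g : ℝ → L2)
    (x : Finset.Icc (-(N : ℤ)) N → ℝ) (t : ℝ) (ψ : SmoothFun) :
    ⟪ψ.toL2, H1.toL2 (galerkinEmb _ (galerkinField a D _ x + galerkinForce _ g t))⟫ =
      D / 2 * ⟪H1.dx (galerkinEmb _ x), ψ.dx.dx.dx.toL2⟫ +
      ⟪trunc N (ctL2 (nonlin a (H1.toCT (galerkinEmb _ x))) + √2 • prim (g t)),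
        ψ.dx.dx.toL2⟫ := by
  rw [inner_galerkinEmb, inner_trunc, H1.inner_dx, ← real_inner_comm, inner_galerkinEmb,
    ← Finset.sum_coe_sort (Finset.Icc (-(N : ℤ)) N), ← Finset.sum_neg_distrib, Finset.mul_sum, ← Finset.sum_add_distrib]
  refine Finset.sum_congr rfl fun n _ => ?_
  rw [coef_dx_dx_toL2, coef_dx_dx_toL2, Pi.add_apply, galerkinField,
    galerkinForce, map_add]
  ring

/-- A Galerkin path solves the full equation exactly once the truncation error is counted in $\rho$.
The uniform $H^1$ bound $M$ makes this error at most $C/N$ at every time. -/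
theorem exists_galerkin {a D T B ε : ℝ} (ha : a < 0) (hD : 0 < D) (hT : 0 ≤ T) (hε : 0 < ε)
    {g : ℝ → L2} (hg : Continuous g) (hB : ∀ t, ‖g t‖ ≤ B) {φ : H1} {n₀ : ℕ}
    (hφ : ∀ n ∉ Finset.Icc (-(n₀ : ℤ)) n₀, coef n (H1.toL2 φ) = 0) :
    ∃ (u : SolutionSpace T) (ρ : ℝ → L2), MemLp ρ 2 (timeMeasure T) ∧
      IsPerturbedSolution a D (toHm1 (H1.toL2 φ)) ρ u ∧ ∀ s, ‖ρ s - √2 • prim (g s)‖ ≤ ε := by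
  have hB0 : 0 ≤ B := (norm_nonneg _).trans (hB 0)
  set m := min (-a / 2) (D / 4) with hm
  have hm0 : 0 < m := lt_min (by linarith) (by linarith)
  set M := √((glEnergy a D φ + B ^ 2 / 2 * T) / m) with hM
  have hM0 : 0 ≤ M := Real.sqrt_nonneg _
  set C := (3 * (‖H1.toCT‖ * M) ^ 2 + |a|) * M + √2 * B with hC
  have hC0 : 0 ≤ C := by positivity
  obtain ⟨N₁, hN₁⟩ := exists_nat_ge (C / ε)
  set N := max n₀ (N₁ + 1) with hN
  have hNpos : (0 : ℝ) < N := by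
    have : 0 < N := by lia
    exact_mod_cast this
  have hNC : C ≤ N * ε := by
    rw [← div_le_iff₀ hε]
    refine hN₁.trans ?_
    have : N₁ ≤ N := by lia
    exact_mod_cast this
  have hφN : ∀ n ∉ Finset.Icc (-(N : ℤ)) N, coef n (H1.toL2 φ) = 0 := fun n hn => hφ n fun h => by
    rw [Finset.mem_Icc] at h hn
    have : n₀ ≤ N := le_max_left _ _
    lia
  obtain ⟨x, hx0, hx⟩ := exists_galerkin_ode ha hD hT (Finset.Icc (-(N : ℤ)) N) hg hB
    (fun n => coef n (H1.toL2 φ))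
  rw [galerkinEmb_coef hφN] at hx
  have hxc : ContinuousOn x (Set.Icc 0 T) := fun t ht => (hx t ht).1.continuousWithinAt
  -- The path is extended by constants outside $[0,T]$ to be continuous on the whole line.
  set y : ℝ → _ := fun t => x (Set.projIcc 0 T hT t) with hy
  have hyc : Continuous y :=
    hxc.comp_continuous (continuous_subtype_val.comp continuous_projIcc) fun t => Subtype.coe_prop _
  have hyx : ∀ t ∈ Set.Icc 0 T, y t = x t := fun t ht => by
    simp only [hy, Set.projIcc_of_mem hT ht]
  set z : ℝ → H1 := fun t => galerkinEmb _ (y t) with hz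
  have hzc : Continuous z := (galerkinEmb _).continuous.comp hyc
  have hzM : ∀ t, ‖z t‖ ≤ M := fun t => by
    refine Real.le_sqrt_of_sq_le ?_
    rw [le_div_iff₀ hm0, mul_comm]
    exact (hx _ (Subtype.coe_prop _)).2
  obtain ⟨u, hup, huv⟩ := exists_solutionSpace_of_continuous T hzc
  set nl : ℝ → L2 := fun t => ctL2 (nonlin a (H1.toCT (z t))) with hnl
  have hnlc : Continuous nl :=
    ctL2.continuous.comp ((continuous_nonlin a).comp (H1.toCT.continuous.comp hzc))
  -- Chosen so that $V'(z)+\rho$ is the truncation of $V'(z)+\sqrt2\,$`prim g`.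
  set ρ : ℝ → L2 := fun t => trunc N (nl t + √2 • prim (g t)) - nl t with hρ
  have hρc : Continuous ρ := by fun_prop
  have hρε : ∀ s, ‖ρ s - √2 • prim (g s)‖ ≤ ε := fun s => by
    have e1 : ρ s - √2 • prim (g s) =
        -((nl s - trunc N (nl s)) + √2 • (prim (g s) - trunc N (prim (g s)))) := by
      simp only [hρ, map_add, map_smul]
      module
    have h1 := norm_nonlin_sub_trunc_le a _ (y s) N
    have h2 := norm_prim_sub_trunc_le N (g s)
    have h3 : N * ‖nl s - trunc N (nl s)‖ ≤ (3 * (‖H1.toCT‖ * M) ^ 2 + |a|) * M := by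
      refine h1.trans ?_
      have := hzM s
      simp only [hz] at this
      gcongr
    have h4 : N * ‖√2 • (prim (g s) - trunc N (prim (g s)))‖ ≤ √2 * B := by
      rw [norm_smul, Real.norm_of_nonneg (Real.sqrt_nonneg _), mul_left_comm]
      exact mul_le_mul_of_nonneg_left (h2.trans (hB s)) (Real.sqrt_nonneg _)
    rw [e1, norm_neg]
    refine (norm_add_le _ _).trans ?_
    refine le_of_mul_le_mul_left ?_ hNpos
    rw [mul_add]
    linarith
  refine ⟨u, ρ, ?_, ?_, hρε⟩
  · refine MemLp.of_bound hρc.aestronglyMeasurable (ε + √2 * B) (Eventually.of_forall fun s => ?_)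
    have h1 : ‖√2 • prim (g s)‖ ≤ √2 * B := by
      rw [norm_smul, Real.norm_of_nonneg (Real.sqrt_nonneg _)]
      exact mul_le_mul_of_nonneg_left ((norm_prim_le _).trans (hB s)) (Real.sqrt_nonneg _)
    have h2 := norm_le_norm_sub_add (ρ s) (√2 • prim (g s))
    linarith [hρε s]
  · intro ψ t
    have hint : ∀ᵐ s, s ∈ Set.uIoc 0 (t : ℝ) →
        D / 2 * ⟪H1.dx (u.val s), ψ.dx.dx.dx.toL2⟫ +
        ⟪ctL2 (nonlin a (u.ct s)) + ρ s, ψ.dx.dx.toL2⟫ =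
        ⟪ψ.toL2, H1.toL2 (galerkinEmb _ (galerkinField a D _ (y s) + galerkinForce _ g s))⟫ := by
      refine ae_uIoc_of_ae (p := fun s => D / 2 * ⟪H1.dx (u.val s), ψ.dx.dx.dx.toL2⟫ +
        ⟪ctL2 (nonlin a (u.ct s)) + ρ s, ψ.dx.dx.toL2⟫ =
        ⟪ψ.toL2, H1.toL2 (galerkinEmb _ (galerkinField a D _ (y s) + galerkinForce _ g s))⟫) ?_ t.2
      filter_upwards [huv] with s hs
      rw [galerkin_weak_form, SolutionSpace.ct, hs]
      simp only [hρ, hnl, hz, add_sub_cancel]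
    rw [intervalIntegral.integral_congr_ae hint]
    let L : (Finset.Icc (-(N : ℤ)) N → ℝ) →L[ℝ] ℝ :=
      (innerSL ℝ ψ.toL2).comp (H1.toL2.comp (galerkinEmb _))
    have hLd : ∀ s ∈ Set.Icc 0 T, HasDerivWithinAt (fun s => L (y s))
        (L (galerkinField a D _ (y s) + galerkinForce _ g s)) (Set.Icc 0 T) s := fun s hs => by
      have h1 := L.hasFDerivAt.comp_hasDerivWithinAt s (hx s hs).1
      rw [hyx s hs]
      exact h1.congr (fun r hr => by simp only [hyx r hr, Function.comp_apply])
        (by simp only [hyx s hs, Function.comp_apply])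
    have hLc : Continuous fun s => L (galerkinField a D _ (y s) + galerkinForce _ g s) :=
      L.continuous.comp (((contDiff_galerkinField a D _).continuous.comp hyc).add
        (continuous_galerkinForce _ hg))
    have hftc := intervalIntegral.integral_eq_sub_of_hasDeriv_right_of_le t.2.1
      (f := fun s => L (y s)) (L.continuous.comp hyc).continuousOn
      (fun s hs => (hLd s ⟨hs.1.le, hs.2.le.trans t.2.2⟩).mono_of_mem_nhdsWithin
        (Icc_mem_nhdsGT_of_mem ⟨hs.1.le, hs.2.trans_le t.2.2⟩))
      (hLc.intervalIntegrable 0 t)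
    have h0 : galerkinEmb _ (y 0) = φ := by
      rw [hyx 0 ⟨le_rfl, hT⟩, hx0, galerkinEmb_coef hφN]
    have e2 : ∫ s in (0 : ℝ)..t, ⟪ψ.toL2, H1.toL2 (galerkinEmb _
        (galerkinField a D _ (y s) + galerkinForce _ g s))⟫ = L (y t) - L (y 0) := hftc
    rw [e2, hup t, toHm1_apply, toHm1_apply, real_inner_comm, real_inner_comm (H1.toL2 ψ.toH1)]
    have e3 : L (y 0) = ⟪ψ.toL2, H1.toL2 φ⟫ := by rw [← h0]; rfl
    rw [e3, ψ.toH1_toL2]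
    simp only [add_sub_cancel]
    rfl

/-! ### Passage to the limit -/

theorem Lp_norm_sq_eq {α E : Type*} [MeasurableSpace α] {μ : Measure α} [NormedAddCommGroup E]
    (f : Lp E 2 μ) : ‖f‖ ^ 2 = ∫ x, ‖f x‖ ^ 2 ∂μ := by
  have h := (Lp.memLp f).eLpNorm_eq_integral_rpow_norm two_ne_zero ENNReal.ofNat_ne_top
  have h0 : 0 ≤ ∫ x, ‖f x‖ ^ 2 ∂μ := integral_nonneg fun _ => sq_nonneg _
  rw [Lp.norm_def, h]
  simp only [ENNReal.toReal_ofNat, Real.rpow_ofNat]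
  rw [ENNReal.toReal_ofReal (by positivity), ← Real.rpow_natCast, ← Real.rpow_mul h0]
  norm_num

theorem abs_intervalIntegral_le {T : ℝ} {f b : ℝ → ℝ} (hb : Integrable b (timeMeasure T))
    (h : ∀ s, |f s| ≤ b s) {t : ℝ} (ht : t ∈ Set.Icc 0 T) :
    |∫ s in (0 : ℝ)..t, f s| ≤ ∫ s, b s ∂timeMeasure T := by
  have hsub : Set.Ioc 0 t ⊆ Set.Icc 0 T := fun s hs => ⟨hs.1.le, hs.2.trans ht.2⟩
  have hb0 : ∀ s, 0 ≤ b s := fun s => (abs_nonneg _).trans (h s)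
  rw [intervalIntegral.integral_of_le ht.1, ← Real.norm_eq_abs]
  refine (norm_integral_le_of_norm_le (IntegrableOn.mono_set (t := Set.Icc 0 T) hb hsub)
    (Eventually.of_forall h)).trans ?_
  exact setIntegral_mono_set hb (Eventually.of_forall hb0) hsub.eventuallyLE

theorem cauchySeq_of_norm_sq_le {E : Type*} [NormedAddCommGroup E] {x : ℕ → E} {b : ℕ → ℝ} {c : ℝ}
    (hb : Tendsto b atTop (𝓝 0)) (h : ∀ n m, ‖x n - x m‖ ^ 2 ≤ c * (b n + b m)) : CauchySeq x := by
  rw [cauchySeq_iff_tendsto_dist_atTop_0]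
  have h1 : Tendsto (fun p : ℕ × ℕ => √(c * (b p.1 + b p.2))) atTop (𝓝 0) := by
    have h2 : Tendsto (fun p : ℕ × ℕ => b p.1 + b p.2) atTop (𝓝 (0 + 0)) := by
      rw [← prod_atTop_atTop_eq]
      exact (hb.comp tendsto_fst).add (hb.comp tendsto_snd)
    simpa using (h2.const_mul c).sqrt
  refine squeeze_zero (fun _ => dist_nonneg) (fun p => ?_) h1
  rw [dist_eq_norm]
  exact Real.le_sqrt_of_sq_le (h _ _)

/-- The choice $\delta_n=\sqrt{r_n}+1/(n+1)$ gives $\delta_n^{-1}r_n\le\sqrt{r_n}$ and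
$\delta_n\to0$; the second summand keeps $\delta_n$ positive when $r_n=0$. -/
theorem tendsto_zero_of_forall_le {x r : ℕ → ℝ} {K C : ℝ} (hx : ∀ n, 0 ≤ x n)
    (hr0 : ∀ n, 0 ≤ r n) (hr : Tendsto r atTop (𝓝 0)) (hK : 0 ≤ K)
    (h : ∀ δ > 0, ∀ n, x n ≤ K * (δ⁻¹ * r n + δ * C)) : Tendsto x atTop (𝓝 0) := by
  have hs : Tendsto (fun n => √(r n)) atTop (𝓝 0) := by simpa using hr.sqrt
  have hd := hs.add (tendsto_one_div_add_atTop_nhds_zero_nat (𝕜 := ℝ))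
  have ht : Tendsto (fun n : ℕ => K * (√(r n) + (√(r n) + 1 / ((n : ℝ) + 1)) * C)) atTop (𝓝 0) := by
    simpa using (hs.add (hd.mul_const C)).const_mul K
  refine squeeze_zero hx (fun n => ?_) ht
  have hδ : 0 < √(r n) + 1 / ((n : ℝ) + 1) := by positivity
  refine (h _ hδ n).trans (mul_le_mul_of_nonneg_left (add_le_add ?_ le_rfl) hK)
  rw [inv_mul_le_iff₀ hδ]
  have h1 := Real.mul_self_sqrt (hr0 n)
  have h2 : 0 ≤ 1 / ((n : ℝ) + 1) * √(r n) := by positivity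
  nlinarith

theorem le_young {x δ : ℝ} (hδ : 0 < δ) : x ≤ δ⁻¹ * x ^ 2 + δ := by
  have : 0 ≤ δ⁻¹ * (x - δ / 2) ^ 2 := by positivity
  have e : δ⁻¹ * (x - δ / 2) ^ 2 = δ⁻¹ * x ^ 2 - x + δ / 4 := by
    field_simp
    ring
  linarith

/-- The integrand in the weak formulation. -/
def weakForm (a D : ℝ) {T : ℝ} (u : SolutionSpace T) (ρ : ℝ → L2) (ψ : SmoothFun) (s : ℝ) : ℝ :=
  D / 2 * ⟪H1.dx (u.val s), ψ.dx.dx.dx.toL2⟫ + ⟪ctL2 (nonlin a (u.ct s)) + ρ s, ψ.dx.dx.toL2⟫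

theorem integrable_norm_sub_sq {T : ℝ} (u v : SolutionSpace T) :
    Integrable (fun s => ‖u.val s - v.val s‖ ^ 2) (timeMeasure T) :=
  integrable_norm_sq (u.memLp_val.sub v.memLp_val)

theorem norm_val_sub_sq {T : ℝ} (u v : SolutionSpace T) :
    ‖u.val - v.val‖ ^ 2 = ∫ s, ‖u.val s - v.val s‖ ^ 2 ∂timeMeasure T := by
  rw [Lp_norm_sq_eq]
  refine integral_congr_ae ?_
  filter_upwards [Lp.coeFn_sub u.val v.val] with s hs
  rw [hs, Pi.sub_apply]

/-- The weak formulation depends continuously on the solution. -/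
theorem exists_weakForm_bound (a D T : ℝ) (ψ : SmoothFun) : ∃ K, 0 ≤ K ∧
    ∀ (u v : SolutionSpace T) (ρ σ : ℝ → L2), MemLp ρ 2 (timeMeasure T) →
      MemLp σ 2 (timeMeasure T) → ∀ δ > 0, ∀ t ∈ Set.Icc 0 T,
      |∫ s in (0 : ℝ)..t, (weakForm a D u ρ ψ s - weakForm a D v σ ψ s)| ≤
        K * (δ⁻¹ * (‖u.val - v.val‖ ^ 2 + ∫ s, ‖ρ s - σ s‖ ^ 2 ∂timeMeasure T) +
          δ * ∫ s, (1 + quart (u.ct s) + quart (v.ct s)) ∂timeMeasure T) := by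
  set K := |D| * ‖ψ.dx.dx.dx.toL2‖ + ‖ψ.dx.dx.onTorus‖ * (8 * (1 + |a|)) + ‖ψ.dx.dx.toL2‖ with hK
  refine ⟨K, by positivity, fun u v ρ σ hρ hσ δ hδ t ht => ?_⟩
  have i1 := integrable_norm_sub_sq u v
  have i2 : Integrable (fun s => ‖ρ s - σ s‖ ^ 2) (timeMeasure T) := integrable_norm_sq (hρ.sub hσ)
  have i3 : Integrable (fun s => 1 + quart (u.ct s) + quart (v.ct s)) (timeMeasure T) := by
    simpa using integrable_quart_bound u v 1
  have i4 : Integrable (fun s => δ⁻¹ * (‖u.val s - v.val s‖ ^ 2 + ‖ρ s - σ s‖ ^ 2))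
    (timeMeasure T) := (i1.add i2).const_mul _
  have i5 := i3.const_mul δ
  rw [norm_val_sub_sq, ← integral_add i1 i2, ← integral_const_mul, ← integral_const_mul,
    ← integral_add i4 i5, ← integral_const_mul]
  refine abs_intervalIntegral_le ((i4.add i5).const_mul _)
    (fun s => ?_) ht
  have e : weakForm a D u ρ ψ s - weakForm a D v σ ψ s =
      D / 2 * ⟪H1.dx (u.val s - v.val s), ψ.dx.dx.dx.toL2⟫ +
      ⟪ctL2 (nonlin a (u.ct s) - nonlin a (v.ct s)), ctL2 ψ.dx.dx.onTorus⟫ +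
      ⟪ρ s - σ s, ψ.dx.dx.toL2⟫ := by
    rw [weakForm, weakForm, ψ.dx.dx.toL2_eq]
    simp only [map_sub, inner_add_left, inner_sub_left]
    ring
  have hq1 := quart_nonneg (u.ct s)
  have hq2 := quart_nonneg (v.ct s)
  set Q := 1 + quart (u.ct s) + quart (v.ct s) with hQ
  have hQ1 : 1 ≤ Q := by linarith
  set n1 := ‖u.val s - v.val s‖ with hn1
  set n2 := ‖ρ s - σ s‖ with hn2
  -- A common majorant of the three terms. Since $Q\ge1$, the quantity $\delta Q$ also absorbs the
  -- $\delta$ left by Young's inequality in the two linear terms.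
  set Y := δ⁻¹ * (n1 ^ 2 + n2 ^ 2) + δ * Q with hY
  have hδi : 0 < δ⁻¹ := inv_pos.2 hδ
  have hδQ : δ ≤ δ * Q := by nlinarith
  have hb1 : n1 ≤ Y := by
    have := le_young (x := n1) hδ
    have h2 : 0 ≤ δ⁻¹ * n2 ^ 2 := by positivity
    rw [hY, mul_add]
    linarith
  have hb2 : n2 ≤ Y := by
    have := le_young (x := n2) hδ
    have h2 : 0 ≤ δ⁻¹ * n1 ^ 2 := by positivity
    rw [hY, mul_add]
    linarith
  have hY0 : 0 ≤ Y := (norm_nonneg _).trans hb1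
  have t1 : |D / 2 * ⟪H1.dx (u.val s - v.val s), ψ.dx.dx.dx.toL2⟫| ≤
      |D| * ‖ψ.dx.dx.dx.toL2‖ * Y := by
    rw [abs_mul, abs_div, abs_two]
    have h1 := (abs_real_inner_le_norm (H1.dx (u.val s - v.val s)) ψ.dx.dx.dx.toL2).trans
      (mul_le_mul_of_nonneg_right ((H1.norm_dx_le _).trans hb1) (norm_nonneg _))
    have h2 := mul_le_mul_of_nonneg_left h1 (abs_nonneg D)
    have h3 : 0 ≤ |D| * |⟪H1.dx (u.val s - v.val s), ψ.dx.dx.dx.toL2⟫| := by positivity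
    linarith
  have t2 : |⟪ctL2 (nonlin a (u.ct s) - nonlin a (v.ct s)), ctL2 ψ.dx.dx.onTorus⟫| ≤
      ‖ψ.dx.dx.onTorus‖ * (8 * (1 + |a|)) * Y := by
    refine (abs_inner_nonlin_sub_le a δ hδ _ _ _).trans ?_
    refine mul_le_mul_of_nonneg_left ?_ (by positivity)
    rw [ctL2_ct_sub]
    refine add_le_add ?_ le_rfl
    have h1 := H1.norm_toL2_le (u.val s - v.val s)
    have h2 := pow_le_pow_left₀ (norm_nonneg _) h1 2
    refine mul_le_mul_of_nonneg_left ?_ hδi.le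
    have := sq_nonneg n2
    linarith
  have t3 : |⟪ρ s - σ s, ψ.dx.dx.toL2⟫| ≤ ‖ψ.dx.dx.toL2‖ * Y := by
    rw [mul_comm]
    exact (abs_real_inner_le_norm _ _).trans (mul_le_mul_of_nonneg_right hb2 (norm_nonneg _))
  change |weakForm a D u ρ ψ s - weakForm a D v σ ψ s| ≤ K * Y
  rw [e]
  refine (abs_add_le _ _).trans ((add_le_add ((abs_add_le _ _).trans (add_le_add t1 t2)) t3).trans ?_)
  rw [hK, add_mul, add_mul]

/-! ### Consequences of the stability estimate and uniqueness -/

theorem intervalIntegral_eq_timeMeasure {T : ℝ} (hT : 0 ≤ T) (f : ℝ → ℝ) :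
    ∫ s in (0 : ℝ)..T, f s = ∫ s, f s ∂timeMeasure T := by
  rw [intervalIntegral.integral_of_le hT, integral_Icc_eq_integral_Ioc]

theorem intervalIntegral_le_timeMeasure {T : ℝ} {f : ℝ → ℝ} (hf : Integrable f (timeMeasure T))
    (h0 : ∀ s, 0 ≤ f s) {t : ℝ} (ht : t ∈ Set.Icc 0 T) :
    ∫ s in (0 : ℝ)..t, f s ≤ ∫ s, f s ∂timeMeasure T :=
  (le_abs_self _).trans
    (abs_intervalIntegral_le hf (fun s => (abs_of_nonneg (h0 s)).le) ht)

section Stability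

variable {T a D : ℝ} {u v : SolutionSpace T} {Φ Ψ : Hm1} {ρ σ : ℝ → L2}

theorem homEnergy_path_sub_le (hD : 0 < D) (ha : a < 0) (hρ : MemLp ρ 2 (timeMeasure T))
    (hσ : MemLp σ 2 (timeMeasure T)) (hu : IsPerturbedSolution a D Φ ρ u)
    (hv : IsPerturbedSolution a D Ψ σ v) (h0 : (Φ - Ψ) (casH1 0) = 0) (t : Set.Icc 0 T) :
    homEnergy (u.path t - v.path t) ≤
      homEnergy (Φ - Ψ) + D⁻¹ * ∫ s, ‖ρ s - σ s‖ ^ 2 ∂timeMeasure T := by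
  have h := energy_estimate hD ha hρ hσ hu hv h0 t
  have h1 : 0 ≤ ∫ s in (0 : ℝ)..t,
      (D / 4 * ‖H1.dx (u.val s - v.val s)‖ ^ 2 + 1 / 4 * quart (u.ct s - v.ct s)) :=
    intervalIntegral.integral_nonneg t.2.1 fun s _ => by
      have := quart_nonneg (u.ct s - v.ct s)
      positivity
  have h2 := mul_le_mul_of_nonneg_left (intervalIntegral_le_timeMeasure
    (integrable_norm_sq (hρ.sub hσ)) (fun s => sq_nonneg _) t.2) (inv_pos.2 hD).le
  simp only [Pi.sub_apply] at h2
  linarith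

theorem norm_path_sub_sq_le (hD : 0 < D) (ha : a < 0) (hρ : MemLp ρ 2 (timeMeasure T))
    (hσ : MemLp σ 2 (timeMeasure T)) (hu : IsPerturbedSolution a D Φ ρ u)
    (hv : IsPerturbedSolution a D Ψ σ v) (h0 : (Φ - Ψ) (casH1 0) = 0) (t : Set.Icc 0 T) :
    ‖u.path t - v.path t‖ ^ 2 ≤
      2 * (homEnergy (Φ - Ψ) + D⁻¹ * ∫ s, ‖ρ s - σ s‖ ^ 2 ∂timeMeasure T) := by
  have h1 := norm_sq_le_homEnergy _ (path_sub_casH1_zero hρ hσ hu hv h0 t)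
  have h2 := homEnergy_path_sub_le hD ha hρ hσ hu hv h0 t
  linarith

theorem integral_energy_le (hT : 0 ≤ T) (hD : 0 < D) (ha : a < 0) (hρ : MemLp ρ 2 (timeMeasure T))
    (hσ : MemLp σ 2 (timeMeasure T)) (hu : IsPerturbedSolution a D Φ ρ u)
    (hv : IsPerturbedSolution a D Ψ σ v) (h0 : (Φ - Ψ) (casH1 0) = 0) :
    D / 4 * (∫ s, ‖H1.dx (u.val s - v.val s)‖ ^ 2 ∂timeMeasure T) +
      1 / 4 * (∫ s, quart (u.ct s - v.ct s) ∂timeMeasure T) ≤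
      homEnergy (Φ - Ψ) + D⁻¹ * ∫ s, ‖ρ s - σ s‖ ^ 2 ∂timeMeasure T := by
  have h := energy_estimate hD ha hρ hσ hu hv h0 ⟨T, hT, le_rfl⟩
  simp only at h
  rw [intervalIntegral_eq_timeMeasure hT, intervalIntegral_eq_timeMeasure hT, integral_add
    ((integrable_norm_sq (memLp_dx_sub u v)).const_mul (D / 4))
    ((integrable_quart_sub u v).const_mul (1 / 4)), integral_const_mul, integral_const_mul] at h
  have := homEnergy_nonneg (u.path ⟨T, hT, le_rfl⟩ - v.path ⟨T, hT, le_rfl⟩)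
  linarith

theorem integral_dx_le (hT : 0 ≤ T) (hD : 0 < D) (ha : a < 0) (hρ : MemLp ρ 2 (timeMeasure T))
    (hσ : MemLp σ 2 (timeMeasure T)) (hu : IsPerturbedSolution a D Φ ρ u)
    (hv : IsPerturbedSolution a D Ψ σ v) (h0 : (Φ - Ψ) (casH1 0) = 0) :
    ∫ s, ‖H1.dx (u.val s - v.val s)‖ ^ 2 ∂timeMeasure T ≤
      4 / D * (homEnergy (Φ - Ψ) + D⁻¹ * ∫ s, ‖ρ s - σ s‖ ^ 2 ∂timeMeasure T) := by
  have h := integral_energy_le hT hD ha hρ hσ hu hv h0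
  have h1 : 0 ≤ ∫ s, quart (u.ct s - v.ct s) ∂timeMeasure T :=
    integral_nonneg fun _ => quart_nonneg _
  rw [div_mul_eq_mul_div, le_div_iff₀ hD]
  linarith

theorem integral_quart_le (hT : 0 ≤ T) (hD : 0 < D) (ha : a < 0) (hρ : MemLp ρ 2 (timeMeasure T))
    (hσ : MemLp σ 2 (timeMeasure T)) (hu : IsPerturbedSolution a D Φ ρ u)
    (hv : IsPerturbedSolution a D Ψ σ v) (h0 : (Φ - Ψ) (casH1 0) = 0) :
    ∫ s, quart (u.ct s - v.ct s) ∂timeMeasure T ≤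
      4 * (homEnergy (Φ - Ψ) + D⁻¹ * ∫ s, ‖ρ s - σ s‖ ^ 2 ∂timeMeasure T) := by
  have h := integral_energy_le hT hD ha hρ hσ hu hv h0
  have h1 : 0 ≤ D / 4 * ∫ s, ‖H1.dx (u.val s - v.val s)‖ ^ 2 ∂timeMeasure T :=
    mul_nonneg (by linarith) (integral_nonneg fun _ => sq_nonneg _)
  linarith

/-- Equal means make Poincaré's inequality available at almost every time, so $\partial_x$ of the
difference controls its full $H^1$ norm. -/
theorem norm_val_sub_sq_le_dx (hρ : MemLp ρ 2 (timeMeasure T))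
    (hσ : MemLp σ 2 (timeMeasure T)) (hu : IsPerturbedSolution a D Φ ρ u)
    (hv : IsPerturbedSolution a D Ψ σ v) (h0 : (Φ - Ψ) (casH1 0) = 0) :
    ‖u.val - v.val‖ ^ 2 ≤ 2 * ∫ s, ‖H1.dx (u.val s - v.val s)‖ ^ 2 ∂timeMeasure T := by
  rw [norm_val_sub_sq, ← integral_const_mul]
  refine integral_mono_ae (integrable_norm_sub_sq u v)
    ((integrable_norm_sq (memLp_dx_sub u v)).const_mul 2) ?_
  filter_upwards [ae_coef_zero hρ hσ hu hv h0] with s hs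
  have h1 := pow_le_pow_left₀ (norm_nonneg _) (norm_toL2_le_norm_dx _ hs) 2
  rw [H1.norm_sq]
  linarith

theorem IsPerturbedSolution.unique (hT : 0 ≤ T) (hD : 0 < D) (ha : a < 0)
    (hρ : MemLp ρ 2 (timeMeasure T)) (hu : IsPerturbedSolution a D Φ ρ u)
    (hv : IsPerturbedSolution a D Φ ρ v) : u = v := by
  have h0 : (Φ - Φ) (casH1 0) = 0 := by simp
  have h1 := norm_path_sub_sq_le hD ha hρ hρ hu hv h0
  have h2 := norm_val_sub_sq_le_dx hρ hρ hu hv h0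
  have h3 := integral_dx_le hT hD ha hρ hρ hu hv h0
  simp only [sub_self, homEnergy_zero, norm_zero, ne_eq, OfNat.ofNat_ne_zero, not_false_eq_true,
    zero_pow, integral_zero, mul_zero, add_zero] at h1 h2 h3
  refine SolutionSpace.ext (ContinuousMap.ext fun t => sub_eq_zero.1 (norm_eq_zero.1 ?_)) (sub_eq_zero.1 (norm_eq_zero.1 ?_))
  · exact pow_eq_zero_iff two_ne_zero |>.1 (le_antisymm (h1 t) (sq_nonneg _))
  · exact pow_eq_zero_iff two_ne_zero |>.1 (le_antisymm (by linarith) (sq_nonneg _))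

end Stability

/-! ### Limits in the solution space -/

theorem exists_uniform_limit {X E : Type*} [TopologicalSpace X] [NormedAddCommGroup E]
    [CompleteSpace E] {f : ℕ → X → E} (hc : ∀ n, Continuous (f n)) {b : ℕ → ℝ} {c : ℝ}
    (hb : Tendsto b atTop (𝓝 0)) (hf : ∀ n m x, ‖f n x - f m x‖ ^ 2 ≤ c * (b n + b m)) :
    ∃ p : X → E, Continuous p ∧ ∀ x, Tendsto (fun n => f n x) atTop (𝓝 (p x)) := by
  choose p hp using fun x => cauchySeq_tendsto_of_complete
    (cauchySeq_of_norm_sq_le hb fun n m => hf n m x)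
  have hd : ∀ n x, dist (p x) (f n x) ≤ √(c * b n) := fun n x => by
    have h1 : Tendsto (fun m => ‖f n x - f m x‖) atTop (𝓝 ‖f n x - p x‖) :=
      ((hp x).const_sub _).norm
    have h2 : Tendsto (fun m => √(c * (b n + b m))) atTop (𝓝 √(c * (b n + 0))) :=
      ((hb.const_add (b n)).const_mul c).sqrt
    rw [dist_comm, dist_eq_norm, ← add_zero (b n)]
    exact le_of_tendsto_of_tendsto' h1 h2 fun m => Real.le_sqrt_of_sq_le (hf n m x)
  have hu : TendstoUniformly (fun n => f n) p atTop := by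
    rw [Metric.tendstoUniformly_iff]
    intro ε hε
    have h3 : Tendsto (fun n => √(c * b n)) atTop (𝓝 0) := by simpa using (hb.const_mul c).sqrt
    filter_upwards [h3.eventually_lt_const hε] with n hn x
    exact (hd n x).trans_lt hn
  exact ⟨p, hu.continuous (Frequently.of_forall hc), hp⟩

/-- Paths converge uniformly and values in $L^2(H^1)$. Along an almost everywhere convergent
subsequence the two limits agree, and Fatou's lemma gives the $L^4$ bound. -/
theorem exists_limit {T : ℝ} {u : ℕ → SolutionSpace T} {b : ℕ → ℝ} {c C : ℝ}
    (hb : Tendsto b atTop (𝓝 0))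
    (hp : ∀ n m t, ‖(u n).path t - (u m).path t‖ ^ 2 ≤ c * (b n + b m))
    (hv : CauchySeq fun n => (u n).val)
    (hq : ∀ n, ∫ s, quart ((u n).ct s) ∂timeMeasure T ≤ C) :
    ∃ v : SolutionSpace T, (∀ t, Tendsto (fun n => (u n).path t) atTop (𝓝 (v.path t))) ∧
      Tendsto (fun n => (u n).val) atTop (𝓝 v.val) := by
  obtain ⟨p, hpc, hp⟩ :=
    exists_uniform_limit (f := fun n => (u n).path) (fun n => (u n).path.continuous) hb hp
  obtain ⟨w, hw⟩ := cauchySeq_tendsto_of_complete hv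
  obtain ⟨ns, hns, hae⟩ :=
    (tendstoInMeasure_of_tendsto_Lp hw).exists_seq_tendsto_ae
  have hc : ∀ᵐ s ∂timeMeasure T, ∀ n, ∀ hs : s ∈ Set.Icc (0 : ℝ) T,
      (u n).path ⟨s, hs⟩ = toHm1 (H1.toL2 ((u n).val s)) := ae_all_iff.2 fun n => (u n).compat
  refine ⟨⟨⟨p, hpc⟩, w, ?_, ?_⟩, hp, hw⟩
  · filter_upwards [hae, hc] with s h1 h2 hs
    have h3 : Tendsto (fun n => (u (ns n)).path ⟨s, hs⟩) atTop (𝓝 (p ⟨s, hs⟩)) :=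
      (hp ⟨s, hs⟩).comp hns.tendsto_atTop
    have h4 := ((continuous_toHm1.comp H1.toL2.continuous).tendsto (w s)).comp h1
    refine tendsto_nhds_unique h3 (h4.congr fun n => ?_)
    exact (h2 (ns n) hs).symm
  · simp only [SolutionSpace.lintegral_toL2]
    have hlim : ∀ᵐ s ∂timeMeasure T, ENNReal.ofReal (quart (H1.toCT (w s))) =
        liminf (fun n => ENNReal.ofReal (quart ((u (ns n)).ct s))) atTop := by
      filter_upwards [hae] with s h1
      have h4 := ((ENNReal.continuous_ofReal.comp
        (continuous_quart.comp H1.toCT.continuous)).tendsto (w s)).comp h1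
      exact h4.liminf_eq.symm
    rw [lintegral_congr_ae hlim]
    refine lt_of_le_of_lt (lintegral_liminf_le' fun n => ?_) (lt_of_le_of_lt ?_
      (ENNReal.ofReal_lt_top (r := C)))
    · exact (ENNReal.continuous_ofReal.comp continuous_quart).comp_aestronglyMeasurable
        (u (ns n)).aesm_ct |>.aemeasurable
    · refine liminf_le_of_le (by isBoundedDefault) fun b hb => ?_
      obtain ⟨n, hn⟩ := hb.exists
      refine hn.trans ?_
      rw [← ofReal_integral_eq_lintegral_ofReal (u (ns n)).integrable_quart
        (Eventually.of_forall fun s => quart_nonneg _)]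
      exact ENNReal.ofReal_le_ofReal (hq _)

/-! ### Existence -/

theorem norm_sub_sq_le_two_mul {E : Type*} [SeminormedAddCommGroup E] (x y z : E) :
    ‖x - y‖ ^ 2 ≤ 2 * (‖x - z‖ ^ 2 + ‖y - z‖ ^ 2) := by
  have h := norm_sub_le (x - z) (y - z)
  rw [sub_sub_sub_cancel_right] at h
  have h1 := pow_le_pow_left₀ (norm_nonneg _) h 2
  nlinarith [sq_nonneg (‖x - z‖ - ‖y - z‖)]

/-- The truncated datum keeps the zero mode of `u₀`: all approximations share one mean, so the
stability estimate can compare them with each other. -/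
theorem exists_approx {a D T ε : ℝ} (ha : a < 0) (hD : 0 < D) (hT : 0 ≤ T) (hε : 0 < ε)
    (u₀ : Hm1) (g : L2L2 T) :
    ∃ (Φ : Hm1) (u : SolutionSpace T) (ρ : ℝ → L2), MemLp ρ 2 (timeMeasure T) ∧
      IsPerturbedSolution a D Φ ρ u ∧ Φ (casH1 0) = u₀ (casH1 0) ∧ ‖Φ - u₀‖ ^ 2 ≤ ε ∧
      ∫ s, ‖ρ s - √2 • prim (g s)‖ ^ 2 ∂timeMeasure T ≤ ε := by
  obtain ⟨N, hN⟩ := ((tendsto_toHm1_trigPoly u₀).eventually_lt_const (Real.sqrt_pos.2 hε)).exists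
  set S := Finset.Icc (-(N : ℤ)) N
  set φ := trigPoly S fun n => u₀ (casH1 n) with hφ
  obtain ⟨k, hk, hk2⟩ := MemLp.exists_boundedContinuous_integral_rpow_sub_le
    (p := 2) two_pos (f := g) (μ := timeMeasure T) (by simpa using Lp.memLp g)
    -- The total error is at most $2\eta^2T+4\int\|g-k\|^2$, and each of the two terms is at most
    -- $\varepsilon/2$ for this choice and that of $\eta$ below.
    (ε := ε / 8) (by positivity)
  simp only [Real.rpow_ofNat] at hk
  rw [ENNReal.ofReal_ofNat] at hk2
  set η := √(ε / (4 * (T + 1))) with hη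
  have hη0 : 0 < η := Real.sqrt_pos.2 (by positivity)
  obtain ⟨u, ρ, hρ, hu, hρg⟩ := exists_galerkin ha hD hT hη0 k.continuous
    (fun t => k.norm_coe_le_norm t) (φ := φ) (n₀ := N) fun n hn => by
      rw [hφ, coef_trigPoly, if_neg hn]
  refine ⟨_, u, ρ, hρ, hu, ?_, ?_, ?_⟩
  · rw [toHm1_casH1, hφ, coef_trigPoly, if_pos (by simp [S])]
  · rw [← Real.sq_sqrt hε.le]
    exact pow_le_pow_left₀ (ContinuousLinearMap.opNorm_nonneg _) hN.le 2
  · have hg := Lp.memLp g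
    have i1 : Integrable (fun s => ‖g s - k s‖ ^ 2) (timeMeasure T) :=
      integrable_norm_sq (hg.sub hk2)
    have i2 : Integrable (fun s => ‖ρ s - √2 • prim (g s)‖ ^ 2) (timeMeasure T) :=
      integrable_norm_sq (hρ.sub ((prim.comp_memLp' hg).const_smul √2))
    have hle : ∀ s, ‖ρ s - √2 • prim (g s)‖ ^ 2 ≤ 2 * η ^ 2 + 4 * ‖g s - k s‖ ^ 2 := fun s => by
      have h1 := norm_sub_sq_le_two_mul (ρ s) (√2 • prim (g s)) (√2 • prim (k s))
      have h2 := pow_le_pow_left₀ (norm_nonneg _) (hρg s) 2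
      have h3 : ‖√2 • prim (g s) - √2 • prim (k s)‖ ^ 2 ≤ 2 * ‖g s - k s‖ ^ 2 := by
        rw [← smul_sub, ← map_sub, norm_smul, mul_pow, Real.norm_of_nonneg (Real.sqrt_nonneg _),
          Real.sq_sqrt zero_le_two]
        have := pow_le_pow_left₀ (norm_nonneg _) (norm_prim_le (g s - k s)) 2
        linarith
      linarith
    refine (integral_mono i2 ((integrable_const _).add (i1.const_mul 4)) hle).trans ?_
    simp only [Pi.add_apply]
    rw [integral_add (integrable_const _) (i1.const_mul 4), integral_const, integral_const_mul]
    have hη2 : η ^ 2 = ε / (4 * (T + 1)) := Real.sq_sqrt (by positivity)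
    have hTm : (timeMeasure T).real Set.univ = T := by simp [hT]
    rw [hTm, hη2, smul_eq_mul]
    have : T * (2 * (ε / (4 * (T + 1)))) ≤ ε / 2 := by
      have e : T * (2 * (ε / (4 * (T + 1)))) = T / (T + 1) * (ε / 2) := by
        field_simp
        ring
      rw [e]
      exact mul_le_of_le_one_left (by positivity) ((div_le_one (by positivity)).2 (by linarith))
    linarith

theorem integral_one_add_add {α : Type*} [MeasurableSpace α] {μ : Measure α} [IsFiniteMeasure μ]
    {f h : α → ℝ} (hf : Integrable f μ) (hh : Integrable h μ) :
    ∫ s, (1 + f s + h s) ∂μ = (∫ _s, (1 : ℝ) ∂μ) + (∫ s, f s ∂μ) + ∫ s, h s ∂μ := by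
  have h1 : Integrable (fun _ : α => (1 : ℝ)) μ := integrable_const _
  have h2 : Integrable (fun s => 1 + f s) μ := h1.add hf
  rw [integral_add h2 hh, integral_add h1 hf]

theorem quart_neg (f : CT) : quart (-f) = quart f := by
  simp [quart, Even.neg_pow (⟨2, rfl⟩ : Even 4)]

theorem integral_quart_le_of_sub {T : ℝ} (u v : SolutionSpace T) :
    ∫ s, quart (u.ct s) ∂timeMeasure T ≤ 8 * ((∫ _s, (1 : ℝ) ∂timeMeasure T) +
      (∫ s, quart (u.ct s - v.ct s) ∂timeMeasure T) + ∫ s, quart (v.ct s) ∂timeMeasure T) := by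
  have i1 := integrable_quart_sub u v
  refine (integral_mono u.integrable_quart ((((integrable_const (1 : ℝ)).add i1).add
    v.integrable_quart).const_mul 8) fun s => ?_).trans ?_
  · have := quart_sub_le_add (u.ct s - v.ct s) (-v.ct s)
    rw [sub_neg_eq_add, sub_add_cancel, quart_neg] at this
    exact this
  · rw [integral_const_mul]
    simp only [Pi.add_apply]
    rw [integral_one_add_add i1 v.integrable_quart]

theorem integrable_weakForm {T a D : ℝ} {ρ : ℝ → L2} (u : SolutionSpace T)
    (hρ : MemLp ρ 2 (timeMeasure T)) (ψ : SmoothFun) :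
    Integrable (weakForm a D u ρ ψ) (timeMeasure T) :=
  integrable_perturbed u hρ ψ

/-- Convergence of the values in $L^2(H^1)$ with bounded fourth powers suffices for the cubic term,
by the bound with free $\delta$ in `exists_weakForm_bound`. -/
theorem IsPerturbedSolution.of_tendsto {a D T C : ℝ} {u : ℕ → SolutionSpace T}
    {v : SolutionSpace T} {Φ : ℕ → Hm1} {Ψ : Hm1} {ρ : ℕ → ℝ → L2} {σ : ℝ → L2}
    (hρ : ∀ n, MemLp (ρ n) 2 (timeMeasure T)) (hσ : MemLp σ 2 (timeMeasure T))
    (hu : ∀ n, IsPerturbedSolution a D (Φ n) (ρ n) (u n))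
    (hp : ∀ t, Tendsto (fun n => (u n).path t) atTop (𝓝 (v.path t)))
    (hv : Tendsto (fun n => (u n).val) atTop (𝓝 v.val))
    (hC : ∀ n, ∫ s, quart ((u n).ct s) ∂timeMeasure T ≤ C)
    (hΦ : Tendsto Φ atTop (𝓝 Ψ))
    (hρσ : Tendsto (fun n => ∫ s, ‖ρ n s - σ s‖ ^ 2 ∂timeMeasure T) atTop (𝓝 0)) :
    IsPerturbedSolution a D Ψ σ v := by
  intro ψ t
  obtain ⟨K, hK, hb⟩ := exists_weakForm_bound a D T ψ
  set r := fun n => ‖(u n).val - v.val‖ ^ 2 + ∫ s, ‖ρ n s - σ s‖ ^ 2 ∂timeMeasure T with hr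
  have hr0 : ∀ n, 0 ≤ r n := fun n =>
    add_nonneg (sq_nonneg _) (integral_nonneg fun _ => sq_nonneg _)
  have hrt : Tendsto r atTop (𝓝 0) := by
    have h1 : Tendsto (fun n => ‖(u n).val - v.val‖) atTop (𝓝 0) :=
      tendsto_iff_norm_sub_tendsto_zero.1 hv
    simpa using (h1.pow 2).add hρσ
  set Q := (∫ _s, (1 : ℝ) ∂timeMeasure T) + C + ∫ s, quart (v.ct s) ∂timeMeasure T with hQ
  have hx := tendsto_zero_of_forall_le (x := fun n => |∫ s in (0 : ℝ)..t,
    (weakForm a D (u n) (ρ n) ψ s - weakForm a D v σ ψ s)|) (C := Q) (fun _ => abs_nonneg _)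
    hr0 hrt hK fun δ hδ n => by
      refine (hb (u n) v (ρ n) σ (hρ n) hσ δ hδ t t.2).trans ?_
      refine mul_le_mul_of_nonneg_left (add_le_add le_rfl
        (mul_le_mul_of_nonneg_left ?_ hδ.le)) hK
      rw [integral_one_add_add (u n).integrable_quart v.integrable_quart]
      have := hC n
      linarith
  have h1 : Tendsto (fun n => (u n).path t ψ.toH1 - Φ n ψ.toH1) atTop
      (𝓝 (v.path t ψ.toH1 - Ψ ψ.toH1)) :=
    (((ContinuousLinearMap.apply ℝ ℝ ψ.toH1).continuous.tendsto _).comp (hp t)).sub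
      (((ContinuousLinearMap.apply ℝ ℝ ψ.toH1).continuous.tendsto _).comp hΦ)
  have h2 : ∀ n, (u n).path t ψ.toH1 - Φ n ψ.toH1 =
      (∫ s in (0 : ℝ)..t, (weakForm a D (u n) (ρ n) ψ s - weakForm a D v σ ψ s)) +
      ∫ s in (0 : ℝ)..t, weakForm a D v σ ψ s := fun n => by
    rw [hu n ψ t, add_sub_cancel_left, intervalIntegral.integral_sub
      (intervalIntegrable_of_integrable (integrable_weakForm (u n) (hρ n) ψ) t.2)
      (intervalIntegrable_of_integrable (integrable_weakForm v hσ ψ) t.2), sub_add_cancel]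
    rfl
  simp only [h2] at h1
  have h3 := ((tendsto_zero_iff_abs_tendsto_zero _).2 hx).add_const
    (∫ s in (0 : ℝ)..t, weakForm a D v σ ψ s)
  rw [zero_add] at h3
  have h4 := tendsto_nhds_unique h1 h3
  rw [sub_eq_iff_eq_add'] at h4
  exact h4

/-- The errors $b_n$ of the approximate data and forcings control all pairwise distances through the
stability estimate. The approximations are therefore Cauchy, and comparison with the approximation
of index $0$ bounds their fourth powers. -/
theorem exists_isWeakSolution {a D T : ℝ} (ha : a < 0) (hD : 0 < D) (hT : 0 ≤ T)
    (u₀ : Hm1) (g : L2L2 T) : ∃ u : SolutionSpace T, IsWeakSolution a D u₀ g u := by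
  set b : ℕ → ℝ := fun n => 1 / ((n : ℝ) + 1) with hb
  have hb0 : ∀ n, 0 < b n := fun n => by positivity
  have hbt : Tendsto b atTop (𝓝 0) := tendsto_one_div_add_atTop_nhds_zero_nat
  choose Φ u ρ hρ hu h0 hΦ hρg using fun n => exists_approx ha hD hT (hb0 n) u₀ g
  set σ : ℝ → L2 := fun s => √2 • prim (g s) with hσd
  have hσ : MemLp σ 2 (timeMeasure T) := (prim.comp_memLp' (Lp.memLp g)).const_smul √2
  have h00 : ∀ n m, (Φ n - Φ m) (casH1 0) = 0 := fun n m => by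
    rw [sub_apply, h0, h0, sub_self]
  set E := fun n m => homEnergy (Φ n - Φ m) +
    D⁻¹ * ∫ s, ‖ρ n s - ρ m s‖ ^ 2 ∂timeMeasure T with hE
  have hEb : ∀ n m, E n m ≤ 2 * (1 + D⁻¹) * (b n + b m) := fun n m => by
    have e1 := (homEnergy_le (Φ n - Φ m)).trans (norm_sub_sq_le_two_mul _ _ u₀)
    have i : ∀ n, Integrable (fun s => ‖ρ n s - σ s‖ ^ 2) (timeMeasure T) := fun n =>
      integrable_norm_sq ((hρ n).sub hσ)
    have inm : Integrable (fun s => ‖ρ n s - ρ m s‖ ^ 2) (timeMeasure T) :=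
      integrable_norm_sq ((hρ n).sub (hρ m))
    have e2 : ∫ s, ‖ρ n s - ρ m s‖ ^ 2 ∂timeMeasure T ≤ 2 * (b n + b m) := by
      refine (integral_mono inm (((i n).add (i m)).const_mul 2)
        fun s => norm_sub_sq_le_two_mul _ _ (σ s)).trans ?_
      rw [integral_const_mul]
      simp only [Pi.add_apply]
      rw [integral_add (i n) (i m)]
      have := hρg n
      have := hρg m
      linarith
    have e3 := mul_le_mul_of_nonneg_left e2 (inv_pos.2 hD).le
    have := hΦ n
    have := hΦ m
    simp only [hE]
    linarith
  have hpath : ∀ n m t, ‖(u n).path t - (u m).path t‖ ^ 2 ≤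
      4 * (1 + D⁻¹) * (b n + b m) := fun n m t => by
    have h1 := norm_path_sub_sq_le hD ha (hρ n) (hρ m) (hu n) (hu m) (h00 n m) t
    have h2 := hEb n m
    simp only [hE] at h2
    linarith
  have hval : CauchySeq fun n => (u n).val := by
    refine cauchySeq_of_norm_sq_le (c := 2 * (4 / D * (2 * (1 + D⁻¹)))) hbt fun n m => ?_
    have h1 := norm_val_sub_sq_le_dx (hρ n) (hρ m) (hu n) (hu m) (h00 n m)
    have h2 := integral_dx_le hT hD ha (hρ n) (hρ m) (hu n) (hu m) (h00 n m)
    have h3 := mul_le_mul_of_nonneg_left (hEb n m) (by positivity : 0 ≤ 4 / D)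
    simp only [hE] at h3
    linarith
  have hquart : ∀ n, ∫ s, quart ((u n).ct s) ∂timeMeasure T ≤
      8 * ((∫ _s, (1 : ℝ) ∂timeMeasure T) + 4 * (2 * (1 + D⁻¹) * (1 + 1)) +
        ∫ s, quart ((u 0).ct s) ∂timeMeasure T) := fun n => by
    have h2 := integral_quart_le hT hD ha (hρ n) (hρ 0) (hu n) (hu 0) (h00 n 0)
    have h3 : E n 0 ≤ 2 * (1 + D⁻¹) * (1 + 1) := by
      refine (hEb n 0).trans (mul_le_mul_of_nonneg_left (add_le_add ?_ ?_) (by positivity))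
      · rw [hb]
        exact div_le_one (by positivity) |>.2 (by simp)
      · simp [hb]
    simp only [hE] at h3
    have h4 := integral_quart_le_of_sub (u n) (u 0)
    linarith
  obtain ⟨v, hvp, hvv⟩ := exists_limit hbt hpath hval hquart
  refine ⟨v, (isWeakSolution_iff a D u₀ g v).2 ?_⟩
  refine IsPerturbedSolution.of_tendsto hρ hσ hu hvp hvv hquart ?_ ?_
  · refine (tendsto_iff_norm_sub_tendsto_zero (E := Hm1)).2 ?_
    have h1 : Tendsto (fun n => √(b n)) atTop (𝓝 0) := by simpa using hbt.sqrt
    exact squeeze_zero (fun n => ContinuousLinearMap.opNorm_nonneg _) (fun n => Real.le_sqrt_of_sq_le (hΦ n)) h1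
  · exact squeeze_zero (fun n => integral_nonneg fun _ => sq_nonneg _) hρg hbt

/-! ### Weakly convergent controls -/

theorem Ioc_subset_Icc_of_le {T s t : ℝ} (hs : 0 ≤ s) (ht : t ≤ T) :
    Set.Ioc s t ⊆ Set.Icc 0 T :=
  fun _ hx => ⟨hs.trans hx.1.le, hx.2.trans ht⟩

theorem inner_indicatorConstLp_Ioc {T s t : ℝ} (hs : 0 ≤ s) (hst : s ≤ t) (ht : t ≤ T) (c : L2)
    (h : L2L2 T) :
    ⟪indicatorConstLp 2 (measurableSet_Ioc (a := s) (b := t))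
      (measure_ne_top (timeMeasure T) _) c, h⟫ = ∫ r in s..t, ⟪c, h r⟫ := by
  rw [L2.inner_indicatorConstLp_eq_setIntegral_inner, intervalIntegral.integral_of_le hst,
    Measure.restrict_restrict_of_subset (Ioc_subset_Icc_of_le hs ht)]

theorem abs_integral_inner_le {T s t : ℝ} (hs : 0 ≤ s) (hst : s ≤ t) (ht : t ≤ T) (c : L2)
    (h : L2L2 T) : |∫ r in s..t, ⟪c, h r⟫| ≤ ‖c‖ * √(t - s) * ‖h‖ := by
  rw [← inner_indicatorConstLp_Ioc hs hst ht]
  refine (abs_real_inner_le_norm _ _).trans (mul_le_mul_of_nonneg_right ?_ (norm_nonneg _))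
  rw [norm_indicatorConstLp two_ne_zero ENNReal.ofNat_ne_top, ENNReal.toReal_ofNat,
    ← Real.sqrt_eq_rpow]
  refine mul_le_mul_of_nonneg_left (Real.sqrt_le_sqrt ?_) (norm_nonneg _)
  rw [measureReal_restrict_apply measurableSet_Ioc, Set.inter_eq_left.2
    (Ioc_subset_Icc_of_le hs ht), Real.volume_real_Ioc_of_le hst]

theorem integrable_inner_L2L2 {T : ℝ} (c : L2) (h : L2L2 T) :
    Integrable (fun r => ⟪c, h r⟫) (timeMeasure T) :=
  ((Lp.memLp h).const_inner c).integrable one_le_two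

/-- The primitives of a weakly convergent sequence converge uniformly. -/
theorem tendstoUniformly_primitive {T B : ℝ} {h : ℕ → L2L2 T}
    (hw : ∀ f : L2L2 T, Tendsto (fun m => ⟪f, h m⟫) atTop (𝓝 0)) (hB : ∀ m, ‖h m‖ ≤ B) (c : L2) :
    TendstoUniformly (fun m (t : Set.Icc 0 T) => ∫ r in (0 : ℝ)..t, ⟪c, h m r⟫) 0 atTop := by
  set F := fun m (t : Set.Icc 0 T) => ∫ r in (0 : ℝ)..t, ⟪c, h m r⟫ with hF
  -- Cauchy–Schwarz in time makes the primitives Hölder of exponent $\frac12$ with a common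
  -- constant. On a compact interval, equicontinuity upgrades pointwise convergence to uniform
  -- convergence.
  have heq : Equicontinuous F := by
    refine Metric.equicontinuous_of_continuity_modulus (fun d => ‖c‖ * √d * B) ?_ F ?_
    · have : Continuous fun d => ‖c‖ * √d * B := by fun_prop
      simpa using this.tendsto 0
    · have key : ∀ s t : Set.Icc 0 T, s ≤ t → ∀ m, dist (F m s) (F m t) ≤
          ‖c‖ * √(dist s t) * B := fun s t hst m => by
        have i := fun x : Set.Icc 0 T =>
          intervalIntegrable_of_integrable (integrable_inner_L2L2 c (h m)) x.2
        have hst' : (s : ℝ) ≤ t := hst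
        rw [dist_comm, Real.dist_eq]
        simp only [hF]
        rw [intervalIntegral.integral_interval_sub_left (i t) (i s), dist_comm,
          Subtype.dist_eq, Real.dist_eq, abs_of_nonneg (sub_nonneg.2 hst')]
        exact (abs_integral_inner_le s.2.1 hst' t.2.2 c (h m)).trans
          (mul_le_mul_of_nonneg_left (hB m) (by positivity))
      intro s t m
      rcases le_total s t with hst | hst
      · exact key s t hst m
      · rw [dist_comm (F m s), dist_comm s]
        exact key t s hst m
  have hpt : Tendsto F atTop (𝓝 0) := by
    rw [tendsto_pi_nhds]
    intro t
    simp only [hF, ← inner_indicatorConstLp_Ioc le_rfl t.2.1 t.2.2]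
    exact hw _
  exact UniformFun.tendsto_iff_tendstoUniformly.1 ((heq.tendsto_uniformFun_iff_pi atTop 0).2 hpt)

/-- Integration by parts moves the primitive onto `c`, where it is at most `ε`. The boundary term
and the remaining integral each contribute one factor of the $2$. -/
theorem abs_integral_mul_primitive_le {T ε : ℝ} (hT : 0 ≤ T) {c G : ℝ → ℝ}
    (hc : Integrable c (timeMeasure T)) (hG : Integrable G (timeMeasure T))
    (hε : ∀ t ∈ Set.Icc 0 T, |∫ s in (0 : ℝ)..t, c s| ≤ ε) :
    |∫ s in (0 : ℝ)..T, c s * ∫ r in (0 : ℝ)..s, G r| ≤ 2 * ε * ∫ s, |G s| ∂timeMeasure T := by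
  have hTT : T ∈ Set.Icc 0 T := ⟨hT, le_rfl⟩
  have hc' := intervalIntegrable_of_integrable hc hTT
  have hG' := intervalIntegrable_of_integrable hG hTT
  have hcont : ∀ {f : ℝ → ℝ}, Integrable f (timeMeasure T) →
      ContinuousOn (fun s => ∫ r in (0 : ℝ)..s, f r) (Set.uIcc 0 T) := fun hf =>
    intervalIntegral.continuousOn_primitive_interval (by rw [Set.uIcc_of_le hT]; exact hf)
  have i1 := hc'.mul_continuousOn (hcont hG)
  have i2 := hG'.continuousOn_mul (hcont hc)
  have hp := primitive_mul_primitive hc' hG' 0 0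
  simp only [zero_add, mul_zero] at hp
  rw [intervalIntegral.integral_add i1 i2, ← sub_eq_iff_eq_add] at hp
  have hε0 : 0 ≤ ε := (abs_nonneg _).trans (hε T hTT)
  have b1 : |∫ s in (0 : ℝ)..T, G s| ≤ ∫ s, |G s| ∂timeMeasure T :=
    abs_intervalIntegral_le hG.abs (fun _ => le_rfl) hTT
  have b2 : |∫ s in (0 : ℝ)..T, (∫ r in (0 : ℝ)..s, c r) * G s| ≤
      ε * ∫ s, |G s| ∂timeMeasure T := by
    rw [← intervalIntegral_eq_timeMeasure hT, ← intervalIntegral.integral_const_mul,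
      ← Real.norm_eq_abs]
    refine intervalIntegral.norm_integral_le_of_norm_le hT (Eventually.of_forall fun s hs => ?_)
      ((intervalIntegrable_of_integrable hG.abs hTT).const_mul ε)
    rw [norm_mul]
    exact mul_le_mul_of_nonneg_right (hε s ⟨hs.1.le, hs.2⟩) (abs_nonneg _)
  rw [← hp]
  refine (abs_sub _ _).trans ?_
  rw [abs_mul]
  have b3 := mul_le_mul (hε T hTT) b1 (abs_nonneg _) hε0
  linarith

/-! ### Pairing a weakly null forcing with differences of solutions. -/

section WeakStrong

variable {T a D : ℝ} {Φ : Hm1} {ρ : ℕ → ℝ → L2} {σ : ℝ → L2} {u : ℕ → SolutionSpace T}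
  {v : SolutionSpace T}

/-- Bounds the time derivative of mode `k`, with a constant independent of the solutions and
forcings; this yields the $L^1$ bound in `tendsto_integral_mode`. -/
theorem abs_mode_le (hD : 0 ≤ D) (a : ℝ) (k : ℤ) : ∃ K, 0 ≤ K ∧
    ∀ (u v : SolutionSpace T) (ρ σ : ℝ → L2) (s : ℝ),
    |-lam k * (D / 2 * lam k * coef k (H1.toL2 (u.val s - v.val s)) +
        coef k (ctL2 (nonlin a (u.ct s) - nonlin a (v.ct s)) + (ρ s - σ s)))| ≤
      K * (‖H1.toL2 (u.val s - v.val s)‖ ^ 2 + ‖ρ s - σ s‖ ^ 2 +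
        (1 + quart (u.ct s) + quart (v.ct s))) := by
  have hl := lam_nonneg k
  refine ⟨lam k * (D / 2 * lam k + (‖(cas k).onTorus‖ * (8 * (1 + |a|)) + 1)), by positivity,
    fun u v ρ σ s => ?_⟩
  have q1 := quart_nonneg (u.ct s)
  have q2 := quart_nonneg (v.ct s)
  have h1 := abs_coef_le k (H1.toL2 (u.val s - v.val s))
  have h2 := abs_coef_le k (ρ s - σ s)
  have h3 := abs_inner_nonlin_sub_le a 1 one_pos (u.ct s) (v.ct s) (cas k).onTorus
  rw [ctL2_ct_sub, inv_one, one_mul, one_mul] at h3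
  have e : ⟪ctL2 (nonlin a (u.ct s) - nonlin a (v.ct s)), ctL2 (cas k).onTorus⟫ =
      coef k (ctL2 (nonlin a (u.ct s) - nonlin a (v.ct s))) := by
    rw [coef_apply', e, SmoothFun.toL2_eq]
  rw [e] at h3
  set n1 := ‖H1.toL2 (u.val s - v.val s)‖
  set n2 := ‖ρ s - σ s‖
  set Y := n1 ^ 2 + n2 ^ 2 + (1 + quart (u.ct s) + quart (v.ct s)) with hY
  have b1 : n1 ≤ Y := by nlinarith [sq_nonneg (n1 - 1), sq_nonneg n2]
  have b2 : n2 ≤ Y := by nlinarith [sq_nonneg (n2 - 1), sq_nonneg n1]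
  have b3 : n1 ^ 2 + (1 + quart (u.ct s) + quart (v.ct s)) ≤ Y := by
    have := sq_nonneg n2
    linarith
  rw [abs_mul, abs_neg, abs_of_nonneg hl, mul_assoc (lam k) _ Y]
  refine mul_le_mul_of_nonneg_left ?_ hl
  rw [map_add, add_mul, add_mul, one_mul]
  refine (abs_add_le _ _).trans (add_le_add ?_ ((abs_add_le _ _).trans
    (add_le_add ?_ (h2.trans b2))))
  · rw [abs_mul, abs_of_nonneg (by positivity)]
    exact mul_le_mul_of_nonneg_left (h1.trans b1) (by positivity)
  · exact h3.trans (mul_le_mul_of_nonneg_left b3 (by positivity))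

/-- The mode of the difference starts from zero and is the primitive of an $L^1$-bounded function,
while the forcing mode has uniformly vanishing primitives. Integration by parts in time concludes.
-/
theorem tendsto_integral_mode (hT : 0 ≤ T) (hD : 0 ≤ D)
    (hρ : ∀ m, MemLp (ρ m) 2 (timeMeasure T))
    (hσ : MemLp σ 2 (timeMeasure T)) (hu : ∀ m, IsPerturbedSolution a D Φ (ρ m) (u m))
    (hv : IsPerturbedSolution a D Φ σ v) {Q : ℝ}
    (hQ : ∀ m, ∫ s, (‖H1.toL2 ((u m).val s - v.val s)‖ ^ 2 + ‖ρ m s - σ s‖ ^ 2 +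
        (1 + quart ((u m).ct s) + quart (v.ct s))) ∂timeMeasure T ≤ Q) (k : ℤ)
    (hk : TendstoUniformly (fun m (t : Set.Icc 0 T) => ∫ s in (0 : ℝ)..t, coef k (ρ m s - σ s))
      0 atTop) :
    Tendsto (fun m => ∫ s in (0 : ℝ)..T, coef k (ρ m s - σ s) *
      coef k (H1.toL2 ((u m).val s - v.val s))) atTop (𝓝 0) := by
  obtain ⟨K, hK, hb⟩ := abs_mode_le (T := T) hD a k
  have hTT : T ∈ Set.Icc 0 T := ⟨hT, le_rfl⟩
  set G := fun m s => -lam k * (D / 2 * lam k * coef k (H1.toL2 ((u m).val s - v.val s)) +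
        coef k (ctL2 (nonlin a ((u m).ct s) - nonlin a (v.ct s)) + (ρ m s - σ s))) with hG
  have hGi : ∀ m, Integrable (G m) (timeMeasure T) := fun m => integrable_mode (hρ m) hσ k
  have hGQ : ∀ m, ∫ s, |G m s| ∂timeMeasure T ≤ K * Q := fun m => by
    refine (integral_mono (hGi m).abs ?_ fun s => hb (u m) v (ρ m) σ s).trans ?_
    · exact (((integrable_norm_sq (memLp_toL2_sub (u m) v)).add
        (integrable_norm_sq ((hρ m).sub hσ))).add
          (by simpa using integrable_quart_bound (u m) v 1)).const_mul K
    · rw [integral_const_mul]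
      exact mul_le_mul_of_nonneg_left (hQ m) hK
  have hci : ∀ m, Integrable (fun s => coef k (ρ m s - σ s)) (timeMeasure T) := fun m =>
    ((coef k).comp_memLp' ((hρ m).sub hσ)).integrable one_le_two
  have heq : ∀ m, ∫ s in (0 : ℝ)..T, coef k (ρ m s - σ s) *
      coef k (H1.toL2 ((u m).val s - v.val s)) =
      ∫ s in (0 : ℝ)..T, coef k (ρ m s - σ s) * ∫ r in (0 : ℝ)..s, G m r := fun m => by
    refine intervalIntegral.integral_congr_ae ?_
    refine ae_uIoc_of_ae (p := fun s => coef k (ρ m s - σ s) *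
      coef k (H1.toL2 ((u m).val s - v.val s)) =
      coef k (ρ m s - σ s) * ∫ r in (0 : ℝ)..s, G m r) ?_ hTT
    filter_upwards [ae_coef_eq (u m) v k, ae_restrict_mem measurableSet_Icc] with s h1 h2
    rw [h1 h2, mode_eq (hρ m) hσ (hu m) hv k ⟨s, h2⟩, sub_self, zero_apply, zero_add]
  have hKQ : 0 ≤ K * Q := (integral_nonneg fun _ => abs_nonneg _).trans (hGQ 0)
  rw [Metric.tendstoUniformly_iff] at hk
  rw [Metric.tendsto_atTop']
  intro ε hε
  -- With this threshold the final bound is $\varepsilon KQ/(KQ+1)<\varepsilon$, including the case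
  -- $KQ=0$.
  obtain ⟨N, hN⟩ := eventually_atTop.1 (hk (ε / (2 * (K * Q + 1))) (by positivity))
  refine ⟨N, fun m hm => ?_⟩
  rw [dist_zero_right, Real.norm_eq_abs, heq]
  refine (abs_integral_mul_primitive_le hT (hci m) (hGi m)
    (ε := ε / (2 * (K * Q + 1))) fun t ht => ?_).trans_lt ?_
  · have := hN m hm.le ⟨t, ht⟩
    rw [Pi.zero_apply, dist_zero_left, Real.norm_eq_abs] at this
    exact this.le
  · have h1 : 2 * (ε / (2 * (K * Q + 1))) * (∫ s, |G m s| ∂timeMeasure T) ≤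
        2 * (ε / (2 * (K * Q + 1))) * (K * Q) :=
      mul_le_mul_of_nonneg_left (hGQ m) (by positivity)
    refine h1.trans_lt ?_
    have e : 2 * (ε / (2 * (K * Q + 1))) * (K * Q) = ε * (K * Q) / (K * Q + 1) := by
      field_simp
    rw [e, div_lt_iff₀ (by positivity)]
    nlinarith

theorem inner_trunc_comm (N : ℕ) (f g : L2) : ⟪trunc N f, g⟫ = ⟪f, trunc N g⟫ := by
  rw [real_inner_comm (trunc N g), inner_trunc, inner_trunc]
  exact Finset.sum_congr rfl fun n _ => mul_comm _ _

theorem abs_inner_sub_trunc_le {N : ℕ} (hN : N ≠ 0) (r : L2) (w : H1) :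
    |⟪r, H1.toL2 w⟫ - ⟪trunc N r, H1.toL2 w⟫| ≤ (N : ℝ)⁻¹ * (‖r‖ ^ 2 + ‖H1.dx w‖ ^ 2) := by
  have hN0 : (0 : ℝ) < N := by positivity
  rw [inner_trunc_comm, ← inner_sub_right, ← mul_le_mul_iff_right₀ hN0,
    mul_inv_cancel_left₀ hN0.ne']
  have h3 := mul_le_mul_of_nonneg_left (norm_toL2_sub_trunc_le N w) (norm_nonneg r)
  have h4 := mul_le_mul_of_nonneg_left
    (abs_real_inner_le_norm r (H1.toL2 w - trunc N (H1.toL2 w))) hN0.le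
  nlinarith [sq_nonneg (‖r‖ - ‖H1.dx w‖), sq_nonneg ‖r‖, sq_nonneg ‖H1.dx w‖]

/-- Frequencies above $N$ contribute at most $R/N$ uniformly in $m$, thanks to the bound on
$\partial_x$ of the differences. The finitely many others tend to zero one by one. -/
theorem tendsto_integral_inner (hT : 0 ≤ T) (hD : 0 ≤ D)
    (hρ : ∀ m, MemLp (ρ m) 2 (timeMeasure T))
    (hσ : MemLp σ 2 (timeMeasure T)) (hu : ∀ m, IsPerturbedSolution a D Φ (ρ m) (u m))
    (hv : IsPerturbedSolution a D Φ σ v) {Q R : ℝ}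
    (hQ : ∀ m, ∫ s, (‖H1.toL2 ((u m).val s - v.val s)‖ ^ 2 + ‖ρ m s - σ s‖ ^ 2 +
        (1 + quart ((u m).ct s) + quart (v.ct s))) ∂timeMeasure T ≤ Q)
    (hR : ∀ m, ∫ s, (‖ρ m s - σ s‖ ^ 2 + ‖H1.dx ((u m).val s - v.val s)‖ ^ 2) ∂timeMeasure T ≤ R)
    (hk : ∀ k, TendstoUniformly (fun m (t : Set.Icc 0 T) =>
      ∫ s in (0 : ℝ)..t, coef k (ρ m s - σ s)) 0 atTop) :
    Tendsto (fun m => ∫ s in (0 : ℝ)..T, ⟪ρ m s - σ s, H1.toL2 ((u m).val s - v.val s)⟫)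
      atTop (𝓝 0) := by
  have hTT : T ∈ Set.Icc 0 T := ⟨hT, le_rfl⟩
  have hr : ∀ m, MemLp (fun s => ρ m s - σ s) 2 (timeMeasure T) := fun m => (hρ m).sub hσ
  have iR : ∀ m, Integrable (fun s => ‖ρ m s - σ s‖ ^ 2 + ‖H1.dx ((u m).val s - v.val s)‖ ^ 2)
      (timeMeasure T) := fun m =>
    (integrable_norm_sq (hr m)).add (integrable_norm_sq (memLp_dx_sub (u m) v))
  have iw : ∀ m, Integrable (fun s => ⟪ρ m s - σ s, H1.toL2 ((u m).val s - v.val s)⟫)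
      (timeMeasure T) := fun m => integrable_inner (hr m) (memLp_toL2_sub (u m) v)
  have it : ∀ N m, Integrable (fun s => ⟪trunc N (ρ m s - σ s),
      H1.toL2 ((u m).val s - v.val s)⟫) (timeMeasure T) := fun N m =>
    integrable_inner ((trunc N).comp_memLp' (hr m)) (memLp_toL2_sub (u m) v)
  have hlow : ∀ N, Tendsto (fun m => ∫ s in (0 : ℝ)..T, ⟪trunc N (ρ m s - σ s),
      H1.toL2 ((u m).val s - v.val s)⟫) atTop (𝓝 0) := fun N => by
    have h1 := tendsto_finsetSum (Finset.Icc (-(N : ℤ)) N) fun k _ =>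
      tendsto_integral_mode hT hD hρ hσ hu hv hQ k (hk k)
    rw [Finset.sum_const_zero] at h1
    refine h1.congr fun m => ?_
    simp only [inner_trunc]
    rw [intervalIntegral.integral_finsetSum]
    intro k _
    refine intervalIntegrable_of_integrable ?_ hTT
    exact ((coef k).comp_memLp' (hr m)).integrable_mul ((coef k).comp_memLp' (memLp_toL2_sub (u m) v))
  have hhigh : ∀ N : ℕ, N ≠ 0 → ∀ m, |(∫ s in (0 : ℝ)..T, ⟪ρ m s - σ s,
      H1.toL2 ((u m).val s - v.val s)⟫) - ∫ s in (0 : ℝ)..T, ⟪trunc N (ρ m s - σ s),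
      H1.toL2 ((u m).val s - v.val s)⟫| ≤ (N : ℝ)⁻¹ * R := fun N hN m => by
    rw [← intervalIntegral.integral_sub (intervalIntegrable_of_integrable (iw m) hTT)
      (intervalIntegrable_of_integrable (it N m) hTT)]
    refine (abs_intervalIntegral_le ((iR m).const_mul (N : ℝ)⁻¹)
      (fun s => abs_inner_sub_trunc_le hN _ _) hTT).trans ?_
    rw [integral_const_mul]
    exact mul_le_mul_of_nonneg_left (hR m) (by positivity)
  have hR0 : 0 ≤ R := (integral_nonneg fun _ => by positivity).trans (hR 0)
  rw [Metric.tendsto_atTop']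
  intro ε hε
  obtain ⟨N, hN⟩ := exists_nat_gt (R / (ε / 2))
  have hN0 : (0 : ℝ) < N := (by positivity : (0 : ℝ) ≤ R / (ε / 2)).trans_lt hN
  obtain ⟨M, hM⟩ := Metric.tendsto_atTop'.1 (hlow N) (ε / 2) (by positivity)
  refine ⟨M, fun m hm => ?_⟩
  have h1 := hhigh N (by exact_mod_cast hN0.ne') m
  have h2 := hM m hm
  rw [dist_zero_right, Real.norm_eq_abs] at h2 ⊢
  have h3 : (N : ℝ)⁻¹ * R < ε / 2 := by
    rw [inv_mul_lt_iff₀ hN0]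
    rwa [div_lt_iff₀ (by positivity)] at hN
  rw [abs_le] at h1
  rw [abs_lt] at h2 ⊢
  constructor <;> linarith

end WeakStrong

/-! ### Convergence of solutions and positivity of the diffusion constant -/

theorem exists_norm_le_of_tendsto_inner {H : Type*} [NormedAddCommGroup H]
    [InnerProductSpace ℝ H] [CompleteSpace H] {h : ℕ → H}
    (hw : ∀ f, Tendsto (fun m => ⟪f, h m⟫) atTop (𝓝 0)) : ∃ B, ∀ m, ‖h m‖ ≤ B := by
  obtain ⟨B, hB⟩ := banach_steinhaus (g := fun m => innerSL ℝ (h m)) fun f => by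
    obtain ⟨C, hC⟩ := (hw f).norm.bddAbove_range
    refine ⟨C, fun m => ?_⟩
    rw [innerSL_apply_apply, real_inner_comm]
    exact hC ⟨m, rfl⟩
  exact ⟨B, fun m => by simpa using hB m⟩

theorem tendsto_inner_sub {H : Type*} [NormedAddCommGroup H] [InnerProductSpace ℝ H]
    {g : ℕ → H} {g₀ : H} (hg : Tendsto (fun m => toWeakSpace ℝ H (g m)) atTop
      (𝓝 (toWeakSpace ℝ H g₀))) (f : H) :
    Tendsto (fun m => ⟪f, g m - g₀⟫) atTop (𝓝 0) := by
  have h1 := ((WeakBilin.eval_continuous (topDualPairing ℝ H).flip (innerSL ℝ f)).tendsto _).comp hg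
  have h2 : Tendsto (fun m => ⟪f, g m⟫) atTop (𝓝 ⟪f, g₀⟫) := h1
  simp only [inner_sub_right]
  simpa using h2.sub_const ⟪f, g₀⟫

theorem exists_coef_prim_eq_inner (k : ℤ) : ∃ c : L2, ∀ f, coef k (√2 • prim f) = ⟪c, f⟫ := by
  refine ⟨(InnerProductSpace.toDual ℝ L2).symm (√2 • (coef k).comp prim), fun f => ?_⟩
  rw [InnerProductSpace.toDual_symm_apply]
  simp

/-- The energy identity for a common datum, with the final energy and the monotone pairing dropped
as nonnegative. The forcing term stays inside a single absolute value, since only the whole pairing,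
not the norm of $\rho-\sigma$, will tend to zero. -/
theorem integral_dx_le_abs {T a D : ℝ} {Φ : Hm1} {ρ σ : ℝ → L2} {u v : SolutionSpace T}
    (hT : 0 ≤ T) (ha : a < 0) (hD : 0 ≤ D) (hρ : MemLp ρ 2 (timeMeasure T))
    (hσ : MemLp σ 2 (timeMeasure T)) (hu : IsPerturbedSolution a D Φ ρ u)
    (hv : IsPerturbedSolution a D Φ σ v) :
    D / 2 * ∫ s, ‖H1.dx (u.val s - v.val s)‖ ^ 2 ∂timeMeasure T ≤
      |∫ s in (0 : ℝ)..T, ⟪ρ s - σ s, H1.toL2 (u.val s - v.val s)⟫| := by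
  have h := energy_identity hD hρ hσ hu hv (by simp) ⟨T, hT, le_rfl⟩
  simp only [inner_add_left, sub_self, homEnergy_zero] at h
  have hE := homEnergy_nonneg (u.path ⟨T, hT, le_rfl⟩ - v.path ⟨T, hT, le_rfl⟩)
  have i1 : Integrable (fun s => D / 2 * ‖H1.dx (u.val s - v.val s)‖ ^ 2) (timeMeasure T) :=
    (integrable_norm_sq (memLp_dx_sub u v)).const_mul (D / 2)
  have i2 := integrable_inner_nonlin u v a
  have i3 : Integrable (fun s => ⟪ρ s - σ s, H1.toL2 (u.val s - v.val s)⟫) (timeMeasure T) :=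
    integrable_inner (hρ.sub hσ) (memLp_toL2_sub u v)
  have i23 : Integrable (fun s => ⟪ctL2 (nonlin a (u.ct s) - nonlin a (v.ct s)),
      H1.toL2 (u.val s - v.val s)⟫ + ⟪ρ s - σ s, H1.toL2 (u.val s - v.val s)⟫)
      (timeMeasure T) := i2.add i3
  rw [intervalIntegral_eq_timeMeasure hT, integral_add i1 i23, integral_add i2 i3,
    integral_const_mul] at h
  have h2 : 0 ≤ ∫ s, ⟪ctL2 (nonlin a (u.ct s) - nonlin a (v.ct s)),
      H1.toL2 (u.val s - v.val s)⟫ ∂timeMeasure T := integral_nonneg fun s => by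
    have := quart_sub_le ha (u.ct s) (v.ct s)
    rw [ctL2_ct_sub] at this
    have := quart_nonneg (u.ct s - v.ct s)
    simp only [Pi.zero_apply]
    linarith
  rw [intervalIntegral_eq_timeMeasure hT]
  have := neg_abs_le (∫ s, ⟪ρ s - σ s, H1.toL2 (u.val s - v.val s)⟫ ∂timeMeasure T)
  linarith

theorem norm_toL2L2_sub_le {T : ℝ} (u v : SolutionSpace T) :
    ‖u.toL2L2 - v.toL2L2‖ ≤ ‖H1.toL2‖ * ‖u.val - v.val‖ := by
  have : u.toL2L2 - v.toL2L2 = (H1.toL2.compLpL 2 (timeMeasure T)) (u.val - v.val) := by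
    rw [map_sub]
    rfl
  rw [this]
  exact ContinuousLinearMap.norm_compLp_le _ _

/-- Banach–Steinhaus bounds the controls and stability then bounds the differences, which are the
inputs of `tendsto_integral_inner`. The argument in fact gives convergence of the values in
$L^2(H^1)$. -/
theorem tendsto_toL2L2_sub {T a D : ℝ} (hT : 0 ≤ T) (ha : a < 0) (hD : 0 < D) {u₀ : Hm1}
    {g : L2L2 T} {gm : ℕ → L2L2 T}
    (hg : Tendsto (fun m => toWeakSpace ℝ (L2L2 T) (gm m)) atTop (𝓝 (toWeakSpace ℝ (L2L2 T) g)))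
    {um : ℕ → SolutionSpace T} {u : SolutionSpace T}
    (hum : ∀ m, IsWeakSolution a D u₀ (gm m) (um m)) (hu : IsWeakSolution a D u₀ g u) :
    Tendsto (fun m => ‖(um m).toL2L2 - u.toL2L2‖) atTop (𝓝 0) := by
  simp only [isWeakSolution_iff] at hum hu
  set h : ℕ → L2L2 T := fun m => gm m - g with hh
  have hw : ∀ f : L2L2 T, Tendsto (fun m => ⟪f, h m⟫) atTop (𝓝 0) := tendsto_inner_sub hg
  obtain ⟨B, hB⟩ := exists_norm_le_of_tendsto_inner hw
  set σ : ℝ → L2 := fun s => √2 • prim (g s) with hσd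
  set ρ : ℕ → ℝ → L2 := fun m s => √2 • prim (gm m s) with hρd
  have hσ : MemLp σ 2 (timeMeasure T) := (prim.comp_memLp' (Lp.memLp g)).const_smul √2
  have hρ : ∀ m, MemLp (ρ m) 2 (timeMeasure T) := fun m =>
    (prim.comp_memLp' (Lp.memLp (gm m))).const_smul √2
  have hr : ∀ m, ∀ᵐ s ∂timeMeasure T, ρ m s - σ s = √2 • prim (h m s) := fun m => by
    filter_upwards [Lp.coeFn_sub (gm m) g] with s hs
    rw [hh]
    simp only
    rw [hs, Pi.sub_apply, map_sub, smul_sub]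
  have ir : ∀ m, Integrable (fun s => ‖ρ m s - σ s‖ ^ 2) (timeMeasure T) := fun m =>
    integrable_norm_sq ((hρ m).sub hσ)
  have hrB : ∀ m, ∫ s, ‖ρ m s - σ s‖ ^ 2 ∂timeMeasure T ≤ 2 * B ^ 2 := fun m => by
    have hhB := pow_le_pow_left₀ (norm_nonneg _) (hB m) 2
    rw [Lp_norm_sq_eq] at hhB
    refine (integral_mono_ae (ir m) ((integrable_norm_sq (Lp.memLp (h m))).const_mul 2) ?_).trans
      (by rw [integral_const_mul]; linarith)
    filter_upwards [hr m] with s hs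
    have h1 := pow_le_pow_left₀ (norm_nonneg _) (norm_prim_le (h m s)) 2
    rw [hs, norm_smul, mul_pow, Real.norm_of_nonneg (Real.sqrt_nonneg _),
      Real.sq_sqrt zero_le_two]
    linarith
  have h00 : (u₀ - u₀) (casH1 0) = 0 := by simp
  have hE : ∀ m, homEnergy (u₀ - u₀) + D⁻¹ * ∫ s, ‖ρ m s - σ s‖ ^ 2 ∂timeMeasure T ≤
      D⁻¹ * (2 * B ^ 2) := fun m => by
    rw [sub_self, homEnergy_zero, zero_add]
    exact mul_le_mul_of_nonneg_left (hrB m) (inv_pos.2 hD).le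
  set A := D⁻¹ * (2 * B ^ 2) with hA
  have hdx : ∀ m, ∫ s, ‖H1.dx ((um m).val s - u.val s)‖ ^ 2 ∂timeMeasure T ≤ 4 / D * A := fun m =>
    (integral_dx_le hT hD ha (hρ m) hσ (hum m) hu h00).trans
      (mul_le_mul_of_nonneg_left (hE m) (by positivity))
  have hq : ∀ m, ∫ s, quart ((um m).ct s - u.ct s) ∂timeMeasure T ≤ 4 * A := fun m =>
    (integral_quart_le hT hD ha (hρ m) hσ (hum m) hu h00).trans
      (mul_le_mul_of_nonneg_left (hE m) (by positivity))
  have idx : ∀ m, Integrable (fun s => ‖H1.dx ((um m).val s - u.val s)‖ ^ 2) (timeMeasure T) :=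
    fun m => integrable_norm_sq (memLp_dx_sub (um m) u)
  have iw : ∀ m, Integrable (fun s => ‖H1.toL2 ((um m).val s - u.val s)‖ ^ 2) (timeMeasure T) :=
    fun m => integrable_norm_sq (memLp_toL2_sub (um m) u)
  have hwL2 : ∀ m, ∫ s, ‖H1.toL2 ((um m).val s - u.val s)‖ ^ 2 ∂timeMeasure T ≤ 4 / D * A :=
    fun m => by
      refine (integral_mono_ae (iw m) (idx m) ?_).trans (hdx m)
      filter_upwards [ae_coef_zero (hρ m) hσ (hum m) hu h00] with s hs
      exact pow_le_pow_left₀ (norm_nonneg _) (norm_toL2_le_norm_dx _ hs) 2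
  have hlim := tendsto_integral_inner hT hD.le hρ hσ hum hu
    -- The summands bound, in order, the $L^2$ norm of the difference, the forcing, and the integral
    -- of $1$ plus the two quartic terms, the first of them through `integral_quart_le_of_sub`.
    (Q := 4 / D * A + 2 * B ^ 2 + ((∫ _s, (1 : ℝ) ∂timeMeasure T) +
      8 * ((∫ _s, (1 : ℝ) ∂timeMeasure T) + 4 * A + ∫ s, quart (u.ct s) ∂timeMeasure T) +
      ∫ s, quart (u.ct s) ∂timeMeasure T)) (R := 2 * B ^ 2 + 4 / D * A)
    (fun m => by
      have i3 : Integrable (fun s => 1 + quart ((um m).ct s) + quart (u.ct s)) (timeMeasure T) := by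
        simpa using integrable_quart_bound (um m) u 1
      have i12 : Integrable (fun s => ‖H1.toL2 ((um m).val s - u.val s)‖ ^ 2 +
          ‖ρ m s - σ s‖ ^ 2) (timeMeasure T) := (iw m).add (ir m)
      rw [integral_add i12 i3, integral_add (iw m) (ir m),
        integral_one_add_add (um m).integrable_quart u.integrable_quart]
      have h1 := integral_quart_le_of_sub (um m) u
      have h2 := hwL2 m
      have h3 := hrB m
      have h4 := hq m
      linarith)
    (fun m => by
      rw [integral_add (ir m) (idx m)]
      exact add_le_add (hrB m) (hdx m))
    (fun k => by
      obtain ⟨c, hc⟩ := exists_coef_prim_eq_inner k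
      convert tendstoUniformly_primitive hw hB c using 3 with m t
      refine intervalIntegral.integral_congr_ae ?_
      refine ae_uIoc_of_ae (p := fun s => coef k (ρ m s - σ s) = ⟪c, h m s⟫) ?_ t.2
      filter_upwards [hr m] with s hs
      rw [hs, hc])
  have hdx0 : Tendsto (fun m => ∫ s, ‖H1.dx ((um m).val s - u.val s)‖ ^ 2 ∂timeMeasure T)
      atTop (𝓝 0) := by
    have h1 := hlim.abs.const_mul (2 / D)
    rw [abs_zero, mul_zero] at h1
    refine squeeze_zero (fun m => integral_nonneg fun _ => sq_nonneg _) (fun m => ?_) h1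
    have h2 := integral_dx_le_abs hT ha hD.le (hρ m) hσ (hum m) hu
    rw [div_mul_eq_mul_div, le_div_iff₀ hD]
    linarith
  have hval : Tendsto (fun m => ‖H1.toL2‖ * √(2 * ∫ s, ‖H1.dx ((um m).val s - u.val s)‖ ^ 2
      ∂timeMeasure T)) atTop (𝓝 0) := by
    simpa using (hdx0.const_mul 2).sqrt.const_mul ‖H1.toL2‖
  refine squeeze_zero (fun m => norm_nonneg _) (fun m => ?_) hval
  refine (norm_toL2L2_sub_le _ _).trans (mul_le_mul_of_nonneg_left ?_
    (ContinuousLinearMap.opNorm_nonneg _))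
  exact Real.le_sqrt_of_sq_le (norm_val_sub_sq_le_dx (hρ m) hσ (hum m) hu h00)

/-- A nonnegative kernel of mass one cannot vanish at every point other than the origin, and the
weight $|x|^2$ is positive at all such points. -/
theorem diffusionConst_pos {J : ℝ → ℝ} (hJ : IsInteractionKernel J) : 0 < diffusionConst J := by
  have hle : (-1 / 2 : ℝ) ≤ 1 / 2 := by norm_num
  have hne : ∃ x ∈ Set.Ioo (-1 / 2 : ℝ) (1 / 2), x ≠ 0 ∧ J x ≠ 0 := by
    by_contra! hcon
    have h0 : ∫ x in (-1 / 2 : ℝ)..(1 / 2), J x = 0 := by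
      rw [intervalIntegral.integral_of_le hle]
      refine integral_eq_zero_of_ae ?_
      have hz : ∀ᵐ x : ℝ, x ≠ 0 := by simp [ae_iff]
      filter_upwards [ae_restrict_of_ae hz] with x hx
      by_contra hJx
      have hx2 : x ∈ Set.Ioo (-1 / 2 : ℝ) (1 / 2) := hJ.support (subset_tsupport J hJx)
      exact hJx (hcon x hx2 hx)
    rw [hJ.mass] at h0
    exact one_ne_zero h0
  obtain ⟨x, hx, hx0, hJx⟩ := hne
  have hc : Continuous fun x => J x * |x| ^ 2 := hJ.smooth.continuous.mul (by fun_prop)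
  refine intervalIntegral.integral_pos (by norm_num) hc.continuousOn
    (fun y _ => mul_nonneg (hJ.nonneg y) (sq_nonneg _)) ⟨x, ⟨hx.1.le, hx.2.le⟩, ?_⟩
  have : 0 < J x := lt_of_le_of_ne (hJ.nonneg x) (Ne.symm hJx)
  positivity

end CahnHilliard

end

/-! ### The main theorem. -/

theorem mainTheorem5 (T : ℝ) (hT : 0 < T)
    (J : ℝ → ℝ) (hJ : CahnHilliard.IsInteractionKernel J)
    (a : ℝ) (ha : a < 0) (u₀ : CahnHilliard.Hm1) (g : CahnHilliard.L2L2 T) :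
    (∃! u : CahnHilliard.SolutionSpace T,
      CahnHilliard.IsWeakSolution a (CahnHilliard.diffusionConst J) u₀ g u) ∧
    ∀ gm : ℕ → CahnHilliard.L2L2 T,
      Tendsto (fun m => toWeakSpace ℝ (CahnHilliard.L2L2 T) (gm m)) atTop
        (𝓝 (toWeakSpace ℝ (CahnHilliard.L2L2 T) g)) →
      ∀ (um : ℕ → CahnHilliard.SolutionSpace T) (u : CahnHilliard.SolutionSpace T),
        (∀ m, CahnHilliard.IsWeakSolution a (CahnHilliard.diffusionConst J) u₀ (gm m) (um m)) →
        CahnHilliard.IsWeakSolution a (CahnHilliard.diffusionConst J) u₀ g u →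
        Tendsto (fun m => ‖(um m).toL2L2 - u.toL2L2‖) atTop (𝓝 0) := by
  have hD := CahnHilliard.diffusionConst_pos hJ
  refine ⟨?_, fun gm hg um u hum hu =>
    CahnHilliard.tendsto_toL2L2_sub hT.le ha hD hg hum hu⟩
  obtain ⟨u, hu⟩ := CahnHilliard.exists_isWeakSolution ha hD hT.le u₀ g
  refine ⟨u, hu, fun v hv => ?_⟩
  rw [CahnHilliard.isWeakSolution_iff] at hu hv
  exact hv.unique hT.le hD ha
    ((CahnHilliard.prim.comp_memLp' (Lp.memLp g)).const_smul √2) hu
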